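/- Let $U\subset\mathbb R$ be a closed interval, let $H:U\to(0,1)$ be infinitely differentiable, let $v>0$, and let $M$ be a centred Gaussian random measure on $\mathbb R$ with $\operatorname{Cov}(M(A),M(B))=v\,|A\cap B|$ for Borel sets $A,B$ of finite Lebesgue measure. (For $v=1$ this is the standard Gaussian measure; for $v=2$ it is the symmetric $2$-stable random measure with Lebesgue control measure, $\mathbb E e^{i\theta M(A)}=e^{-\theta^2|A|}$.) Let $X$ be the multifractional Brownian motion $$X(t)=\int_{\mathbb R}\bigl(|t-s|^{H(t)-1/2}-|s|^{H(t)-1/2}\bigr)\,M(ds),\qquad t\in U.$$ Fix $t_0$ in the interior of $U$ with $H(t_0)\neq 1/2$; integers $L\ge1$, $K\ge1$ and real numbers $a_0,\dots,a_K$ with $\sum_{k=0}^K k^q a_k=0$ for $q=0,\dots,L$ (with $0^0=1$) and $\sum_{k=0}^K k^{L+1}a_k\ne0$; a number $\gamma$ with $\sup_{t\in U}H(t)<\gamma<1$; and $\beta\in(-1/2,0)$. For real $r>0$ and $k\in\mathbb Z$ put $$\triangle_{k,r}X=\sum_{p=0}^K a_p X\Bigl(\frac{k+p}{r}\Bigr),\qquad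 \nu_{\gamma,r}(t_0)=\Bigl\{k\in\mathbb Z:\ \Bigl|\frac{k+p}{r}-t_0\Bigr|\le \frac1{r^{\gamma}}\ \text{ for } p=0,\dots,K\Bigr\},$$ $$V_{t_0,r}(\beta)=\frac{1}{\#\nu_{\gamma,r}(t_0)}\sum_{k\in\nu_{\gamma,r}(t_0)}|\triangle_{k,r}X|^{\beta},\qquad W_{t_0,r}(\beta)=r^{\beta H(t_0)}V_{t_0,r}(\beta),\qquad \widehat H_n(t_0)=\frac1\beta\log_2\frac{V_{t_0,n/2}(\beta)}{V_{t_0,n}(\beta)}.$$ Put $$M_{t_0}=\Bigl(\int_{\mathbb R}\Bigl|\sum_{p=0}^K a_p|p-s|^{H(t_0)-1/2}\Bigr|^2ds\Bigr)^{1/2},\qquad C_\beta=\frac{2^{\beta+1/2}\,\Gamma(\frac{\beta+1}{2})}{\Gamma(-\frac\beta2)},\qquad M_{t_0,\beta}=\frac{M_{t_0}^{\beta}C_\beta}{\sqrt{2\pi}}\int_{\mathbb R}\frac{e^{-v y^2/2}}{|y|^{1+\beta}}\,dy,$$ $$d_n=\begin{cases} n^{H(t_0)-\gamma} & \text{if }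 H(t_0)<\gamma\le\frac{1+2H(t_0)}3,\\ n^{(\gamma-1)/2} & \text{if } \gamma>\frac{1+2H(t_0)}3.\end{cases}$$ Write $X_n=O_{\mathbb P}(1)$ if for every $\epsilon>0$ there is $C>0$ with $\sup_n\mathbb P(|X_n|>C)<\epsilon$, and $Y_n=O_{\mathbb P}(d_n)$ if $Y_n=d_nX_n$ for all large $n$, with $X_n=O_{\mathbb P}(1)$. For all sufficiently large real $r$, the set $\nu_{\gamma,r}(t_0)$ is finite and non-empty, all the points $(k+p)/r$ with $k\in\nu_{\gamma,r}(t_0)$, $0\le p\le K$, lie in $U$, and $\triangle_{k,r}X\ne0$ almost surely for every $k\in\nu_{\gamma,r}(t_0)$, so that the quantities above make sense. Moreover, as $n\to\infty$ through the positive integers: 1. $W_{t_0,n}(\beta)\to M_{t_0,\beta}$ in probability, and $W_{t_0,n}(\beta)-M_{t_0,\beta}=O_{\mathbb P}(d_n)$; 2. $\widehat H_n(t_0)\to H(t_0)$ in probability, and $\widehat H_n(t_0)-H(t_0)=O_{\mathbb P}(d_n)$. -/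

import Mathlib

open MeasureTheory ProbabilityTheory Filter Topology
open scoped ENNReal

namespace MultifracBM

noncomputable section

/-- `M` is a Gaussian random measure on `ℝ` with intensity `v` times Lebesgue measure: the family
`M A`, indexed by the Borel sets `A` of finite Lebesgue measure, is a centred Gaussian family with
`Cov (M A, M B) = v * |A ∩ B|`. For `v = 1` it is the standard Gaussian measure (white noise). For
`v = 2` it is the symmetric `2`-stable random measure whose control measure is Lebesgue measure,
`E exp (i θ M A) = exp (- |θ| ^ 2 * |A|)`. -/
structure IsGaussianRandomMeasure {Ω : Type*} [MeasurableSpace Ω] (μ : Measure Ω) (v : ℝ)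
    (M : Set ℝ → Ω → ℝ) : Prop where
  isGaussianProcess :
    IsGaussianProcess (fun A : {A : Set ℝ // MeasurableSet A ∧ volume A < ∞} => M A.1) μ
  centered : ∀ A : Set ℝ, MeasurableSet A → volume A < ∞ → ∫ ω, M A ω ∂μ = 0
  covariance_eq : ∀ A B : Set ℝ, MeasurableSet A → volume A < ∞ → MeasurableSet B →
    volume B < ∞ → cov[M A, M B; μ] = v * volume.real (A ∩ B)

/-- The integral `∫ φ dM = ∑ c * M {φ = c}` of a simple function `φ` (the value `c = 0`
contributes nothing). -/
def simpleIntegral {Ω : Type*} (M : Set ℝ → Ω → ℝ) (φ : SimpleFunc ℝ ℝ) (ω : Ω) : ℝ :=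
  ∑ c ∈ φ.range, c * M (φ ⁻¹' {c}) ω

/-- `Y` is (a version of) the Wiener integral `∫ f dM` of `f ∈ L²(ℝ)`: the limit in `L²(μ)` of the
integrals of simple functions that converge to `f` in `L²(ℝ)`. -/
def IsWienerIntegral {Ω : Type*} [MeasurableSpace Ω] (μ : Measure Ω) (M : Set ℝ → Ω → ℝ)
    (f : ℝ → ℝ) (Y : Ω → ℝ) : Prop :=
  MemLp f 2 volume ∧ MemLp Y 2 μ ∧
    ∃ φ : ℕ → SimpleFunc ℝ ℝ, (∀ n, MemLp (φ n) 2 volume) ∧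
      Tendsto (fun n => eLpNorm (fun s => φ n s - f s) 2 volume) atTop (𝓝 0) ∧
      Tendsto (fun n => eLpNorm (fun ω => simpleIntegral M (φ n) ω - Y ω) 2 μ) atTop (𝓝 0)

/-- `X` is, on `U`, the multifractional Brownian motion with multifractional function `H` driven by
`M`: `X t = ∫ (|t - s| ^ (H t - 1/2) - |s| ^ (H t - 1/2)) M(ds)` for every `t ∈ U`. -/
def IsMultifractionalBM {Ω : Type*} [MeasurableSpace Ω] (μ : Measure Ω) (M : Set ℝ → Ω → ℝ)
    (U : Set ℝ) (H : ℝ → ℝ) (X : ℝ → Ω → ℝ) : Prop :=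
  ∀ t ∈ U, IsWienerIntegral μ M
    (fun s => |t - s| ^ (H t - 1 / 2) - |s| ^ (H t - 1 / 2)) (X t)

/-- The discrete variation `∑ₚ aₚ X ((k + p) / r)`. The scale `r` is real, so that `r = n / 2` makes
sense for every integer `n`. -/
def variation {Ω : Type*} {K : ℕ} (a : Fin (K + 1) → ℝ) (X : ℝ → Ω → ℝ) (r : ℝ) (k : ℤ)
    (ω : Ω) : ℝ :=
  ∑ p : Fin (K + 1), a p * X (((k : ℝ) + (p : ℕ)) / r) ω

/-- The integers `k` for which all the points `(k + p) / r`, `0 ≤ p ≤ K`, are at distance at most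
`1 / r ^ γ` from `t₀`. -/
def window (K : ℕ) (γ t₀ r : ℝ) : Set ℤ :=
  {k : ℤ | ∀ p : Fin (K + 1), |((k : ℝ) + (p : ℕ)) / r - t₀| ≤ 1 / r ^ γ}

/-- The local `β`-power variation `V_{t₀,r}(β)`. -/
def V {Ω : Type*} {K : ℕ} (a : Fin (K + 1) → ℝ) (X : ℝ → Ω → ℝ) (γ β t₀ r : ℝ) (ω : Ω) : ℝ :=
  1 / ((window K γ t₀ r).ncard : ℝ) * ∑ᶠ k ∈ window K γ t₀ r, |variation a X r k ω| ^ β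

/-- The normalized variation `W_{t₀,r}(β) = r ^ (β H(t₀)) V_{t₀,r}(β)`. -/
def W {Ω : Type*} {K : ℕ} (a : Fin (K + 1) → ℝ) (H : ℝ → ℝ) (X : ℝ → Ω → ℝ) (γ β t₀ r : ℝ)
    (ω : Ω) : ℝ :=
  r ^ (β * H t₀) * V a X γ β t₀ r ω

/-- The estimator `(1 / β) log₂ (V_{t₀,r/2}(β) / V_{t₀,r}(β))` of `H(t₀)`. -/
def HHat {Ω : Type*} {K : ℕ} (a : Fin (K + 1) → ℝ) (X : ℝ → Ω → ℝ) (γ β t₀ r : ℝ) (ω : Ω) : ℝ :=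
  1 / β * Real.logb 2 (V a X γ β t₀ (r / 2) ω / V a X γ β t₀ r ω)

/-- `M_{t₀} = (∫ |∑ₚ aₚ |p - s| ^ (h - 1/2)|² ds) ^ (1/2)`, where `h = H(t₀)`. -/
def scaleConst {K : ℕ} (a : Fin (K + 1) → ℝ) (h : ℝ) : ℝ :=
  (∫ s : ℝ, |∑ p : Fin (K + 1), a p * |((p : ℕ) : ℝ) - s| ^ (h - 1 / 2)| ^ 2) ^ (1 / 2 : ℝ)

/-- `C_β = 2 ^ (β + 1/2) Γ((β + 1) / 2) / Γ(-β / 2)`. -/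
def constC (β : ℝ) : ℝ :=
  2 ^ (β + 1 / 2) * Real.Gamma ((β + 1) / 2) / Real.Gamma (-β / 2)

/-- `M_{t₀,β} = M_{t₀} ^ β C_β / √(2π) ∫ exp (-v y² / 2) / |y| ^ (1 + β) dy`, where `v` is the
variance of the noise per unit length; `exp (-v y² / 2)` is the characteristic function of a
centred Gaussian variable of variance `v`. -/
def limitConst {K : ℕ} (a : Fin (K + 1) → ℝ) (h v β : ℝ) : ℝ :=
  scaleConst a h ^ β * constC β / √(2 * Real.pi) *
    ∫ y : ℝ, Real.exp (-(v * |y| ^ 2 / 2)) / |y| ^ (1 + β)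

/-- The rate `d_n`, where `h = H(t₀) < γ`. -/
def rate (h γ : ℝ) (n : ℕ) : ℝ :=
  if γ ≤ (1 + 2 * h) / 3 then (n : ℝ) ^ (h - γ) else (n : ℝ) ^ ((γ - 1) / 2)

/-- `X_n = O_P(1)`. -/
def IsBoundedInProb {Ω : Type*} [MeasurableSpace Ω] (μ : Measure Ω) (X : ℕ → Ω → ℝ) : Prop :=
  ∀ ε : ℝ, 0 < ε → ∃ C : ℝ, 0 < C ∧ (⨆ n, μ {ω | C < |X n ω|}) < ENNReal.ofReal ε

/-- `Y_n = O_P(d_n)`: `Y_n = d_n X_n` with `X_n = O_P(1)`. The `Y_n` need to make sense for all large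
`n` only, so the equation is asked for those. -/
def IsBigOInProb {Ω : Type*} [MeasurableSpace Ω] (μ : Measure Ω) (Y : ℕ → Ω → ℝ) (d : ℕ → ℝ) :
    Prop :=
  ∃ X : ℕ → Ω → ℝ, IsBoundedInProb μ X ∧ ∀ᶠ n in atTop, ∀ ω, Y n ω = d n * X n ω

end

end MultifracBM

open MultifracBM

/-! Write h = H(t₀), ξ_k = r^h △_{k,r}X, and let m be the limit constant. The ξ_k are centred
Gaussian, and W is the average of |ξ_k|^β over the window. If H were constant, self-similarity would
make (ξ_k) stationary with covariances v R(j), where R(j) = ∫ G(x) G(x - j) dx and G = `filteredPow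
a (h - 1/2)`. In L² the kernel is Lipschitz in the Hurst index (`exists_eLpNorm_fbmKernel_sub_le`),
and H moves by O(r^(-γ)) over the window. Freezing H at h therefore changes each rescaled kernel by
O(r^(h-γ)) (`exists_variationKernel_estimate`), which bounds both the bias of W and the error in the
covariances.

The fluctuations are controlled by a bound quadratic in the correlation ρ
(`HasGaussianLaw.lintegral_abs_rpow_mul_le`). A negative power is a positive mixture of the
functions exp(-u x²/2), and the joint Laplace transform of two squared Gaussians is A^(-1/2) with A
affine in ρ². By convexity the mixed moment is at most the (1 - ρ², ρ²)-interpolation between the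
independent and the fully correlated case. The latter involves a moment of order 2β, finite because
β > -1/2.

Since a has vanishing moments of orders 0 and 1, G decays like |x|^(-3/2), so R(j) = O(|j|^(-3/2))
is square summable. Summing ρ² over pairs in a window of N ≥ r^(1-γ) integers gives E(W - m)² =
O(r^(2(h-γ)) + r^(γ-1)), which is the order of the squared rate; h ≠ 1/2 ensures that G is not zero.
Chebyshev's inequality yields the claim on W. The claim on the estimator follows because its error
is a difference of logarithms of W at two scales, divided by β log 2. -/

namespace MultifracBM

/-! ### Negative moments of Gaussian vectors -/

/-- Convexity of z ↦ z^(-1/2), obtained by averaging its tangent-line inequality at the interpolated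
point. -/
lemma inv_sqrt_convex {A₀ A₁ θ : ℝ} (h₀ : 0 < A₀) (h₁ : 0 < A₁) (hθ : 0 ≤ θ) (hθ1 : θ ≤ 1) :
    (√((1 - θ) * A₀ + θ * A₁))⁻¹ ≤ (1 - θ) * (√A₀)⁻¹ + θ * (√A₁)⁻¹ := by
  set A := (1 - θ) * A₀ + θ * A₁ with hA
  have hApos : 0 < A := by
    rcases hθ.eq_or_lt with h | h
    · simp [hA, ← h, h₀]
    · have : 0 < θ * A₁ := by positivity
      have : 0 ≤ (1 - θ) * A₀ := mul_nonneg (by linarith) h₀.le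
      linarith
  -- The left side is the tangent at A, evaluated at B; in terms of the square roots the gap is a
  -- square times a positive factor.
  have key : ∀ B : ℝ, 0 < B → (√A)⁻¹ * ((3 - B / A) / 2) ≤ (√B)⁻¹ := by
    intro B hB
    have ha : 0 < √A := Real.sqrt_pos.2 hApos
    have hb : 0 < √B := Real.sqrt_pos.2 hB
    have hA2 : A = √A ^ 2 := (Real.sq_sqrt hApos.le).symm
    have hB2 : B = √B ^ 2 := (Real.sq_sqrt hB.le).symm
    generalize √A = x at *
    generalize √B = y at *
    subst hB2
    rw [hA2, ← sub_nonneg]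
    have : y⁻¹ - x⁻¹ * ((3 - y ^ 2 / x ^ 2) / 2) = (x - y) ^ 2 * (2 * x + y) / (2 * x ^ 3 * y) := by
      field_simp
      ring
    rw [this]
    positivity
  have e : (1 - θ) * ((√A)⁻¹ * ((3 - A₀ / A) / 2)) + θ * ((√A)⁻¹ * ((3 - A₁ / A) / 2))
      = (√A)⁻¹ := by
    have : (1 - θ) * A₀ / A + θ * A₁ / A = 1 := by
      rw [← add_div]; exact div_self hApos.ne'
    linear_combination (-(√A)⁻¹ / 2) * this
  rw [← e]
  exact add_le_add (mul_le_mul_of_nonneg_left (key _ h₀) (by linarith))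
    (mul_le_mul_of_nonneg_left (key _ h₁) hθ)

lemma lintegral_exp_neg_mul_sq_gaussianReal {w : ℝ} (hw : 0 ≤ w) (m : ℝ) (s : NNReal) :
    ∫⁻ x, ENNReal.ofReal (Real.exp (-(w * x ^ 2 / 2))) ∂gaussianReal m s =
      ENNReal.ofReal ((√(1 + w * s))⁻¹ * Real.exp (-(w * m ^ 2 / (2 * (1 + w * s))))) := by
  rcases eq_or_ne s 0 with rfl | hs
  · simp
  have hs0 : (0 : ℝ) < s := by positivity
  have hD : 0 < 1 + w * s := by positivity
  have hint : Integrable (fun x => Real.exp (-(w * x ^ 2 / 2))) (gaussianReal m s) := by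
    refine Integrable.of_bound (C := 1) (by fun_prop) (ae_of_all _ fun x => ?_)
    rw [Real.norm_eq_abs, Real.abs_exp, Real.exp_le_one_iff]
    have : 0 ≤ w * x ^ 2 / 2 := by positivity
    linarith
  rw [← ofReal_integral_eq_lintegral_ofReal hint (ae_of_all _ fun x => (Real.exp_pos _).le)]
  congr 1
  rw [integral_gaussianReal_eq_integral_smul hs]
  have h1 : ∀ x : ℝ, gaussianPDFReal m s x • Real.exp (-(w * x ^ 2 / 2)) =
      ((√(2 * Real.pi * s))⁻¹ * Real.exp (-(w * m ^ 2 / (2 * (1 + w * s))))) *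
        Real.exp (-((1 + w * s) / (2 * s)) * (x - m / (1 + w * s)) ^ 2) := by
    intro x
    rw [gaussianPDFReal, smul_eq_mul, mul_assoc, ← Real.exp_add,
      mul_assoc (√(2 * Real.pi * s))⁻¹, ← Real.exp_add]
    congr 2
    field_simp
    ring
  simp_rw [h1]
  rw [integral_const_mul,
    integral_sub_right_eq_self (fun x => Real.exp (-((1 + w * s) / (2 * s)) * x ^ 2)),
    integral_gaussian]
  have h2 : Real.pi / ((1 + w * s) / (2 * s)) = (2 * Real.pi * s) / (1 + w * s) := by
    field_simp
  rw [h2, Real.sqrt_div (by positivity)]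
  have : √(2 * Real.pi * s) ≠ 0 := by positivity
  field_simp

/-- Regress Y on X: the residual R = Y - lX is uncorrelated with X, hence independent of it.
Integrating out R and then X leaves two one-dimensional Gaussian integrals. The radicand is det(I +
Σ diag(u, w)), Σ being the covariance matrix; only the square of the covariance enters. -/
lemma HasGaussianLaw.lintegral_exp_neg_quadratic {Ω : Type*} [MeasurableSpace Ω] {μ : Measure Ω}
    [IsProbabilityMeasure μ] {X Y : Ω → ℝ} (hXY : HasGaussianLaw (fun ω => (X ω, Y ω)) μ)
    (hX0 : ∫ ω, X ω ∂μ = 0) (hY0 : ∫ ω, Y ω ∂μ = 0) (hXpos : 0 < Var[X; μ])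
    {u w : ℝ} (hu : 0 ≤ u) (hw : 0 ≤ w) :
    ∫⁻ ω, ENNReal.ofReal (Real.exp (-(u * X ω ^ 2 / 2)) * Real.exp (-(w * Y ω ^ 2 / 2))) ∂μ =
      ENNReal.ofReal (√((1 + u * Var[X; μ]) * (1 + w * Var[Y; μ])
        - u * w * cov[X, Y; μ] ^ 2))⁻¹ := by
  set σ := Var[X; μ] with hσ
  set τ := Var[Y; μ] with hτ
  set c := cov[X, Y; μ] with hc
  set l := c / σ with hl
  have hXm : AEMeasurable X μ := hXY.fst.aemeasurable
  have hYm : AEMeasurable Y μ := hXY.snd.aemeasurable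
  have hX2 : MemLp X 2 μ := hXY.fst.memLp_two
  have hY2 : MemLp Y 2 μ := hXY.snd.memLp_two
  let R : Ω → ℝ := fun ω => Y ω - l * X ω
  have hXR : HasGaussianLaw (fun ω => (X ω, R ω)) μ := by
    let T : ℝ × ℝ →L[ℝ] ℝ × ℝ := (ContinuousLinearMap.fst ℝ ℝ ℝ).prod
      (ContinuousLinearMap.snd ℝ ℝ ℝ - l • ContinuousLinearMap.fst ℝ ℝ ℝ)
    have := hXY.map T
    exact this
  have hRm : AEMeasurable R μ := hXR.snd.aemeasurable
  have hlX2 : MemLp (fun ω => l * X ω) 2 μ := hX2.const_mul l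
  have hlc : l * σ = c := by rw [hl]; field_simp
  have hcov : cov[X, R; μ] = 0 := by
    have : cov[X, R; μ] = cov[X, Y; μ] - cov[X, fun ω => l * X ω; μ] :=
      covariance_fun_sub_right hX2 hY2 hlX2
    rw [this, covariance_const_mul_right, covariance_self hXm, ← hσ, ← hc, hlc, sub_self]
  have hR0 : ∫ ω, R ω ∂μ = 0 := by
    have : ∫ ω, R ω ∂μ = ∫ ω, Y ω ∂μ - ∫ ω, l * X ω ∂μ :=
      integral_sub (hY2.integrable (by norm_num)) (hlX2.integrable (by norm_num))
    rw [this, integral_const_mul, hX0, hY0]; simp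
  have hRvar : Var[R; μ] = τ - l ^ 2 * σ := by
    have : Var[R; μ] = Var[Y; μ] - 2 * cov[Y, fun ω => l * X ω; μ] + Var[fun ω => l * X ω; μ] :=
      variance_fun_sub hY2 hlX2
    rw [this, covariance_const_mul_right, variance_const_mul, covariance_comm, ← hc, ← hτ, ← hσ,
      ← hlc]
    ring
  have hs : ((Var[R; μ]).toNNReal : ℝ) = τ - l ^ 2 * σ := by
    rw [Real.coe_toNNReal _ (variance_nonneg _ _), hRvar]
  have hσ' : ((Var[X; μ]).toNNReal : ℝ) = σ := Real.coe_toNNReal _ (variance_nonneg _ _)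
  have hindep := (indepFun_iff_map_prod_eq_prod_map_map hXm hRm).1
    (hXR.indepFun_of_covariance_eq_zero hcov)
  have hlawX : μ.map X = gaussianReal 0 (Var[X; μ]).toNNReal := by
    rw [hXR.fst.map_eq_gaussianReal, hX0]
  have hlawR : μ.map R = gaussianReal 0 (Var[R; μ]).toNNReal := by
    have := hXR.snd.map_eq_gaussianReal
    rwa [hR0] at this
  have hmeas : Measurable fun p : ℝ × ℝ => ENNReal.ofReal (Real.exp (-(u * p.1 ^ 2 / 2)) *
      Real.exp (-(w * (l * p.1 + p.2) ^ 2 / 2))) := by fun_prop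
  have step1 : ∫⁻ ω, ENNReal.ofReal (Real.exp (-(u * X ω ^ 2 / 2)) *
        Real.exp (-(w * Y ω ^ 2 / 2))) ∂μ =
      ∫⁻ p, ENNReal.ofReal (Real.exp (-(u * p.1 ^ 2 / 2)) *
        Real.exp (-(w * (l * p.1 + p.2) ^ 2 / 2))) ∂(μ.map fun ω => (X ω, R ω)) := by
    rw [lintegral_map' hmeas.aemeasurable (hXm.prodMk hRm)]
    refine lintegral_congr fun ω => ?_
    simp [R]
  rw [step1, hindep, lintegral_prod _ hmeas.aemeasurable, hlawX, hlawR]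
  have hD : 0 < 1 + w * (τ - l ^ 2 * σ) := by
    have : 0 ≤ τ - l ^ 2 * σ := hs ▸ NNReal.coe_nonneg _
    positivity
  have inner : ∀ x : ℝ, ∫⁻ y, ENNReal.ofReal (Real.exp (-(u * x ^ 2 / 2)) *
        Real.exp (-(w * (l * x + y) ^ 2 / 2))) ∂(gaussianReal 0 (Var[R; μ]).toNNReal) =
      ENNReal.ofReal (√(1 + w * (τ - l ^ 2 * σ)))⁻¹ * ENNReal.ofReal (Real.exp
        (-((u + w * l ^ 2 / (1 + w * (τ - l ^ 2 * σ))) * x ^ 2 / 2))) := by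
    intro x
    have e1 : ∀ y, ENNReal.ofReal (Real.exp (-(u * x ^ 2 / 2)) *
        Real.exp (-(w * (l * x + y) ^ 2 / 2))) = ENNReal.ofReal (Real.exp (-(u * x ^ 2 / 2))) *
        (fun z => ENNReal.ofReal (Real.exp (-(w * z ^ 2 / 2)))) (l * x + y) := fun y =>
      ENNReal.ofReal_mul (Real.exp_pos _).le
    simp_rw [e1]
    rw [lintegral_const_mul _ (by fun_prop)]
    rw [← lintegral_map (f := fun z => ENNReal.ofReal (Real.exp (-(w * z ^ 2 / 2))))
      (g := fun y => l * x + y) (by fun_prop) (by fun_prop), gaussianReal_map_const_add,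
      lintegral_exp_neg_mul_sq_gaussianReal hw, hs, ← ENNReal.ofReal_mul (Real.exp_pos _).le,
      ← ENNReal.ofReal_mul (by positivity), mul_left_comm, ← Real.exp_add]
    congr 3
    field_simp
    ring
  simp_rw [inner]
  rw [lintegral_const_mul _ (by fun_prop), lintegral_exp_neg_mul_sq_gaussianReal (by positivity),
    hσ', ← ENNReal.ofReal_mul (by positivity)]
  congr 1
  simp only [ne_eq, OfNat.ofNat_ne_zero, not_false_eq_true, zero_pow, mul_zero, zero_div, neg_zero,
    Real.exp_zero, mul_one]
  rw [← mul_inv, ← Real.sqrt_mul hD.le]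
  congr 2
  rw [← hlc]
  field_simp
  ring

/-- The absolute moment of order `β` of the standard normal distribution. -/
noncomputable def normalAbsMoment (β : ℝ) : ℝ := ∫ x, |x| ^ β ∂gaussianReal 0 1

lemma integrable_comp_abs {f : ℝ → ℝ} (hf : IntegrableOn f (Set.Ioi 0)) :
    Integrable (fun x => f |x|) := by
  have h1 : IntegrableOn (fun x => f |x|) (Set.Ioi 0) :=
    hf.congr_fun (fun x hx => by simp [abs_of_pos (Set.mem_Ioi.1 hx)]) measurableSet_Ioi
  have h2 : IntegrableOn (fun x => f |x|) (Set.Iic 0) := by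
    rw [integrableOn_Iic_iff_integrableOn_Iio]
    have : IntegrableOn (fun x => f |-x|) (Set.Iio 0) := by
      have := (IntegrableOn.comp_neg_Iio (f := fun x => f |x|) (c := 0)) (by simpa using h1)
      exact this
    simpa using this
  rw [← integrableOn_univ, ← Set.Iic_union_Ioi (a := (0 : ℝ))]
  exact h2.union h1

lemma integrable_abs_rpow_mul_exp_neg {β b : ℝ} (hβ : -1 < β) (hb : 0 < b) :
    Integrable (fun x : ℝ => |x| ^ β * Real.exp (-b * |x| ^ 2)) :=
  integrable_comp_abs (integrableOn_rpow_mul_exp_neg_mul_sq hb hβ)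

lemma integrable_abs_rpow_gaussianReal {β : ℝ} (hβ : -1 < β) :
    Integrable (fun x : ℝ => |x| ^ β) (gaussianReal 0 1) := by
  rw [gaussianReal_of_var_ne_zero _ one_ne_zero,
    integrable_withDensity_iff (measurable_gaussianPDF _ _) (ae_of_all _ fun _ => gaussianPDF_lt_top)]
  have := (integrable_abs_rpow_mul_exp_neg hβ (one_half_pos (α := ℝ))).const_mul
    (√(2 * Real.pi))⁻¹
  refine this.congr (ae_of_all _ fun x => ?_)
  simp only [toReal_gaussianPDF, gaussianPDFReal, sq_abs, NNReal.coe_one, mul_one, sub_zero]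
  rw [show -x ^ 2 / 2 = -(1 / 2) * x ^ 2 by ring]
  ring

lemma normalAbsMoment_eq {β : ℝ} (hβ : -1 < β) :
    normalAbsMoment β = 2 ^ (β / 2) * Real.Gamma ((β + 1) / 2) / √Real.pi := by
  rw [normalAbsMoment, integral_gaussianReal_eq_integral_smul one_ne_zero]
  have h1 : ∀ x : ℝ, gaussianPDFReal 0 1 x • |x| ^ β =
      (√(2 * Real.pi))⁻¹ * (fun y : ℝ => y ^ β * Real.exp (-(1 / 2) * y ^ (2 : ℝ))) |x| := by
    intro x
    simp only [gaussianPDFReal, NNReal.coe_one, mul_one, sub_zero, smul_eq_mul, Real.rpow_two,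
      sq_abs]
    rw [show -x ^ 2 / 2 = -(1 / 2) * x ^ 2 by ring]
    ring
  simp_rw [h1]
  rw [integral_const_mul, integral_comp_abs (f := fun y : ℝ => y ^ β * Real.exp (-(1 / 2) * y ^ (2 : ℝ))),
    integral_rpow_mul_exp_neg_mul_rpow two_pos hβ one_half_pos, Real.sqrt_mul two_pos.le,
    one_div, Real.inv_rpow two_pos.le, ← Real.rpow_neg two_pos.le,
    show -(-(β + 1) / 2) = β / 2 + 1 / 2 by ring, Real.rpow_add two_pos, ← Real.sqrt_eq_rpow]
  have : √(2 : ℝ) ≠ 0 := by positivity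
  field_simp

lemma normalAbsMoment_pos {β : ℝ} (hβ : -1 < β) : 0 < normalAbsMoment β := by
  rw [normalAbsMoment_eq hβ]
  have := Real.Gamma_pos_of_pos (show 0 < (β + 1) / 2 by linarith)
  positivity

lemma map_sqrt_mul_gaussianReal (s : NNReal) :
    (gaussianReal 0 1).map (fun x => √s * x) = gaussianReal 0 s := by
  rw [gaussianReal_map_const_mul, mul_zero, mul_one]
  congr 1
  ext
  simp

lemma lintegral_abs_rpow_gaussianReal {β : ℝ} (hβ : -1 < β) (s : NNReal) :
    ∫⁻ x, ENNReal.ofReal (|x| ^ β) ∂gaussianReal 0 s =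
      ENNReal.ofReal (√s ^ β * normalAbsMoment β) := by
  rw [← map_sqrt_mul_gaussianReal, lintegral_map (by fun_prop) (by fun_prop), normalAbsMoment,
    ENNReal.ofReal_mul (by positivity), ofReal_integral_eq_lintegral_ofReal
      (integrable_abs_rpow_gaussianReal hβ) (ae_of_all _ fun x => by positivity),
    ← lintegral_const_mul _ (by fun_prop)]
  refine lintegral_congr fun x => ?_
  rw [← ENNReal.ofReal_mul (by positivity), abs_mul, abs_of_nonneg (Real.sqrt_nonneg _),
    Real.mul_rpow (Real.sqrt_nonneg _) (abs_nonneg _)]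

/-- A negative power as a mixture of Gaussians. -/
lemma ofReal_abs_rpow_eq_lintegral {β : ℝ} (hβ : β < 0) {x : ℝ} (hx : x ≠ 0) :
    ENNReal.ofReal (|x| ^ β) = ENNReal.ofReal (2 ^ (β / 2) / Real.Gamma (-β / 2)) *
      ∫⁻ u in Set.Ioi (0 : ℝ), ENNReal.ofReal (u ^ (-β / 2 - 1)) *
        ENNReal.ofReal (Real.exp (-(u * x ^ 2 / 2))) := by
  have ha : 0 < -β / 2 := by linarith
  have hr : 0 < x ^ 2 / 2 := by positivity
  have hG := Real.Gamma_pos_of_pos ha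
  have hval := Real.integral_rpow_mul_exp_neg_mul_Ioi ha hr
  have hint : IntegrableOn (fun u => u ^ (-β / 2 - 1) * Real.exp (-(x ^ 2 / 2 * u)))
      (Set.Ioi 0) := by
    -- A non-integrable function would have integral zero, contradicting the positive value in
    -- `hval`.
    by_contra h
    rw [integral_undef h] at hval
    have : 0 < (1 / (x ^ 2 / 2)) ^ (-β / 2) * Real.Gamma (-β / 2) := by positivity
    linarith
  have e : ∫⁻ u in Set.Ioi (0 : ℝ), ENNReal.ofReal (u ^ (-β / 2 - 1)) *
        ENNReal.ofReal (Real.exp (-(u * x ^ 2 / 2))) =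
      ENNReal.ofReal ((1 / (x ^ 2 / 2)) ^ (-β / 2) * Real.Gamma (-β / 2)) := by
    rw [← hval, ofReal_integral_eq_lintegral_ofReal hint]
    · refine setLIntegral_congr_fun measurableSet_Ioi fun u hu => ?_
      have : 0 < u := hu
      rw [← ENNReal.ofReal_mul (by positivity)]
      congr 4
      ring
    · refine (ae_restrict_iff' measurableSet_Ioi).2 (ae_of_all _ fun u hu => ?_)
      have : 0 < u := hu
      simp only [Pi.zero_apply]
      positivity
  rw [e, ← ENNReal.ofReal_mul (by positivity)]
  congr 1
  have h1 : (1 / (x ^ 2 / 2)) = 2 * (|x| ^ (-2 : ℝ)) := by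
    rw [Real.rpow_neg (abs_nonneg _), Real.rpow_two, sq_abs]
    field_simp
  rw [h1, Real.mul_rpow two_pos.le (by positivity), ← Real.rpow_mul (abs_nonneg _),
    show (-2 : ℝ) * (-β / 2) = β by ring, div_mul_eq_mul_div, ← mul_assoc, ← mul_assoc,
    ← Real.rpow_add two_pos, show β / 2 + -β / 2 = 0 by ring, Real.rpow_zero, one_mul,
    mul_div_assoc, div_self hG.ne', mul_one]

/-- The mixture formula in both factors, then Tonelli. The weights are nonnegative, so inequalities
between Laplace transforms of squares pass to negative moments. The axes must be null: there the
power takes the default value 0 while the mixture diverges. -/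
lemma lintegral_abs_rpow_mul_abs_rpow {β : ℝ} (hβ : β < 0) (ν : Measure (ℝ × ℝ)) [SFinite ν]
    (hν : ∀ᵐ p ∂ν, p.1 ≠ 0 ∧ p.2 ≠ 0) :
    ∫⁻ p, ENNReal.ofReal (|p.1| ^ β * |p.2| ^ β) ∂ν =
      ENNReal.ofReal (2 ^ (β / 2) / Real.Gamma (-β / 2)) ^ 2 *
      ∫⁻ q, ENNReal.ofReal (q.1 ^ (-β / 2 - 1)) * ENNReal.ofReal (q.2 ^ (-β / 2 - 1)) *
        ∫⁻ p, ENNReal.ofReal (Real.exp (-(q.1 * p.1 ^ 2 / 2)) * Real.exp (-(q.2 * p.2 ^ 2 / 2))) ∂ν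
        ∂((volume.restrict (Set.Ioi (0 : ℝ))).prod (volume.restrict (Set.Ioi (0 : ℝ)))) := by
  set c := ENNReal.ofReal (2 ^ (β / 2) / Real.Gamma (-β / 2))
  set κ := (volume.restrict (Set.Ioi (0 : ℝ))).prod (volume.restrict (Set.Ioi (0 : ℝ)))
  have h1 : ∫⁻ p, ENNReal.ofReal (|p.1| ^ β * |p.2| ^ β) ∂ν =
      ∫⁻ p, c ^ 2 * ∫⁻ q, ENNReal.ofReal (q.1 ^ (-β / 2 - 1)) *
        ENNReal.ofReal (Real.exp (-(q.1 * p.1 ^ 2 / 2))) * (ENNReal.ofReal (q.2 ^ (-β / 2 - 1)) *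
        ENNReal.ofReal (Real.exp (-(q.2 * p.2 ^ 2 / 2)))) ∂κ ∂ν := by
    refine lintegral_congr_ae (hν.mono fun p hp => ?_)
    dsimp only
    rw [lintegral_prod_mul (f := fun u => ENNReal.ofReal (u ^ (-β / 2 - 1)) *
        ENNReal.ofReal (Real.exp (-(u * p.1 ^ 2 / 2))))
        (g := fun u => ENNReal.ofReal (u ^ (-β / 2 - 1)) *
        ENNReal.ofReal (Real.exp (-(u * p.2 ^ 2 / 2)))) (by fun_prop) (by fun_prop),
      ENNReal.ofReal_mul (by positivity), ofReal_abs_rpow_eq_lintegral hβ hp.1,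
      ofReal_abs_rpow_eq_lintegral hβ hp.2]
    ring
  rw [h1, lintegral_const_mul' _ _ (ENNReal.pow_ne_top ENNReal.ofReal_ne_top),
    lintegral_lintegral_swap (by fun_prop)]
  congr 1
  refine lintegral_congr fun q => ?_
  rw [← lintegral_const_mul _ (by fun_prop)]
  refine lintegral_congr fun p => ?_
  rw [ENNReal.ofReal_mul (by positivity)]
  ring

lemma ae_ne_zero_gaussianReal {s : NNReal} (hs : s ≠ 0) : ∀ᵐ x ∂gaussianReal 0 s, x ≠ 0 := by
  have := nullSingletonClass_gaussianReal (μ := 0) hs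
  simp [ae_iff]

/-- Nonnegativity of the variance of the regression residual. -/
lemma covariance_sq_le {Ω : Type*} [MeasurableSpace Ω] {μ : Measure Ω}
    [IsProbabilityMeasure μ] {X Y : Ω → ℝ} (hX : MemLp X 2 μ) (hY : MemLp Y 2 μ)
    (h : 0 < Var[X; μ]) : cov[X, Y; μ] ^ 2 ≤ Var[X; μ] * Var[Y; μ] := by
  have h1 : Var[fun ω => Y ω - (cov[X, Y; μ] / Var[X; μ]) * X ω; μ] = Var[Y; μ] -
      2 * cov[Y, fun ω => (cov[X, Y; μ] / Var[X; μ]) * X ω; μ] +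
      Var[fun ω => (cov[X, Y; μ] / Var[X; μ]) * X ω; μ] :=
    variance_fun_sub hY (hX.const_mul _)
  rw [covariance_const_mul_right, variance_const_mul, covariance_comm Y X] at h1
  have h2 := variance_nonneg (fun ω => Y ω - (cov[X, Y; μ] / Var[X; μ]) * X ω) μ
  rw [h1] at h2
  have h3 : Var[Y; μ] - 2 * (cov[X, Y; μ] / Var[X; μ] * cov[X, Y; μ]) +
      (cov[X, Y; μ] / Var[X; μ]) ^ 2 * Var[X; μ] = Var[Y; μ] - cov[X, Y; μ] ^ 2 / Var[X; μ] := by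
    field_simp
    ring
  rw [h3, sub_nonneg, div_le_iff₀ h] at h2
  linarith

/-- For a centred Gaussian vector, the mixed moment of a negative order exceeds the product of the
moments by at most a multiple of the squared correlation. -/
lemma HasGaussianLaw.lintegral_abs_rpow_mul_le {Ω : Type*} [MeasurableSpace Ω] {μ : Measure Ω}
    [IsProbabilityMeasure μ] {X Y : Ω → ℝ} (hXY : HasGaussianLaw (fun ω => (X ω, Y ω)) μ)
    (hX0 : ∫ ω, X ω ∂μ = 0) (hY0 : ∫ ω, Y ω ∂μ = 0) (hX : 0 < Var[X; μ]) (hY : 0 < Var[Y; μ])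
    {β : ℝ} (hβ : -1 / 2 < β) (hβ0 : β < 0) :
    ∫⁻ ω, ENNReal.ofReal (|X ω| ^ β * |Y ω| ^ β) ∂μ ≤
      ENNReal.ofReal ((√Var[X; μ] * √Var[Y; μ]) ^ β * (normalAbsMoment β ^ 2 +
        cov[X, Y; μ] ^ 2 / (Var[X; μ] * Var[Y; μ]) * normalAbsMoment (2 * β))) := by
  set σ := Var[X; μ] with hσ
  set τ := Var[Y; μ] with hτ
  set c := cov[X, Y; μ] with hc
  set θ := c ^ 2 / (σ * τ) with hθ
  have hXm : AEMeasurable X μ := hXY.fst.aemeasurable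
  have hYm : AEMeasurable Y μ := hXY.snd.aemeasurable
  have hθ0 : 0 ≤ θ := by positivity
  have hθ1 : θ ≤ 1 := by
    rw [hθ, div_le_one (by positivity)]
    exact covariance_sq_le hXY.fst.memLp_two hXY.snd.memLp_two hX
  let s : NNReal := σ.toNNReal
  let t : NNReal := τ.toNNReal
  have hs : (s : ℝ) = σ := Real.coe_toNNReal _ hX.le
  have ht : (t : ℝ) = τ := Real.coe_toNNReal _ hY.le
  have hs0 : s ≠ 0 := fun h => by rw [h] at hs; exact hX.ne hs
  have ht0 : t ≠ 0 := fun h => by rw [h] at ht; exact hY.ne ht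
  -- Three laws with the same marginals: the given one, the independent one `ν₀`, and the one of
  -- correlation 1, `ν₁`.
  let ν := μ.map fun ω => (X ω, Y ω)
  let ν₀ := (gaussianReal 0 s).prod (gaussianReal 0 t)
  let ν₁ := (gaussianReal 0 1).map fun x => (√σ * x, √τ * x)
  have : IsProbabilityMeasure ν := Measure.isProbabilityMeasure_map (hXm.prodMk hYm)
  have : IsProbabilityMeasure ν₁ := Measure.isProbabilityMeasure_map (by fun_prop)
  have hlawX : μ.map X = gaussianReal 0 s := by
    rw [hXY.fst.map_eq_gaussianReal, hX0]
  have hlawY : μ.map Y = gaussianReal 0 t := by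
    rw [hXY.snd.map_eq_gaussianReal, hY0]
  have hνae : ∀ᵐ p ∂ν, p.1 ≠ 0 ∧ p.2 ≠ 0 := by
    have h1 : ∀ᵐ ω ∂μ, X ω ≠ 0 := ae_of_ae_map hXm (hlawX ▸ ae_ne_zero_gaussianReal hs0)
    have h2 : ∀ᵐ ω ∂μ, Y ω ≠ 0 := ae_of_ae_map hYm (hlawY ▸ ae_ne_zero_gaussianReal ht0)
    rw [ae_map_iff (hXm.prodMk hYm) (by measurability)]
    exact h1.and h2
  have hν₀ae : ∀ᵐ p ∂ν₀, p.1 ≠ 0 ∧ p.2 ≠ 0 :=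
    (Measure.quasiMeasurePreserving_fst.ae (ae_ne_zero_gaussianReal hs0)).and
      (Measure.quasiMeasurePreserving_snd.ae (ae_ne_zero_gaussianReal ht0))
  have hν₁ae : ∀ᵐ p ∂ν₁, p.1 ≠ 0 ∧ p.2 ≠ 0 := by
    rw [ae_map_iff (by fun_prop) (by measurability)]
    filter_upwards [ae_ne_zero_gaussianReal one_ne_zero] with x hx
    exact ⟨by positivity, by positivity⟩
  have hm : Measurable fun p : ℝ × ℝ => ENNReal.ofReal (|p.1| ^ β * |p.2| ^ β) := by fun_prop
  have hJ : ∫⁻ ω, ENNReal.ofReal (|X ω| ^ β * |Y ω| ^ β) ∂μ =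
      ∫⁻ p, ENNReal.ofReal (|p.1| ^ β * |p.2| ^ β) ∂ν := by
    rw [lintegral_map' hm.aemeasurable (hXm.prodMk hYm)]
  have hJ₀ : ∫⁻ p, ENNReal.ofReal (|p.1| ^ β * |p.2| ^ β) ∂ν₀ =
      ENNReal.ofReal ((√σ * √τ) ^ β * normalAbsMoment β ^ 2) := by
    have : ∀ p : ℝ × ℝ, ENNReal.ofReal (|p.1| ^ β * |p.2| ^ β) =
        ENNReal.ofReal (|p.1| ^ β) * ENNReal.ofReal (|p.2| ^ β) := fun p =>
      ENNReal.ofReal_mul (by positivity)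
    simp_rw [this]
    rw [lintegral_prod_mul (f := fun x => ENNReal.ofReal (|x| ^ β))
      (g := fun x => ENNReal.ofReal (|x| ^ β)) (by fun_prop) (by fun_prop),
      lintegral_abs_rpow_gaussianReal (by linarith), lintegral_abs_rpow_gaussianReal (by linarith),
      ← ENNReal.ofReal_mul (mul_nonneg (by positivity) (normalAbsMoment_pos (by linarith)).le),
      hs, ht, Real.mul_rpow (by positivity) (by positivity)]
    congr 1
    ring
  -- Under full correlation both powers fall on one normal variable, giving order 2β; β > -1/2 makes
  -- this moment finite.
  have hJ₁ : ∫⁻ p, ENNReal.ofReal (|p.1| ^ β * |p.2| ^ β) ∂ν₁ =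
      ENNReal.ofReal ((√σ * √τ) ^ β * normalAbsMoment (2 * β)) := by
    have h2 := lintegral_abs_rpow_gaussianReal (β := 2 * β) (by linarith) 1
    rw [NNReal.coe_one, Real.sqrt_one, Real.one_rpow, one_mul] at h2
    rw [lintegral_map hm (by fun_prop), ENNReal.ofReal_mul (by positivity), ← h2,
      ← lintegral_const_mul _ (by fun_prop)]
    refine lintegral_congr_ae ?_
    filter_upwards [ae_ne_zero_gaussianReal one_ne_zero] with x hx
    rw [← ENNReal.ofReal_mul (by positivity), abs_mul, abs_mul,
      abs_of_nonneg (Real.sqrt_nonneg _), abs_of_nonneg (Real.sqrt_nonneg _),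
      Real.mul_rpow (by positivity) (by positivity), Real.mul_rpow (by positivity) (by positivity),
      Real.mul_rpow (by positivity) (by positivity), show 2 * β = β + β by ring,
      Real.rpow_add (by positivity)]
    congr 1
    ring
  have hL₀ : ∀ u w : ℝ, 0 ≤ u → 0 ≤ w → ∫⁻ p, ENNReal.ofReal (Real.exp (-(u * p.1 ^ 2 / 2)) *
      Real.exp (-(w * p.2 ^ 2 / 2))) ∂ν₀ =
      ENNReal.ofReal (√((1 + u * σ) * (1 + w * τ)))⁻¹ := by
    intro u w hu hw
    have : ∀ p : ℝ × ℝ, ENNReal.ofReal (Real.exp (-(u * p.1 ^ 2 / 2)) *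
      Real.exp (-(w * p.2 ^ 2 / 2))) = ENNReal.ofReal (Real.exp (-(u * p.1 ^ 2 / 2))) *
      ENNReal.ofReal (Real.exp (-(w * p.2 ^ 2 / 2))) := fun p =>
      ENNReal.ofReal_mul (by positivity)
    simp_rw [this]
    rw [lintegral_prod_mul (f := fun x => ENNReal.ofReal (Real.exp (-(u * x ^ 2 / 2))))
      (g := fun x => ENNReal.ofReal (Real.exp (-(w * x ^ 2 / 2)))) (by fun_prop) (by fun_prop),
      lintegral_exp_neg_mul_sq_gaussianReal hu, lintegral_exp_neg_mul_sq_gaussianReal hw,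
      ← ENNReal.ofReal_mul (by positivity), hs, ht, Real.sqrt_mul (by positivity), mul_inv]
    simp
  have hL₁ : ∀ u w : ℝ, 0 ≤ u → 0 ≤ w → ∫⁻ p, ENNReal.ofReal (Real.exp (-(u * p.1 ^ 2 / 2)) *
      Real.exp (-(w * p.2 ^ 2 / 2))) ∂ν₁ = ENNReal.ofReal (√(1 + (u * σ + w * τ)))⁻¹ := by
    intro u w hu hw
    have h2 := lintegral_exp_neg_mul_sq_gaussianReal (w := u * σ + w * τ) (by positivity) 0 1
    simp only [NNReal.coe_one, mul_one, ne_eq, OfNat.ofNat_ne_zero, not_false_eq_true, zero_pow,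
      mul_zero, zero_div, neg_zero, Real.exp_zero] at h2
    rw [← h2, lintegral_map (by fun_prop) (by fun_prop)]
    refine lintegral_congr fun x => ?_
    rw [← Real.exp_add, mul_pow, mul_pow, Real.sq_sqrt hX.le, Real.sq_sqrt hY.le]
    congr 2
    ring
  -- With A₀ = (1 + uσ)(1 + wτ) and A₁ = 1 + uσ + wτ, the radicand for ν equals (1 - θ)A₀ + θA₁,
  -- since A₀ - A₁ = uwστ and c² = θστ.
  have hL : ∀ u w : ℝ, 0 ≤ u → 0 ≤ w → ∫⁻ p, ENNReal.ofReal (Real.exp (-(u * p.1 ^ 2 / 2)) *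
      Real.exp (-(w * p.2 ^ 2 / 2))) ∂ν ≤
      ENNReal.ofReal (1 - θ) * ∫⁻ p, ENNReal.ofReal (Real.exp (-(u * p.1 ^ 2 / 2)) *
        Real.exp (-(w * p.2 ^ 2 / 2))) ∂ν₀ +
      ENNReal.ofReal θ * ∫⁻ p, ENNReal.ofReal (Real.exp (-(u * p.1 ^ 2 / 2)) *
        Real.exp (-(w * p.2 ^ 2 / 2))) ∂ν₁ := by
    intro u w hu hw
    rw [hL₀ u w hu hw, hL₁ u w hu hw, lintegral_map' (by fun_prop) (hXm.prodMk hYm),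
      HasGaussianLaw.lintegral_exp_neg_quadratic hXY hX0 hY0 hX hu hw,
      ← ENNReal.ofReal_mul (by linarith), ← ENNReal.ofReal_mul hθ0,
      ← ENNReal.ofReal_add (mul_nonneg (by linarith) (by positivity)) (by positivity)]
    refine ENNReal.ofReal_le_ofReal (le_trans (le_of_eq ?_)
      (inv_sqrt_convex (by positivity) (by positivity) hθ0 hθ1))
    have : c ^ 2 = θ * (σ * τ) := by rw [hθ]; field_simp
    rw [← hσ, ← hτ, ← hc, this]
    congr 2
    ring
  have hJle : ∫⁻ p, ENNReal.ofReal (|p.1| ^ β * |p.2| ^ β) ∂ν ≤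
      ENNReal.ofReal (1 - θ) * ∫⁻ p, ENNReal.ofReal (|p.1| ^ β * |p.2| ^ β) ∂ν₀ +
      ENNReal.ofReal θ * ∫⁻ p, ENNReal.ofReal (|p.1| ^ β * |p.2| ^ β) ∂ν₁ := by
    rw [lintegral_abs_rpow_mul_abs_rpow hβ0 ν hνae, lintegral_abs_rpow_mul_abs_rpow hβ0 ν₀ hν₀ae,
      lintegral_abs_rpow_mul_abs_rpow hβ0 ν₁ hν₁ae, mul_left_comm, mul_left_comm (ENNReal.ofReal θ),
      ← mul_add]
    gcongr
    have hmeas : ∀ ρ : Measure (ℝ × ℝ), SFinite ρ → Measurable fun q : ℝ × ℝ =>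
        ENNReal.ofReal (q.1 ^ (-β / 2 - 1)) * ENNReal.ofReal (q.2 ^ (-β / 2 - 1)) *
        ∫⁻ p, ENNReal.ofReal (Real.exp (-(q.1 * p.1 ^ 2 / 2)) *
          Real.exp (-(q.2 * p.2 ^ 2 / 2))) ∂ρ := by
      intro ρ _
      refine Measurable.mul (by fun_prop) (Measurable.lintegral_prod_right' (f := fun z :
        (ℝ × ℝ) × (ℝ × ℝ) => ENNReal.ofReal (Real.exp (-(z.1.1 * z.2.1 ^ 2 / 2)) *
          Real.exp (-(z.1.2 * z.2.2 ^ 2 / 2)))) (by fun_prop))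
    rw [← lintegral_const_mul _ (hmeas ν₀ inferInstance),
      ← lintegral_const_mul _ (hmeas ν₁ inferInstance),
      ← lintegral_add_left ((hmeas ν₀ inferInstance).const_mul _)]
    refine lintegral_mono_ae ?_
    rw [Measure.prod_restrict]
    refine (ae_restrict_iff' (measurableSet_Ioi.prod measurableSet_Ioi)).2 (ae_of_all _ ?_)
    intro q hq
    have := hL q.1 q.2 (Set.mem_Ioi.1 hq.1).le (Set.mem_Ioi.1 hq.2).le
    calc _ ≤ _ := mul_le_mul_right this _
      _ = _ := by ring
  rw [hJ]
  refine hJle.trans ?_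
  have hm2 := normalAbsMoment_pos (β := 2 * β) (by linarith)
  rw [hJ₀, hJ₁, ← ENNReal.ofReal_mul (by linarith), ← ENNReal.ofReal_mul hθ0,
    ← ENNReal.ofReal_add (mul_nonneg (by linarith) (by positivity)) (by positivity)]
  refine ENNReal.ofReal_le_ofReal ?_
  have : 0 ≤ θ * ((√σ * √τ) ^ β * normalAbsMoment β ^ 2) := by positivity
  nlinarith

/-- The limit constant is an absolute moment of a centred normal variable. -/
lemma limitConst_eq {K : ℕ} (a : Fin (K + 1) → ℝ) {h v β : ℝ} (hv : 0 < v) (hβ : -1 < β)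
    (hβ0 : β < 0) :
    limitConst a h v β = (√v * scaleConst a h) ^ β * normalAbsMoment β := by
  have hG := Real.Gamma_pos_of_pos (show 0 < -β / 2 by linarith)
  -- The factor Γ(-β/2) produced here cancels the denominator of `constC β`.
  have h1 : ∫ y : ℝ, Real.exp (-(v * |y| ^ 2 / 2)) / |y| ^ (1 + β) =
      (v / 2) ^ (β / 2) * Real.Gamma (-β / 2) := by
    rw [integral_comp_abs (f := fun y => Real.exp (-(v * y ^ 2 / 2)) / y ^ (1 + β))]
    have : ∫ y in Set.Ioi (0 : ℝ), Real.exp (-(v * y ^ 2 / 2)) / y ^ (1 + β) =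
        ∫ y in Set.Ioi (0 : ℝ), y ^ (-(1 + β)) * Real.exp (-(v / 2) * y ^ (2 : ℝ)) := by
      refine setIntegral_congr_fun measurableSet_Ioi fun y hy => ?_
      have hy : 0 < y := hy
      rw [Real.rpow_neg hy.le, Real.rpow_two, show -(v * y ^ 2 / 2) = -(v / 2) * y ^ 2 by ring]
      ring
    rw [this, integral_rpow_mul_exp_neg_mul_rpow two_pos (by linarith) (by positivity),
      show -(-(1 + β) + 1) / 2 = β / 2 by ring, show (-(1 + β) + 1) / 2 = -β / 2 by ring]
    ring
  have hs : 0 ≤ scaleConst a h := by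
    rw [scaleConst]
    exact Real.rpow_nonneg (integral_nonneg fun _ => by positivity) _
  rw [limitConst, h1, constC, normalAbsMoment_eq hβ, Real.mul_rpow (by positivity) hs,
    Real.sqrt_mul two_pos.le, Real.div_rpow hv.le two_pos.le, Real.sqrt_eq_rpow v,
    ← Real.rpow_mul hv.le, show 1 / 2 * β = β / 2 by ring, Real.rpow_add two_pos,
    ← Real.sqrt_eq_rpow, show (2 : ℝ) ^ β = 2 ^ (β / 2) * 2 ^ (β / 2) by
      rw [← Real.rpow_add two_pos]; ring_nf]
  have : √(2 : ℝ) ≠ 0 := by positivity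
  have : (2 : ℝ) ^ (β / 2) ≠ 0 := by positivity
  have : Real.Gamma (-(β / 2)) ≠ 0 := by rw [← neg_div]; exact hG.ne'
  field_simp

/-! ### Wiener integrals form a centred Gaussian family -/

lemma inner_toLp_eq_integral {α : Type*} [MeasurableSpace α] {ν : Measure α} {f g : α → ℝ}
    (hf : MemLp f 2 ν) (hg : MemLp g 2 ν) :
    inner ℝ (hf.toLp f) (hg.toLp g) = ∫ s, f s * g s ∂ν := by
  rw [L2.inner_def]
  refine integral_congr_ae ?_
  filter_upwards [hf.coeFn_toLp, hg.coeFn_toLp] with s h1 h2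
  rw [h1, h2]
  simp [mul_comm]

lemma norm_toLp_sq_eq_integral {α : Type*} [MeasurableSpace α] {ν : Measure α} {f : α → ℝ}
    (hf : MemLp f 2 ν) : ‖hf.toLp f‖ ^ 2 = ∫ s, f s ^ 2 ∂ν := by
  rw [← real_inner_self_eq_norm_sq, inner_toLp_eq_integral]
  simp_rw [pow_two]

lemma tendsto_eLpNorm_finsetSum_sub {α ι : Type*} [MeasurableSpace α] [Fintype ι] {ν : Measure α}
    {φ : ι → ℕ → α → ℝ} {f : ι → α → ℝ} (hφ : ∀ i n, MemLp (φ i n) 2 ν) (hf : ∀ i, MemLp (f i) 2 ν)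
    (h : ∀ i, Tendsto (fun n => eLpNorm (fun s => φ i n s - f i s) 2 ν) atTop (𝓝 0)) (c : ι → ℝ) :
    Tendsto (fun n => eLpNorm (fun s => ∑ i, c i * φ i n s - ∑ i, c i * f i s) 2 ν)
      atTop (𝓝 0) := by
  have h1 : Tendsto (fun n => ∑ i, ‖c i‖ₑ * eLpNorm (fun s => φ i n s - f i s) 2 ν)
      atTop (𝓝 0) := by
    have : Tendsto (fun n => ∑ i, ‖c i‖ₑ * eLpNorm (fun s => φ i n s - f i s) 2 ν)
      atTop (𝓝 (∑ i : ι, ‖c i‖ₑ * 0)) :=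
      tendsto_finsetSum _ fun i _ => ENNReal.Tendsto.const_mul (h i) (Or.inr (by simp))
    simpa using this
  refine tendsto_of_tendsto_of_tendsto_of_le_of_le tendsto_const_nhds h1 (fun _ => zero_le) ?_
  intro n
  have e : (fun s => ∑ i, c i * φ i n s - ∑ i, c i * f i s) =
      ∑ i, c i • (fun s => φ i n s - f i s) := by
    ext s
    simp [← Finset.sum_sub_distrib, mul_sub]
  dsimp only
  rw [e]
  refine (eLpNorm_sum_le (fun i _ => ?_) (by norm_num)).trans_eq ?_
  · exact (((hφ i n).sub (hf i)).const_smul (c i)).aestronglyMeasurable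
  · exact Finset.sum_congr rfl fun i _ => eLpNorm_const_smul _ _ _ _

/-- For a simple function in L² the fibre over 0 has infinite measure, where `M` carries no
information; it has to be dropped before the Gaussian family is used. -/
lemma simpleIntegral_eq_sum {Ω : Type*} {M : Set ℝ → Ω → ℝ} (φ : SimpleFunc ℝ ℝ) (ω : Ω) :
    simpleIntegral M φ ω =
      ∑ x : {x // x ∈ φ.range.filter (· ≠ 0)}, x.1 * M (φ ⁻¹' {x.1}) ω := by
  rw [Finset.sum_coe_sort (φ.range.filter (· ≠ 0)) fun x => x * M (φ ⁻¹' {x}) ω, simpleIntegral,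
    Finset.sum_filter_of_ne]
  intro x _ h hx
  exact h (by rw [hx, zero_mul])

section

variable {Ω : Type*} [MeasurableSpace Ω] {μ : Measure Ω} [IsProbabilityMeasure μ] {v : ℝ}
  {M : Set ℝ → Ω → ℝ}

/-- The covariance v |A ∩ B| is v times the L² inner product of indicators, so bilinearity makes the
variance v times the squared L² norm of the step function. -/
lemma IsGaussianRandomMeasure.map_sum (hM : IsGaussianRandomMeasure μ v M) {J : Type*} [Fintype J]
    {A : J → Set ℝ} (hA : ∀ j, MeasurableSet (A j)) (hfin : ∀ j, volume (A j) < ∞) (d : J → ℝ) :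
    HasGaussianLaw (fun ω => ∑ j, d j * M (A j) ω) μ ∧
    μ.map (fun ω => ∑ j, d j * M (A j) ω) =
      gaussianReal 0 (v * ∫ s, (∑ j, d j * (A j).indicator 1 s) ^ 2).toNNReal := by
  have hproc := hM.isGaussianProcess.comp_right
    (fun j : J => (⟨A j, hA j, hfin j⟩ : {A : Set ℝ // MeasurableSet A ∧ volume A < ∞}))
  have hlaw : HasGaussianLaw (fun ω => ∑ j, d j * M (A j) ω) μ :=
    (hproc.smul d).hasGaussianLaw_fun_sum (I := Finset.univ)
  have hmem : ∀ j, MemLp (M (A j)) 2 μ := fun j => (hproc.hasGaussianLaw_eval j).memLp_two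
  have hmem' : ∀ j, MemLp (fun ω => d j * M (A j) ω) 2 μ := fun j => (hmem j).const_mul _
  refine ⟨hlaw, ?_⟩
  rw [hlaw.map_eq_gaussianReal]
  congr 1
  · rw [integral_finsetSum _ fun j _ => (hmem' j).integrable (by norm_num)]
    refine Finset.sum_eq_zero fun j _ => ?_
    rw [integral_const_mul, hM.centered _ (hA j) (hfin j), mul_zero]
  · congr 1
    rw [← covariance_self hlaw.aemeasurable, covariance_fun_sum_fun_sum hmem' hmem']
    have hint : ∀ i j, Integrable (fun s => (d i * (A i).indicator 1 s) *
        (d j * (A j).indicator 1 s) : ℝ → ℝ) := by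
      intro i j
      have : (fun s => (d i * (A i).indicator 1 s) * (d j * (A j).indicator 1 s) : ℝ → ℝ) =
          fun s => d i * d j * (A i ∩ A j).indicator 1 s := by
        ext s
        by_cases h1 : s ∈ A i <;> by_cases h2 : s ∈ A j <;> simp [h1, h2]
      rw [this]
      refine Integrable.const_mul ?_ _
      exact (integrable_indicator_iff ((hA i).inter (hA j))).2 (integrableOn_const
        (((measure_mono Set.inter_subset_left).trans_lt (hfin i)).ne))
    have e : ∀ s, (∑ j, d j * (A j).indicator 1 s) ^ 2 = ∑ i, ∑ j, (d i * (A i).indicator 1 s) *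
        (d j * (A j).indicator 1 s : ℝ) := fun s => by rw [pow_two, Finset.sum_mul_sum]
    simp_rw [e]
    rw [integral_finsetSum _ fun i _ => integrable_finsetSum _ fun j _ => hint i j,
      Finset.mul_sum]
    refine Finset.sum_congr rfl fun i _ => ?_
    rw [integral_finsetSum _ fun j _ => hint i j, Finset.mul_sum]
    refine Finset.sum_congr rfl fun j _ => ?_
    rw [covariance_const_mul_left, covariance_const_mul_right,
      hM.covariance_eq _ _ (hA i) (hfin i) (hA j) (hfin j)]
    have : (fun s => (d i * (A i).indicator 1 s) * (d j * (A j).indicator 1 s) : ℝ → ℝ) =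
          fun s => d i * d j * (A i ∩ A j).indicator 1 s := by
        ext s
        by_cases h1 : s ∈ A i <;> by_cases h2 : s ∈ A j <;> simp [h1, h2]
    rw [this, integral_const_mul, integral_indicator_one ((hA i).inter (hA j))]
    ring

lemma simpleFunc_eq_sum (φ : SimpleFunc ℝ ℝ) (s : ℝ) :
    φ s = ∑ x : {x // x ∈ φ.range.filter (· ≠ 0)}, x.1 * (φ ⁻¹' {x.1}).indicator 1 s := by
  rw [Finset.sum_coe_sort (φ.range.filter (· ≠ 0)) fun x => x * (φ ⁻¹' {x}).indicator 1 s]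
  by_cases h : φ s = 0
  · rw [h]
    refine (Finset.sum_eq_zero fun x hx => ?_).symm
    have : s ∉ φ ⁻¹' {x} := fun hs => (Finset.mem_filter.1 hx).2 (by
      rw [← h]; exact (Set.mem_singleton_iff.1 hs).symm)
    simp [this]
  · rw [Finset.sum_eq_single (φ s)]
    · simp
    · intro x _ hx
      have : s ∉ φ ⁻¹' {x} := fun hs => hx (Set.mem_singleton_iff.1 hs).symm
      simp [this]
    · intro hs
      exact absurd (Finset.mem_filter.2 ⟨SimpleFunc.mem_range_self φ s, h⟩) hs

/-- All nonzero fibres of all the `φ i` are collected in one sigma type, which reduces the claim to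
a single sum over sets. -/
lemma IsGaussianRandomMeasure.map_sum_simpleIntegral (hM : IsGaussianRandomMeasure μ v M)
    {ι : Type*} [Fintype ι] {φ : ι → SimpleFunc ℝ ℝ} (hφ : ∀ i, MemLp (φ i) 2 volume)
    (c : ι → ℝ) :
    HasGaussianLaw (fun ω => ∑ i, c i * simpleIntegral M (φ i) ω) μ ∧
    μ.map (fun ω => ∑ i, c i * simpleIntegral M (φ i) ω) =
      gaussianReal 0 (v * ∫ s, (∑ i, c i * φ i s) ^ 2).toNNReal := by
  have := hM.map_sum (J := Σ i, {x // x ∈ (φ i).range.filter (· ≠ 0)})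
    (A := fun j => φ j.1 ⁻¹' {j.2.1}) (fun j => (φ j.1).measurableSet_fiber _)
    (fun j => SimpleFunc.measure_preimage_lt_top_of_memLp two_ne_zero (by simp) _ (hφ j.1) _
      (Finset.mem_filter.1 j.2.2).2) (fun j => c j.1 * j.2.1)
  simp_rw [Fintype.sum_sigma, mul_assoc, ← Finset.mul_sum, ← simpleFunc_eq_sum,
    ← simpleIntegral_eq_sum] at this
  exact this

/-- An L² limit of centred Gaussians is centred Gaussian with the limiting variance: the
characteristic functions converge to that of the limit variable and also to the Gaussian one. -/
lemma IsGaussianRandomMeasure.map_sum_wienerIntegral (hM : IsGaussianRandomMeasure μ v M)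
    {ι : Type*} [Fintype ι] {f : ι → ℝ → ℝ} {Y : ι → Ω → ℝ}
    (h : ∀ i, IsWienerIntegral μ M (f i) (Y i)) (c : ι → ℝ) :
    μ.map (fun ω => ∑ i, c i * Y i ω) =
      gaussianReal 0 (v * ∫ s, (∑ i, c i * f i s) ^ 2).toNNReal := by
  have hf := fun i => (h i).1
  have hY := fun i => (h i).2.1
  choose φ hφ hφf hφY using fun i => (h i).2.2
  have hS : ∀ i n, MemLp (simpleIntegral M (φ i n)) 2 μ := by
    intro i n
    have := (hM.map_sum_simpleIntegral (ι := Unit) (φ := fun _ => φ i n) (fun _ => hφ i n)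
      (fun _ => 1)).1.memLp_two
    simpa using this
  have hgn : ∀ n, MemLp (fun s => ∑ i, c i * φ i n s) 2 volume := fun n =>
    memLp_finsetSum _ fun i _ => (hφ i n).const_mul _
  have hg : MemLp (fun s => ∑ i, c i * f i s) 2 volume :=
    memLp_finsetSum _ fun i _ => (hf i).const_mul _
  have hSn : ∀ n, MemLp (fun ω => ∑ i, c i * simpleIntegral M (φ i n) ω) 2 μ := fun n =>
    memLp_finsetSum _ fun i _ => (hS i n).const_mul _
  have hZ : MemLp (fun ω => ∑ i, c i * Y i ω) 2 μ :=
    memLp_finsetSum _ fun i _ => (hY i).const_mul _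
  have lim1 := tendsto_eLpNorm_finsetSum_sub (φ := fun i n s => φ i n s) hφ hf hφf c
  have lim2 := tendsto_eLpNorm_finsetSum_sub hS hY hφY c
  have limvar : Tendsto (fun n => v * ∫ s, (∑ i, c i * φ i n s) ^ 2) atTop
      (𝓝 (v * ∫ s, (∑ i, c i * f i s) ^ 2)) := by
    have := ((Lp.tendsto_Lp_iff_tendsto_eLpNorm'' (p := 2) _ hgn _ hg).2 lim1).norm.pow 2
    simp_rw [norm_toLp_sq_eq_integral] at this
    exact this.const_mul v
  -- An almost surely convergent subsequence makes dominated convergence applicable to the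
  -- characteristic functions.
  obtain ⟨ns, hns, hae⟩ := (tendstoInMeasure_of_tendsto_eLpNorm two_ne_zero
    (fun n => (hSn n).aestronglyMeasurable) hZ.aestronglyMeasurable lim2).exists_seq_tendsto_ae
  have : IsProbabilityMeasure (μ.map (fun ω => ∑ i, c i * Y i ω)) :=
    Measure.isProbabilityMeasure_map hZ.aestronglyMeasurable.aemeasurable
  refine Measure.ext_of_charFun (funext fun θ => ?_)
  have hc : ∀ {Z : Ω → ℝ}, AEMeasurable Z μ → charFun (μ.map Z) θ =
      ∫ ω, Complex.exp (θ * Z ω * Complex.I) ∂μ := by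
    intro Z hZ
    rw [charFun_apply_real, integral_map hZ (by fun_prop)]
  have t1 : Tendsto (fun k => charFun (μ.map fun ω => ∑ i, c i * simpleIntegral M (φ i (ns k)) ω) θ)
      atTop (𝓝 (charFun (μ.map fun ω => ∑ i, c i * Y i ω) θ)) := by
    rw [hc hZ.aestronglyMeasurable.aemeasurable]
    simp_rw [fun k => hc (hSn (ns k)).aestronglyMeasurable.aemeasurable]
    refine tendsto_integral_of_dominated_convergence (fun _ => 1) (fun k => ?_)
      (integrable_const _) (fun k => ae_of_all _ fun ω => ?_) ?_
    · have := (hSn (ns k)).aestronglyMeasurable.aemeasurable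
      exact (by fun_prop : AEMeasurable _ μ).aestronglyMeasurable
    · rw [← Complex.ofReal_mul, Complex.norm_exp_ofReal_mul_I]
    · filter_upwards [hae] with ω hω
      exact ((Complex.continuous_exp.comp (by fun_prop :
        Continuous fun x : ℝ => (θ * x * Complex.I : ℂ))).tendsto _).comp hω
  have t2 : Tendsto (fun k => charFun (μ.map fun ω => ∑ i, c i * simpleIntegral M (φ i (ns k)) ω) θ)
      atTop (𝓝 (charFun (gaussianReal 0 (v * ∫ s, (∑ i, c i * f i s) ^ 2).toNNReal) θ)) := by
    simp_rw [fun n => (hM.map_sum_simpleIntegral (fun i => hφ i n) c).2, charFun_gaussianReal]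
    have hv := ((NNReal.continuous_coe.comp continuous_real_toNNReal).tendsto _).comp
      (limvar.comp hns.tendsto_atTop)
    exact ((Complex.continuous_exp.comp (by fun_prop :
      Continuous fun x : ℝ => (θ * (0 : ℝ) * Complex.I - x * θ ^ 2 / 2 : ℂ))).tendsto _).comp hv
  exact tendsto_nhds_unique t1 t2

/-- Two finite linear combinations of Wiener integrals form a centred Gaussian vector, with
covariances given by the inner products of the integrands. -/
lemma IsGaussianRandomMeasure.hasGaussianLaw_pair (hM : IsGaussianRandomMeasure μ v M) (hv : 0 ≤ v)
    {ι κ : Type*} [Fintype ι] [Fintype κ] {f : ι → ℝ → ℝ} {Y : ι → Ω → ℝ} {g : κ → ℝ → ℝ}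
    {Z : κ → Ω → ℝ} (hY : ∀ i, IsWienerIntegral μ M (f i) (Y i))
    (hZ : ∀ i, IsWienerIntegral μ M (g i) (Z i)) (a : ι → ℝ) (b : κ → ℝ) :
    HasGaussianLaw (fun ω => (∑ i, a i * Y i ω, ∑ i, b i * Z i ω)) μ ∧
    ∫ ω, ∑ i, a i * Y i ω ∂μ = 0 ∧
    Var[fun ω => ∑ i, a i * Y i ω; μ] = v * ∫ s, (∑ i, a i * f i s) ^ 2 ∧
    cov[fun ω => ∑ i, a i * Y i ω, fun ω => ∑ i, b i * Z i ω; μ] =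
      v * ∫ s, (∑ i, a i * f i s) * (∑ i, b i * g i s) := by
  have hYm : MemLp (fun ω => ∑ i, a i * Y i ω) 2 μ :=
    memLp_finsetSum _ fun i _ => (hY i).2.1.const_mul _
  have hZm : MemLp (fun ω => ∑ i, b i * Z i ω) 2 μ :=
    memLp_finsetSum _ fun i _ => (hZ i).2.1.const_mul _
  have hfm : MemLp (fun s => ∑ i, a i * f i s) 2 volume :=
    memLp_finsetSum _ fun i _ => (hY i).1.const_mul _
  have hgm : MemLp (fun s => ∑ i, b i * g i s) 2 volume :=
    memLp_finsetSum _ fun i _ => (hZ i).1.const_mul _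
  -- A combination of the two sums is one sum over `ι ⊕ κ`; Gaussianity of all such combinations is
  -- joint Gaussianity.
  have hlin : ∀ x y : ℝ, μ.map (fun ω => x * ∑ i, a i * Y i ω + y * ∑ i, b i * Z i ω) =
      gaussianReal 0
        (v * ∫ s, (x * ∑ i, a i * f i s + y * ∑ i, b i * g i s) ^ 2).toNNReal := by
    intro x y
    have := hM.map_sum_wienerIntegral (ι := ι ⊕ κ) (f := Sum.elim f g) (Y := Sum.elim Y Z)
      (by rintro (i | i); exacts [hY i, hZ i]) (Sum.elim (fun i => x * a i) (fun i => y * b i))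
    simpa only [Fintype.sum_sum_type, Sum.elim_inl, Sum.elim_inr, mul_assoc, ← Finset.mul_sum]
      using this
  have hvar : ∀ x y : ℝ, Var[fun ω => x * ∑ i, a i * Y i ω + y * ∑ i, b i * Z i ω; μ] =
      v * ∫ s, (x * ∑ i, a i * f i s + y * ∑ i, b i * g i s) ^ 2 := by
    intro x y
    have hm : MemLp (fun ω => x * ∑ i, a i * Y i ω + y * ∑ i, b i * Z i ω) 2 μ :=
      (hYm.const_mul x).add (hZm.const_mul y)
    rw [← variance_id_map hm.aestronglyMeasurable.aemeasurable, hlin x y, variance_id_gaussianReal,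
      Real.coe_toNNReal _ (mul_nonneg hv (integral_nonneg fun _ => sq_nonneg _))]
  have hpm : AEMeasurable (fun ω => (∑ i, a i * Y i ω, ∑ i, b i * Z i ω)) μ :=
    hYm.aestronglyMeasurable.aemeasurable.prodMk hZm.aestronglyMeasurable.aemeasurable
  have hYvar : Var[fun ω => ∑ i, a i * Y i ω; μ] = v * ∫ s, (∑ i, a i * f i s) ^ 2 := by
    simpa using hvar 1 0
  have hZvar : Var[fun ω => ∑ i, b i * Z i ω; μ] = v * ∫ s, (∑ i, b i * g i s) ^ 2 := by
    simpa using hvar 0 1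
  refine ⟨⟨isGaussian_of_map_eq_gaussianReal fun L => ?_⟩, ?_, hYvar, ?_⟩
  · refine ⟨0, (v * ∫ s, (L (1, 0) * ∑ i, a i * f i s +
      L (0, 1) * ∑ i, b i * g i s) ^ 2).toNNReal, ?_⟩
    rw [AEMeasurable.map_map_of_aemeasurable (by fun_prop) hpm]
    convert hlin (L (1, 0)) (L (0, 1)) using 2
    ext ω
    have : (∑ i, a i * Y i ω, ∑ i, b i * Z i ω) =
        (∑ i, a i * Y i ω) • ((1, 0) : ℝ × ℝ) + (∑ i, b i * Z i ω) • ((0, 1) : ℝ × ℝ) := by simp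
    rw [Function.comp_apply, this, map_add, map_smul, map_smul, smul_eq_mul, smul_eq_mul, mul_comm,
      mul_comm (L (0, 1))]
  · have h1 := hlin 1 0
    simp only [one_mul, zero_mul, add_zero] at h1
    have h2 := integral_map hYm.aestronglyMeasurable.aemeasurable
      (f := fun x : ℝ => x) (by fun_prop)
    rw [h1, integral_id_gaussianReal] at h2
    exact h2.symm
  -- Polarization: the covariance is read off from the variances of Y, Z and Y + Z.
  · have h1 := variance_fun_add hYm hZm
    have h2 := hvar 1 1
    simp only [one_mul] at h2
    have i1 : Integrable (fun s => (∑ i, a i * f i s) ^ 2) := hfm.integrable_sq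
    have i2 : Integrable (fun s => (∑ i, a i * f i s) * (∑ i, b i * g i s)) :=
      hfm.integrable_mul hgm
    have i3 : Integrable (fun s => (∑ i, b i * g i s) ^ 2) := hgm.integrable_sq
    have h3 : ∫ s, (∑ i, a i * f i s + ∑ i, b i * g i s) ^ 2 = (∫ s, (∑ i, a i * f i s) ^ 2) +
        2 * (∫ s, (∑ i, a i * f i s) * (∑ i, b i * g i s)) + ∫ s, (∑ i, b i * g i s) ^ 2 := by
      have i12 : Integrable (fun s => (∑ i, a i * f i s) ^ 2 +
          2 * ((∑ i, a i * f i s) * (∑ i, b i * g i s))) := i1.add (i2.const_mul 2)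
      rw [← integral_const_mul, ← integral_add i1 (i2.const_mul 2), ← integral_add i12 i3]
      refine integral_congr_ae (ae_of_all _ fun s => ?_)
      dsimp only
      ring
    rw [h2, h3, hYvar, hZvar] at h1
    linarith

end

/-! ### The moving-average kernel -/

/-- `|x| ^ p` for `|x| ≤ 1` and `|x| ^ q` for `1 < |x|`. -/
noncomputable def tailPow (p q x : ℝ) : ℝ := if |x| ≤ 1 then |x| ^ p else |x| ^ q

lemma tailPow_nonneg (p q x : ℝ) : 0 ≤ tailPow p q x := by
  unfold tailPow
  split_ifs <;> positivity

lemma integrable_tailPow {p q : ℝ} (hp : -1 < p) (hq : q < -1) : Integrable (tailPow p q) := by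
  have h : IntegrableOn (fun x : ℝ => if x ≤ 1 then x ^ p else x ^ q) (Set.Ioi 0) := by
    rw [← Set.Ioc_union_Ioi_eq_Ioi zero_le_one]
    refine IntegrableOn.union ?_ ?_
    · have := (intervalIntegral.intervalIntegrable_rpow' (a := 0) (b := 1) hp).1
      exact this.congr_fun (fun x hx => by simp [hx.2]) measurableSet_Ioc
    · exact (integrableOn_Ioi_rpow_of_lt hq one_pos).congr_fun
        (fun x hx => by simp [not_le.2 (Set.mem_Ioi.1 hx)]) measurableSet_Ioi
  exact integrable_comp_abs h

lemma memLp_tailPow {p q : ℝ} (hp : -1 / 2 < p) (hq : q < -1 / 2) :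
    MemLp (tailPow p q) 2 volume := by
  have hm : Measurable (tailPow p q) :=
    Measurable.ite (measurableSet_le (by fun_prop) (by fun_prop)) (by fun_prop) (by fun_prop)
  rw [memLp_two_iff_integrable_sq hm.aestronglyMeasurable]
  have := integrable_tailPow (p := 2 * p) (q := 2 * q) (by linarith) (by linarith)
  refine this.congr (ae_of_all _ fun x => ?_)
  unfold tailPow
  dsimp only
  split_ifs
  · rw [mul_comm, Real.rpow_mul (abs_nonneg _), Real.rpow_two]
  · rw [mul_comm, Real.rpow_mul (abs_nonneg _), Real.rpow_two]

lemma abs_exp_sub_one_le_mul_exp (y : ℝ) : |Real.exp y - 1| ≤ |y| * Real.exp |y| := by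
  rcases le_total 0 y with h | h
  · rw [abs_of_nonneg h, abs_of_nonneg (by linarith [Real.add_one_le_exp y])]
    have h1 := Real.add_one_le_exp (-y)
    have h2 : Real.exp (-y) * Real.exp y = 1 := by rw [← Real.exp_add]; simp
    nlinarith [Real.exp_pos y]
  · rw [abs_of_nonpos h, abs_of_nonpos (by linarith [Real.exp_le_one_iff.2 h])]
    have h1 := Real.add_one_le_exp y
    have h2 := Real.one_le_exp (show 0 ≤ -y by linarith)
    nlinarith

/-- Here x^δ - 1 is about δ log x. The logarithm is absorbed by exp(ε|log x|)/ε, so a full factor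
|δ| comes out at the price of a small power of x. -/
lemma abs_rpow_sub_one_le {x δ ε : ℝ} (hx : 0 < x) (hε : 0 < ε) (hδ : |δ| ≤ ε) :
    |x ^ δ - 1| ≤ |δ| / ε * Real.exp (2 * ε * |Real.log x|) := by
  rw [Real.rpow_def_of_pos hx]
  refine (abs_exp_sub_one_le_mul_exp _).trans ?_
  rw [abs_mul]
  set L := |Real.log x|
  have hL : 0 ≤ L := abs_nonneg _
  have h1 : L ≤ Real.exp (ε * L) / ε := by
    rw [le_div_iff₀ hε]
    linarith [Real.add_one_le_exp (ε * L)]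
  have h2 : Real.exp (L * |δ|) ≤ Real.exp (ε * L) := by
    apply Real.exp_le_exp.2
    nlinarith
  calc L * |δ| * Real.exp (L * |δ|) ≤ (Real.exp (ε * L) / ε) * |δ| * Real.exp (ε * L) := by
        gcongr
    _ = |δ| / ε * Real.exp (2 * ε * L) := by
        rw [show 2 * ε * L = ε * L + ε * L by ring, Real.exp_add]
        ring

lemma abs_rpow_sub_one_le_of_le_one {x δ ε : ℝ} (hx : 0 < x) (hx1 : x ≤ 1) (hε : 0 < ε)
    (hδ : |δ| ≤ ε) : |x ^ δ - 1| ≤ |δ| / ε * x ^ (-(2 * ε)) := by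
  have := abs_rpow_sub_one_le hx hε hδ
  rwa [abs_of_nonpos (Real.log_nonpos hx.le hx1), show 2 * ε * -Real.log x =
    Real.log x * (-(2 * ε)) by ring, ← Real.rpow_def_of_pos hx] at this

lemma abs_rpow_sub_one_le_of_one_le {x δ ε : ℝ} (hx : 1 ≤ x) (hε : 0 < ε)
    (hδ : |δ| ≤ ε) : |x ^ δ - 1| ≤ |δ| / ε * x ^ (2 * ε) := by
  have hx0 : 0 < x := by linarith
  have := abs_rpow_sub_one_le hx0 hε hδ
  rwa [abs_of_nonneg (Real.log_nonneg hx), mul_comm (2 * ε), ← Real.rpow_def_of_pos hx0] at this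

/-- For bounded x one power of x can be traded for the constant B. This lowers the exponent beyond 1
by one, in agreement with the far-field bound and with square integrability at infinity. -/
lemma abs_rpow_sub_rpow_le_tailPow {α δ ε B x : ℝ} (hε : 0 < ε) (hδ : |δ| ≤ ε) (hx : 0 < x)
    (hB : 1 ≤ B) (hxB : x ≤ B) :
    |x ^ (α + δ) - x ^ α| ≤ B / ε * |δ| * tailPow (α - 2 * ε) (α + 2 * ε - 1) x := by
  have e : x ^ (α + δ) - x ^ α = x ^ α * (x ^ δ - 1) := by rw [Real.rpow_add hx]; ring
  rw [e, abs_mul, abs_of_pos (Real.rpow_pos_of_pos hx _), tailPow, abs_of_pos hx]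
  have hd : 0 ≤ |δ| / ε := by positivity
  split_ifs with h
  · calc x ^ α * |x ^ δ - 1| ≤ x ^ α * (|δ| / ε * x ^ (-(2 * ε))) := by
          gcongr; exact abs_rpow_sub_one_le_of_le_one hx h hε hδ
      _ = 1 / ε * |δ| * x ^ (α - 2 * ε) := by
          rw [sub_eq_add_neg, Real.rpow_add hx]; ring
      _ ≤ _ := by gcongr
  · push Not at h
    calc x ^ α * |x ^ δ - 1| ≤ x ^ α * (|δ| / ε * x ^ (2 * ε)) := by
          gcongr; exact abs_rpow_sub_one_le_of_one_le h.le hε hδ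
      _ = x / ε * |δ| * x ^ (α + 2 * ε - 1) := by
          rw [Real.rpow_sub hx, Real.rpow_add hx, Real.rpow_one]; field_simp
      _ ≤ _ := by gcongr

/-- Mean value inequality on [m, ∞) for z^(α+δ) - z^α. Its derivative keeps the factor |δ| and has
one power of z fewer, the decay needed at infinity. -/
lemma abs_rpow_sub_rpow_sub_le {α δ ε m x y : ℝ} (hε : 0 < ε) (hδ : |δ| ≤ ε) (hα : |α| ≤ 1)
    (hq : α + 2 * ε - 1 ≤ 0) (hm : 1 ≤ m) (hx : m ≤ x) (hy : m ≤ y) :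
    |(y ^ (α + δ) - y ^ α) - (x ^ (α + δ) - x ^ α)| ≤
      |δ| * (1 + 1 / ε) * m ^ (α + 2 * ε - 1) * |y - x| := by
  have hder : ∀ z ∈ Set.Ici m, HasDerivWithinAt (fun z : ℝ => z ^ (α + δ) - z ^ α)
      ((α + δ) * z ^ (α + δ - 1) - α * z ^ (α - 1)) (Set.Ici m) z := by
    intro z hz
    have hz0 : z ≠ 0 := (one_pos.trans_le (hm.trans hz)).ne'
    exact ((Real.hasDerivAt_rpow_const (Or.inl hz0)).sub
      (Real.hasDerivAt_rpow_const (Or.inl hz0))).hasDerivWithinAt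
  have hbound : ∀ z ∈ Set.Ici m, ‖(α + δ) * z ^ (α + δ - 1) - α * z ^ (α - 1)‖ ≤
      |δ| * (1 + 1 / ε) * m ^ (α + 2 * ε - 1) := by
    intro z hz
    have hmz : m ≤ z := hz
    have hz1 : 1 ≤ z := hm.trans hmz
    have hz0 : 0 < z := by linarith
    have e : (α + δ) * z ^ (α + δ - 1) - α * z ^ (α - 1) =
        δ * z ^ (α + δ - 1) + α * (z ^ (α - 1) * (z ^ δ - 1)) := by
      rw [show α + δ - 1 = (α - 1) + δ by ring, Real.rpow_add hz0]; ring
    have h1 : |δ * z ^ (α + δ - 1)| ≤ |δ| * z ^ (α + 2 * ε - 1) := by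
      rw [abs_mul, abs_of_pos (Real.rpow_pos_of_pos hz0 _)]
      have := le_abs_self δ
      gcongr
      linarith
    have h2 : |α * (z ^ (α - 1) * (z ^ δ - 1))| ≤ |δ| / ε * z ^ (α + 2 * ε - 1) := by
      rw [abs_mul, abs_mul, abs_of_pos (Real.rpow_pos_of_pos hz0 _)]
      calc |α| * (z ^ (α - 1) * |z ^ δ - 1|) ≤ 1 * (z ^ (α - 1) * (|δ| / ε * z ^ (2 * ε))) := by
            gcongr
            exact abs_rpow_sub_one_le_of_one_le hz1 hε hδ
        _ = _ := by
            rw [show α + 2 * ε - 1 = (α - 1) + 2 * ε by ring, Real.rpow_add hz0]; ring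
    rw [e, Real.norm_eq_abs]
    calc _ ≤ |δ| * z ^ (α + 2 * ε - 1) + |δ| / ε * z ^ (α + 2 * ε - 1) :=
          (abs_add_le _ _).trans (add_le_add h1 h2)
      _ = |δ| * (1 + 1 / ε) * z ^ (α + 2 * ε - 1) := by ring
      _ ≤ _ := by
          gcongr |δ| * (1 + 1 / ε) * ?_
          exact Real.rpow_le_rpow_of_nonpos (by linarith) hmz hq
  exact (convex_Ici m).norm_image_sub_le_of_norm_hasDerivWithin_le hder hbound hx hy

/-- The integrand of fractional Brownian motion with Hurst index `η`. -/
noncomputable def fbmKernel (η t s : ℝ) : ℝ := |t - s| ^ (η - 1 / 2) - |s| ^ (η - 1 / 2)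

lemma measurable_fbmKernel (η t : ℝ) : Measurable (fbmKernel η t) := by
  unfold fbmKernel
  fun_prop

/-- For bounded s the two powers in the kernel are estimated separately. For large s each difference
alone decays too slowly, and the cancellation between the points |t - s| and |s| is used. -/
lemma abs_fbmKernel_sub_le {h ε T η t s : ℝ} (hε : 0 < ε) (hεh : 2 * ε < h)
    (hεh1 : 2 * ε < 1 - h) (hη : |η - h| ≤ ε) (ht : |t| ≤ T) (hs : s ≠ 0) (hts : t - s ≠ 0) :
    |fbmKernel η t s - fbmKernel h t s| ≤
      ((3 * T + 2) / ε + (1 + 1 / ε) * 2 ^ (3 / 2 - h - 2 * ε) * T) * |η - h| *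
      (tailPow (h - 1 / 2 - 2 * ε) (h - 3 / 2 + 2 * ε) (t - s) +
        tailPow (h - 1 / 2 - 2 * ε) (h - 3 / 2 + 2 * ε) s) := by
  have hT : 0 ≤ T := (abs_nonneg t).trans ht
  set α := h - 1 / 2 with hα
  set δ := η - h with hδ
  have hηα : η - 1 / 2 = α + δ := by rw [hα, hδ]; ring
  have hq : h - 3 / 2 + 2 * ε = α + 2 * ε - 1 := by rw [hα]; ring
  have e : fbmKernel η t s - fbmKernel h t s =
      (|t - s| ^ (α + δ) - |t - s| ^ α) - (|s| ^ (α + δ) - |s| ^ α) := by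
    rw [fbmKernel, fbmKernel, hηα, ← hα]; ring
  rw [e, hq]
  have hs' : 0 < |s| := abs_pos.2 hs
  have hts' : 0 < |t - s| := abs_pos.2 hts
  have n1 := tailPow_nonneg (α - 2 * ε) (α + 2 * ε - 1) (t - s)
  have n2 := tailPow_nonneg (α - 2 * ε) (α + 2 * ε - 1) s
  have tabs : ∀ x, tailPow (α - 2 * ε) (α + 2 * ε - 1) |x| =
    tailPow (α - 2 * ε) (α + 2 * ε - 1) x := fun x => by simp [tailPow]
  have c1 : 0 ≤ (3 * T + 2) / ε := by positivity
  have c2 : 0 ≤ (1 + 1 / ε) * 2 ^ (3 / 2 - h - 2 * ε) * T := by positivity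
  -- Beyond 2T + 2 both |s|/2 ≥ 1 and |t - s| ≥ |s|/2 hold, so the mean value bound applies with m =
  -- |s|/2.
  by_cases hsB : |s| ≤ 2 * T + 2
  · have htsB : |t - s| ≤ 3 * T + 2 := by linarith [abs_sub t s]
    have b1 := abs_rpow_sub_rpow_le_tailPow (α := α) hε hη hts' (by linarith) htsB
    have b2 := abs_rpow_sub_rpow_le_tailPow (α := α) hε hη hs' (B := 3 * T + 2) (by linarith)
      (by linarith)
    rw [tabs] at b1 b2
    calc _ ≤ (3 * T + 2) / ε * |δ| * tailPow (α - 2 * ε) (α + 2 * ε - 1) (t - s) +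
          (3 * T + 2) / ε * |δ| * tailPow (α - 2 * ε) (α + 2 * ε - 1) s :=
          (abs_sub _ _).trans (add_le_add b1 b2)
      _ = (3 * T + 2) / ε * |δ| * (tailPow (α - 2 * ε) (α + 2 * ε - 1) (t - s) +
          tailPow (α - 2 * ε) (α + 2 * ε - 1) s) := by ring
      _ ≤ _ := by
          gcongr
          linarith
  · push Not at hsB
    have hm : |s| / 2 ≤ |t - s| := by
      have := abs_sub_abs_le_abs_sub s t
      rw [abs_sub_comm] at this
      linarith
    have hdiff : |(|t - s| - |s|)| ≤ T := by
      rw [abs_sub_comm t s]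
      refine (abs_abs_sub_abs_le_abs_sub _ _).trans ?_
      simpa using ht
    have b := abs_rpow_sub_rpow_sub_le (α := α) hε hη
      (abs_le.2 ⟨by rw [hα]; linarith, by rw [hα]; linarith⟩)
      (by rw [hα]; linarith) (m := |s| / 2) (x := |s|) (by linarith) (by linarith) hm
    have ht2 : tailPow (α - 2 * ε) (α + 2 * ε - 1) s = |s| ^ (α + 2 * ε - 1) := by
      rw [tailPow, if_neg (by linarith)]
    have hpow : (|s| / 2) ^ (α + 2 * ε - 1) =
        2 ^ (3 / 2 - h - 2 * ε) * tailPow (α - 2 * ε) (α + 2 * ε - 1) s := by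
      rw [ht2, Real.div_rpow hs'.le two_pos.le, div_eq_mul_inv, ← Real.rpow_neg two_pos.le,
        mul_comm, ← hq]
      ring_nf
    rw [hpow] at b
    calc _ ≤ |δ| * (1 + 1 / ε) * (2 ^ (3 / 2 - h - 2 * ε) *
          tailPow (α - 2 * ε) (α + 2 * ε - 1) s) * T := b.trans (by gcongr)
      _ = (1 + 1 / ε) * 2 ^ (3 / 2 - h - 2 * ε) * T * |δ| *
          tailPow (α - 2 * ε) (α + 2 * ε - 1) s := by ring
      _ ≤ _ := by
          gcongr <;> linarith

/-- Lipschitz dependence of the kernel on the Hurst index, in `L²` and locally uniformly in `t`. -/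
lemma exists_eLpNorm_fbmKernel_sub_le {h : ℝ} (h0 : 0 < h) (h1 : h < 1) {T : ℝ} (hT : 0 ≤ T) :
    ∃ ε > 0, ∃ C : ℝ, 0 ≤ C ∧ ∀ η t, |η - h| ≤ ε → |t| ≤ T →
      MemLp (fun s => fbmKernel η t s - fbmKernel h t s) 2 volume ∧
      eLpNorm (fun s => fbmKernel η t s - fbmKernel h t s) 2 volume ≤
        ENNReal.ofReal (C * |η - h|) := by
  -- 2ε < h puts the exponent at the singularities above -1/2; 2ε < 1 - h puts the exponent at
  -- infinity below -1/2. Together they give a dominating function in L².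
  obtain ⟨ε, hε, hε1, hε2⟩ : ∃ ε > 0, 2 * ε < h ∧ 2 * ε < 1 - h := by
    refine ⟨min h (1 - h) / 4, by have := lt_min h0 (sub_pos.2 h1); positivity, ?_, ?_⟩
    · linarith [min_le_left h (1 - h)]
    · linarith [min_le_right h (1 - h)]
  obtain ⟨Ψ, c, hΨm, hc0, hbound⟩ : ∃ (Ψ : ℝ → ℝ) (c : ℝ), MemLp Ψ 2 volume ∧ 0 ≤ c ∧
      ∀ η t s : ℝ, |η - h| ≤ ε → |t| ≤ T → s ≠ 0 → t - s ≠ 0 →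
        |fbmKernel η t s - fbmKernel h t s| ≤ c * |η - h| * (Ψ (t - s) + Ψ s) :=
    ⟨_, _, memLp_tailPow (by linarith) (by linarith), by positivity,
      fun η t s hη ht hs hts => abs_fbmKernel_sub_le hε hε1 hε2 hη ht hs hts⟩
  refine ⟨ε, hε, c * (2 * (eLpNorm Ψ 2 volume).toReal), by positivity, fun η t hη ht => ?_⟩
  have hmp := Measure.measurePreserving_sub_left (volume : Measure ℝ) t
  have hΨt : MemLp (fun s => Ψ (t - s)) 2 volume := hΨm.comp_measurePreserving hmp
  have hdom : MemLp (fun s => c * |η - h| * (Ψ (t - s) + Ψ s)) 2 volume :=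
    (hΨt.add hΨm).const_mul _
  have hle : ∀ᵐ s : ℝ, ‖fbmKernel η t s - fbmKernel h t s‖ ≤ c * |η - h| * (Ψ (t - s) + Ψ s) := by
    have hne : ∀ x : ℝ, ∀ᵐ s : ℝ, s ≠ x := fun x => by simp [ae_iff]
    filter_upwards [hne 0, hne t] with s hs0 hst
    exact hbound η t s hη ht hs0 (sub_ne_zero.2 hst.symm)
  refine ⟨hdom.mono' ((measurable_fbmKernel η t).sub
    (measurable_fbmKernel h t)).aestronglyMeasurable hle, ?_⟩
  refine (eLpNorm_mono_ae_real hle).trans ?_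
  have e : (fun s => c * |η - h| * (Ψ (t - s) + Ψ s)) =
      (c * |η - h|) • ((fun s => Ψ (t - s)) + Ψ) := rfl
  rw [e, eLpNorm_const_smul, Real.enorm_of_nonneg (by positivity)]
  have e2 : eLpNorm (fun s => Ψ (t - s)) 2 volume = eLpNorm Ψ 2 volume :=
    eLpNorm_comp_measurePreserving hΨm.aestronglyMeasurable hmp
  calc _ ≤ ENNReal.ofReal (c * |η - h|) * (eLpNorm (fun s => Ψ (t - s)) 2 volume +
        eLpNorm Ψ 2 volume) := by
        gcongr
        exact eLpNorm_add_le hΨt.aestronglyMeasurable hΨm.aestronglyMeasurable (by norm_num)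
    _ = ENNReal.ofReal (c * |η - h|) * ENNReal.ofReal (2 * (eLpNorm Ψ 2 volume).toReal) := by
        rw [e2, ENNReal.ofReal_mul two_pos.le, ENNReal.ofReal_toReal hΨm.eLpNorm_ne_top,
          ENNReal.ofReal_ofNat, two_mul]
    _ = _ := by
        rw [← ENNReal.ofReal_mul (by positivity)]
        congr 1
        ring

/-! ### The filtered power function -/

/-- The mean value inequality is applied twice: to (1 + u)^(α-1), then to (1 + u)^α - αu. -/
lemma exists_one_add_rpow_taylor_bound (α : ℝ) :
    ∃ C : ℝ, 0 ≤ C ∧ ∀ u : ℝ, |u| ≤ 1 / 2 → |(1 + u) ^ α - 1 - α * u| ≤ C * u ^ 2 := by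
  have hpos : ∀ u ∈ Set.Icc (-(1 / 2) : ℝ) (1 / 2), 1 + u ≠ 0 := fun u hu => by
    have := hu.1
    intro h
    linarith
  have hderiv : ∀ p : ℝ, ∀ u ∈ Set.Icc (-(1 / 2) : ℝ) (1 / 2),
      HasDerivAt (fun u : ℝ => (1 + u) ^ p) (p * (1 + u) ^ (p - 1)) u := fun p u hu => by
    simpa using ((hasDerivAt_id u).const_add 1).rpow_const (p := p) (Or.inl (hpos u hu))
  have hcont : ContinuousOn (fun u : ℝ => (α - 1) * (1 + u) ^ (α - 1 - 1))
      (Set.Icc (-(1 / 2)) (1 / 2)) :=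
    continuousOn_const.mul (fun u hu => (hderiv _ u hu).continuousAt.continuousWithinAt)
  obtain ⟨B, hB⟩ := isCompact_Icc.exists_bound_of_continuousOn hcont
  have h0 : (0 : ℝ) ∈ Set.Icc (-(1 / 2) : ℝ) (1 / 2) := by constructor <;> norm_num
  have hB0 : 0 ≤ B := (norm_nonneg _).trans (hB 0 h0)
  have hfirst : ∀ u ∈ Set.Icc (-(1 / 2) : ℝ) (1 / 2), |(1 + u) ^ (α - 1) - 1| ≤ B * |u| := by
    intro u hu
    have := (convex_Icc _ _).norm_image_sub_le_of_norm_hasDerivWithin_le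
      (fun x hx => (hderiv (α - 1) x hx).hasDerivWithinAt) hB h0 hu
    simpa using this
  refine ⟨|α| * B, by positivity, fun u hu => ?_⟩
  have huI : u ∈ Set.Icc (-(1 / 2) : ℝ) (1 / 2) := abs_le.1 hu
  have hsub : ∀ x ∈ Set.uIcc 0 u, |x| ≤ |u| ∧ x ∈ Set.Icc (-(1 / 2) : ℝ) (1 / 2) := by
    intro x hx
    have h1 : |x| ≤ |u| := by simpa using Set.abs_sub_left_of_mem_uIcc hx
    exact ⟨h1, abs_le.1 (h1.trans hu)⟩
  have hlin : ∀ x : ℝ, HasDerivAt (fun u : ℝ => α * u) α x := fun x => by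
    simpa using (hasDerivAt_id x).const_mul α
  have := (convex_uIcc 0 u).norm_image_sub_le_of_norm_hasDerivWithin_le
    (f := fun u : ℝ => (1 + u) ^ α - α * u) (f' := fun u => α * (1 + u) ^ (α - 1) - α)
    (C := |α| * (B * |u|))
    (fun x hx => ((hderiv α x (hsub x hx).2).sub (hlin x)).hasDerivWithinAt)
    (fun x hx => by
      rw [show α * (1 + x) ^ (α - 1) - α = α * ((1 + x) ^ (α - 1) - 1) by ring, norm_mul,
        Real.norm_eq_abs, Real.norm_eq_abs]
      gcongr
      exact (hfirst x (hsub x hx).2).trans (mul_le_mul_of_nonneg_left (hsub x hx).1 hB0))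
    Set.left_mem_uIcc Set.right_mem_uIcc
  simp only [add_zero, Real.one_rpow, mul_zero, sub_zero, Real.norm_eq_abs] at this
  calc _ = |(1 + u) ^ α - α * u - 1| := by ring_nf
    _ ≤ _ := this
    _ = |α| * B * u ^ 2 := by rw [← sq_abs u]; ring

/-- The function `x ↦ ∑ₚ aₚ |p - x| ^ α`. -/
noncomputable def filteredPow {K : ℕ} (a : Fin (K + 1) → ℝ) (α x : ℝ) : ℝ :=
  ∑ p : Fin (K + 1), a p * |((p : ℕ) : ℝ) - x| ^ α

section

variable {K : ℕ} {a : Fin (K + 1) → ℝ} {α : ℝ}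

lemma measurable_filteredPow : Measurable (filteredPow a α) := by
  unfold filteredPow
  fun_prop

/-- Expand |p - x|^α = |x|^α (1 - p/x)^α. The two moment conditions remove the terms of orders 0 and
1, leaving |x|^(α-2), at most |x|^(-3/2) as α ≤ 1/2. The threshold 2K + 1 ensures |p/x| ≤ 1/2. -/
lemma exists_abs_filteredPow_le_of_large (h0 : ∑ p, a p = 0)
    (h1 : ∑ p : Fin (K + 1), ((p : ℕ) : ℝ) * a p = 0) (hα : α ≤ 1 / 2) :
    ∃ C : ℝ, 0 ≤ C ∧ ∀ x : ℝ, 2 * K + 1 ≤ |x| → |filteredPow a α x| ≤ C * |x| ^ (-3 / 2 : ℝ) := by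
  obtain ⟨C, hC0, hC⟩ := exists_one_add_rpow_taylor_bound α
  refine ⟨∑ p, |a p| * (C * K ^ 2), by positivity, fun x hx => ?_⟩
  have hK : (0 : ℝ) ≤ K := K.cast_nonneg
  have hx0 : 0 < |x| := by linarith
  have hxne : x ≠ 0 := abs_pos.1 hx0
  have hpK : ∀ p : Fin (K + 1), ((p : ℕ) : ℝ) ≤ K := fun p => by exact_mod_cast Fin.is_le p
  have hu : ∀ p : Fin (K + 1), |-((p : ℕ) : ℝ) / x| ≤ 1 / 2 := fun p => by
    rw [abs_div, abs_neg, Nat.abs_cast, div_le_iff₀ hx0]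
    linarith [hpK p]
  have hpow : ∀ p : Fin (K + 1), |((p : ℕ) : ℝ) - x| ^ α =
      |x| ^ α * (1 + -((p : ℕ) : ℝ) / x) ^ α := fun p => by
    rw [← Real.mul_rpow hx0.le (by linarith [(abs_le.1 (hu p)).1])]
    congr 1
    rw [← abs_of_nonneg (show 0 ≤ 1 + -((p : ℕ) : ℝ) / x by linarith [(abs_le.1 (hu p)).1]),
      ← abs_mul, abs_sub_comm]
    congr 1
    field_simp
    ring
  have e : filteredPow a α x = |x| ^ α * ∑ p : Fin (K + 1),
      a p * ((1 + -((p : ℕ) : ℝ) / x) ^ α - 1 - α * (-((p : ℕ) : ℝ) / x)) := by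
    have : ∀ p : Fin (K + 1), a p * ((1 + -((p : ℕ) : ℝ) / x) ^ α - 1 - α * (-((p : ℕ) : ℝ) / x)) =
        a p * (1 + -((p : ℕ) : ℝ) / x) ^ α - a p + α / x * (((p : ℕ) : ℝ) * a p) := fun p => by
      ring
    simp_rw [this]
    rw [Finset.sum_add_distrib, Finset.sum_sub_distrib, ← Finset.mul_sum, h0, h1, filteredPow,
      sub_zero, mul_zero, add_zero, Finset.mul_sum]
    exact Finset.sum_congr rfl fun p _ => by rw [hpow]; ring
  have hterm : ∀ p : Fin (K + 1),
      |a p * ((1 + -((p : ℕ) : ℝ) / x) ^ α - 1 - α * (-((p : ℕ) : ℝ) / x))| ≤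
        |a p| * (C * K ^ 2) * |x| ^ (-2 : ℝ) := by
    intro p
    rw [abs_mul, mul_assoc]
    gcongr
    refine (hC _ (hu p)).trans ?_
    rw [Real.rpow_neg hx0.le, Real.rpow_two, sq_abs, div_pow, neg_sq, mul_assoc, ← div_eq_mul_inv]
    gcongr
    exact Fin.is_le p
  rw [e, abs_mul, abs_of_pos (Real.rpow_pos_of_pos hx0 _)]
  calc _ ≤ |x| ^ α * ∑ p, |a p| * (C * K ^ 2) * |x| ^ (-2 : ℝ) := by
        gcongr
        exact (Finset.abs_sum_le_sum_abs _ _).trans (Finset.sum_le_sum fun p _ => hterm p)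
    _ = (∑ p, |a p| * (C * K ^ 2)) * |x| ^ (α + -2) := by
        rw [Real.rpow_add hx0, ← Finset.sum_mul]; ring
    _ ≤ _ := by
        gcongr
        · linarith
        · linarith

/-- One dominating function that covers both the singularities at the integers p and the decay at
infinity, for use in L¹ and in L². -/
lemma exists_abs_filteredPow_le (h0 : ∑ p, a p = 0)
    (h1 : ∑ p : Fin (K + 1), ((p : ℕ) : ℝ) * a p = 0) (hα : α ≤ 1 / 2) :
    ∃ C : ℝ, ∀ x : ℝ, |filteredPow a α x| ≤
      C * ∑ p : Fin (K + 1), tailPow α (-3 / 2) (((p : ℕ) : ℝ) - x) := by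
  obtain ⟨C, hC0, hC⟩ := exists_abs_filteredPow_le_of_large h0 h1 hα
  have hK : (0 : ℝ) ≤ K := K.cast_nonneg
  -- For |x| < 2K + 1 every y = p - x satisfies |y| ≤ B, and if |y| > 1 then |y|^α ≤ |y|^(1/2) =
  -- |y|² |y|^(-3/2) ≤ B² |y|^(-3/2).
  set B : ℝ := 3 * K + 1 with hB
  refine ⟨C + ∑ p, |a p| * B ^ 2, fun x => ?_⟩
  have hsum0 : 0 ≤ ∑ p : Fin (K + 1), tailPow α (-3 / 2) (((p : ℕ) : ℝ) - x) :=
    Finset.sum_nonneg fun p _ => tailPow_nonneg _ _ _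
  have hsumB : 0 ≤ ∑ p, |a p| * B ^ 2 := by positivity
  rw [add_mul]
  rcases le_or_gt (2 * K + 1 : ℝ) |x| with hx | hx
  · have h2 : |x| ^ (-3 / 2 : ℝ) ≤ ∑ p : Fin (K + 1), tailPow α (-3 / 2) (((p : ℕ) : ℝ) - x) := by
      rcases (show (1 : ℝ) ≤ |x| by linarith).eq_or_lt with h | h
      · refine le_trans (le_of_eq ?_) (Finset.single_le_sum (fun p _ => tailPow_nonneg _ _ _)
          (Finset.mem_univ (0 : Fin (K + 1))))
        simp [tailPow, ← h]
      · refine le_trans (le_of_eq ?_) (Finset.single_le_sum (fun p _ => tailPow_nonneg _ _ _)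
          (Finset.mem_univ (0 : Fin (K + 1))))
        simp [tailPow, not_le.2 h]
    have := mul_le_mul_of_nonneg_left h2 hC0
    have h3 := mul_nonneg hsumB hsum0
    linarith [hC x hx]
  · have hterm : ∀ p : Fin (K + 1), |a p * |((p : ℕ) : ℝ) - x| ^ α| ≤
        |a p| * B ^ 2 * tailPow α (-3 / 2) (((p : ℕ) : ℝ) - x) := by
      intro p
      rw [abs_mul, abs_of_nonneg (by positivity : (0 : ℝ) ≤ |((p : ℕ) : ℝ) - x| ^ α), mul_assoc]
      gcongr
      have hy : |((p : ℕ) : ℝ) - x| ≤ B := by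
        have := abs_sub ((p : ℕ) : ℝ) x
        rw [Nat.abs_cast] at this
        have : ((p : ℕ) : ℝ) ≤ K := by exact_mod_cast Fin.is_le p
        linarith
      have hB1 : 1 ≤ B := by linarith
      generalize ((p : ℕ) : ℝ) - x = y at hy
      unfold tailPow
      split_ifs with h
      · have : 1 ≤ B ^ 2 := by nlinarith
        exact le_mul_of_one_le_left (by positivity) this
      · push Not at h
        have hy0 : 0 < |y| := by linarith
        calc |y| ^ α ≤ |y| ^ (2 + -3 / 2 : ℝ) := by
              gcongr
              · exact h.le
              · linarith
          _ = |y| ^ 2 * |y| ^ (-3 / 2 : ℝ) := by rw [Real.rpow_add hy0, Real.rpow_two]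
          _ ≤ _ := by gcongr
    have h4 : |filteredPow a α x| ≤ (∑ p, |a p| * B ^ 2) *
        ∑ p : Fin (K + 1), tailPow α (-3 / 2) (((p : ℕ) : ℝ) - x) := by
      refine (Finset.abs_sum_le_sum_abs _ _).trans ?_
      rw [Finset.sum_mul]
      refine Finset.sum_le_sum fun p _ => (hterm p).trans ?_
      gcongr
      exact Finset.single_le_sum (f := fun p : Fin (K + 1) =>
        tailPow α (-3 / 2) (((p : ℕ) : ℝ) - x)) (fun p _ => tailPow_nonneg _ _ _)
        (Finset.mem_univ p)
    have := mul_nonneg hC0 hsum0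
    linarith

lemma integrable_filteredPow (h0 : ∑ p, a p = 0)
    (h1 : ∑ p : Fin (K + 1), ((p : ℕ) : ℝ) * a p = 0) (hα' : -1 < α) (hα : α ≤ 1 / 2) :
    Integrable (filteredPow a α) := by
  obtain ⟨C, hC⟩ := exists_abs_filteredPow_le h0 h1 hα
  refine Integrable.mono' (Integrable.const_mul (integrable_finsetSum _ fun p _ => ?_) C)
    measurable_filteredPow.aestronglyMeasurable (ae_of_all _ hC)
  exact (integrable_tailPow hα' (by norm_num)).comp_sub_left ((p : ℕ) : ℝ)

lemma memLp_filteredPow (h0 : ∑ p, a p = 0)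
    (h1 : ∑ p : Fin (K + 1), ((p : ℕ) : ℝ) * a p = 0) (hα' : -1 / 2 < α) (hα : α ≤ 1 / 2) :
    MemLp (filteredPow a α) 2 volume := by
  obtain ⟨C, hC⟩ := exists_abs_filteredPow_le h0 h1 hα
  have hp : ∀ p : Fin (K + 1), MemLp (fun x => tailPow α (-3 / 2) (((p : ℕ) : ℝ) - x)) 2 volume :=
    fun p => (memLp_tailPow hα' (by norm_num)).comp_measurePreserving
      (Measure.measurePreserving_sub_left volume ((p : ℕ) : ℝ))
  have hsum := memLp_finsetSum Finset.univ fun p _ => hp p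
  exact (hsum.const_mul C).mono' measurable_filteredPow.aestronglyMeasurable (ae_of_all _ hC)

/-- The power function with a non-integer exponent in `(-1, 1)` has no vanishing filtered version. -/
lemma integral_filteredPow_sq_pos (hL2 : MemLp (filteredPow a α) 2 volume) (hα0 : α ≠ 0)
    (hα1 : α < 1) (ha : ∃ p, a p ≠ 0) :
    0 < ∫ x, filteredPow a α x ^ 2 := by
  refine lt_of_le_of_ne (integral_nonneg fun _ => sq_nonneg _) fun hzero => ?_
  obtain ⟨p₀, hp₀⟩ := ha
  have hae : filteredPow a α =ᵐ[volume] 0 := by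
    have := (integral_eq_zero_iff_of_nonneg (fun _ => sq_nonneg _) hL2.integrable_sq).1 hzero.symm
    exact this.mono fun x hx => by simpa using hx
  obtain ⟨x₀, hx₀⟩ : ∃ x₀ : ℝ, x₀ = ((p₀ : ℕ) : ℝ) := ⟨_, rfl⟩
  -- Only the p₀ term is singular at x₀; `ψ` collects the others, which are differentiable there.
  let ψ : ℝ → ℝ := fun x => ∑ p ∈ Finset.univ.erase p₀, a p * |((p : ℕ) : ℝ) - x| ^ α
  have hsplit : ∀ x, filteredPow a α x = a p₀ * |x₀ - x| ^ α + ψ x := fun x => by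
    rw [hx₀]
    exact (Finset.add_sum_erase _ _ (Finset.mem_univ p₀)).symm
  have hne : ∀ x ∈ Set.Ioo x₀ (x₀ + 1), ∀ p : Fin (K + 1), ((p : ℕ) : ℝ) - x ≠ 0 := by
    intro x hx p hpx
    have h2 : ((p : ℕ) : ℝ) = x := by linarith
    rw [← h2, hx₀] at hx
    have h3 : (p₀ : ℕ) < (p : ℕ) := by exact_mod_cast hx.1
    have h4 : (p : ℕ) < (p₀ : ℕ) + 1 := by exact_mod_cast hx.2
    omega
  have hcont : ContinuousOn (filteredPow a α) (Set.Ioo x₀ (x₀ + 1)) := by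
    intro x hx
    refine ContinuousAt.continuousWithinAt ?_
    unfold filteredPow
    refine tendsto_finsetSum _ fun p _ => ?_
    exact (continuousAt_const.mul (ContinuousAt.rpow_const (by fun_prop)
      (Or.inl (abs_ne_zero.2 (hne x hx p)))))
  -- No singularity lies strictly between consecutive integers, so continuity upgrades vanishing
  -- almost everywhere to vanishing everywhere.
  have heq : Set.EqOn (filteredPow a α) 0 (Set.Ioo x₀ (x₀ + 1)) :=
    Measure.eqOn_open_of_ae_eq (ae_restrict_of_ae hae) isOpen_Ioo hcont continuousOn_const
  have hψ : DifferentiableAt ℝ ψ x₀ := by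
    refine DifferentiableAt.fun_sum fun p hp => ?_
    have hpne : ((p : ℕ) : ℝ) - x₀ ≠ 0 := by
      rw [hx₀, sub_ne_zero]
      exact_mod_cast fun h => (Finset.mem_erase.1 hp).1 (Fin.ext h)
    refine DifferentiableAt.const_mul ?_ _
    refine DifferentiableAt.rpow_const ?_ (Or.inl (abs_ne_zero.2 hpne))
    exact (differentiableAt_abs hpne).comp x₀ (by fun_prop)
  obtain ⟨C, hC⟩ := (hψ.hasDerivAt.isBigO_sub).bound
  have hC2 : ∀ᶠ δ in 𝓝[>] (0 : ℝ), |ψ (x₀ + δ) - ψ x₀| ≤ C * δ := by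
    have ht : Tendsto (fun δ : ℝ => x₀ + δ) (𝓝[>] 0) (𝓝 x₀) := by
      have : Tendsto (fun δ : ℝ => x₀ + δ) (𝓝 0) (𝓝 x₀) :=
        (continuous_const_add x₀).tendsto' _ _ (add_zero _)
      exact this.mono_left nhdsWithin_le_nhds
    filter_upwards [ht.eventually hC, self_mem_nhdsWithin] with δ h hδ
    have hδ : 0 < δ := hδ
    simpa [abs_of_pos hδ] using h
  have hhalf : Tendsto (fun δ : ℝ => δ / 2) (𝓝[>] 0) (𝓝[>] 0) := by
    refine tendsto_nhdsWithin_iff.2 ⟨?_, ?_⟩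
    · have : Tendsto (fun δ : ℝ => δ / 2) (𝓝 0) (𝓝 0) :=
        (continuous_id.div_const 2).tendsto' _ _ (zero_div _)
      exact this.mono_left nhdsWithin_le_nhds
    · filter_upwards [self_mem_nhdsWithin] with δ hδ
      exact half_pos (Set.mem_Ioi.1 hδ)
  have hval : ∀ δ ∈ Set.Ioo (0 : ℝ) 1, ψ (x₀ + δ) = -(a p₀ * δ ^ α) := by
    intro δ hδ
    have h1 := heq (show x₀ + δ ∈ Set.Ioo x₀ (x₀ + 1) from
      ⟨by linarith [hδ.1], by linarith [hδ.2]⟩)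
    rw [hsplit, show x₀ - (x₀ + δ) = -δ by ring, abs_neg, abs_of_pos hδ.1] at h1
    simp only [Pi.zero_apply] at h1
    linarith
  -- Comparing δ with δ/2 eliminates the value ψ(x₀). The factor 1 - 2^(-α) is nonzero because α ≠
  -- 0, and c δ^α ≤ 2Cδ then contradicts α < 1 as δ → 0.
  obtain ⟨c, hcpos, hc⟩ : ∃ c, 0 < c ∧ c = |a p₀| * |1 - (2 : ℝ) ^ (-α)| := by
    refine ⟨_, ?_, rfl⟩
    refine mul_pos (abs_pos.2 hp₀) (abs_pos.2 (sub_ne_zero.2 ?_))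
    intro h
    have := Real.rpow_right_inj two_pos (by norm_num : (2 : ℝ) ≠ 1) |>.1
      (h.symm.trans (Real.rpow_zero 2).symm)
    exact hα0 (by linarith)
  have hbound : ∀ᶠ δ in 𝓝[>] (0 : ℝ), δ ^ (α - 1) ≤ 2 * C / c := by
    have hlt : ∀ᶠ δ in 𝓝[>] (0 : ℝ), δ ∈ Set.Ioo (0 : ℝ) 1 := Ioo_mem_nhdsGT one_pos
    filter_upwards [hC2, hhalf.eventually hC2, hlt] with δ h1 h2 hδ
    have hδ2 : δ / 2 ∈ Set.Ioo (0 : ℝ) 1 := ⟨by linarith [hδ.1], by linarith [hδ.1, hδ.2]⟩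
    have hδ0 : 0 < δ := hδ.1
    have hC0 : 0 ≤ C := by
      by_contra hneg
      push Not at hneg
      linarith [abs_nonneg (ψ (x₀ + δ) - ψ x₀), mul_neg_of_neg_of_pos hneg hδ0]
    have h3 : |ψ (x₀ + δ) - ψ (x₀ + δ / 2)| ≤ 2 * C * δ := by
      have := abs_sub_le (ψ (x₀ + δ)) (ψ x₀) (ψ (x₀ + δ / 2))
      rw [abs_sub_comm (ψ x₀)] at this
      nlinarith
    rw [hval δ hδ, hval _ hδ2, Real.div_rpow hδ0.le two_pos.le,
      show -(a p₀ * δ ^ α) - -(a p₀ * (δ ^ α / 2 ^ α)) = -(a p₀ * (1 - (2 ^ α)⁻¹) * δ ^ α) by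
        rw [div_eq_mul_inv]; ring, ← Real.rpow_neg two_pos.le, abs_neg, abs_mul, abs_mul,
      abs_of_pos (Real.rpow_pos_of_pos hδ0 _), ← hc] at h3
    rw [le_div_iff₀ hcpos, Real.rpow_sub hδ0, Real.rpow_one, div_mul_eq_mul_div, div_le_iff₀ hδ0]
    linarith
  have htop : Tendsto (fun δ : ℝ => δ ^ (α - 1)) (𝓝[>] 0) atTop :=
    tendsto_rpow_neg_nhdsGT_zero (by linarith)
  obtain ⟨δ, h1, h2⟩ := (hbound.and (htop.eventually_gt_atTop (2 * C / c))).exists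
  linarith

end

/-- The autocorrelations at integer lags of an integrable function that decays faster than
`|x| ^ (-3/2)` are square summable. -/
lemma summable_sq_integral_mul_comp_sub {G : ℝ → ℝ} (hint : Integrable G)
    {C X₀ : ℝ} (hC : 0 ≤ C) (hX : 0 < X₀)
    (hdecay : ∀ x : ℝ, X₀ ≤ |x| → |G x| ≤ C * |x| ^ (-3 / 2 : ℝ)) :
    Summable fun j : ℤ => (∫ x, G x * G (x - j)) ^ 2 := by
  set I := ∫ x, |G x| with hI
  have hI0 : 0 ≤ I := integral_nonneg fun _ => abs_nonneg _
  have hbound : ∀ j : ℤ, 2 * X₀ ≤ |(j : ℝ)| →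
      ‖(∫ x, G x * G (x - j)) ^ 2‖ ≤ (C * 2 ^ (3 / 2 : ℝ) * (2 * I)) ^ 2 * |(j : ℝ)| ^ (-3 : ℝ) := by
    intro j hj
    have hj0 : 0 < |(j : ℝ)| := by linarith
    set D := C * (2 ^ (3 / 2 : ℝ) * |(j : ℝ)| ^ (-3 / 2 : ℝ)) with hD
    have hD0 : 0 ≤ D := by positivity
    have hfar : ∀ y : ℝ, |(j : ℝ)| / 2 ≤ |y| → |G y| ≤ D := by
      intro y hy
      refine (hdecay y (by linarith)).trans ?_
      rw [hD]
      gcongr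
      calc |y| ^ (-3 / 2 : ℝ) ≤ (|(j : ℝ)| / 2) ^ (-3 / 2 : ℝ) :=
            Real.rpow_le_rpow_of_nonpos (by positivity) hy (by norm_num)
        _ = _ := by
            rw [Real.div_rpow hj0.le two_pos.le, div_eq_mul_inv, ← Real.rpow_neg two_pos.le,
              mul_comm]
            norm_num
    -- For each x, |x| or |x - j| is at least |j|/2, so one factor is O(|j|^(-3/2)) and the other is
    -- integrated.
    have hpt : ∀ x : ℝ, |G x * G (x - j)| ≤ D * (|G x| + |G (x - j)|) := by
      intro x
      rw [abs_mul]
      have n1 := abs_nonneg (G x)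
      have n2 := abs_nonneg (G (x - j))
      by_cases hx : |(j : ℝ)| / 2 ≤ |x|
      · nlinarith [mul_le_mul_of_nonneg_right (hfar x hx) n2, mul_nonneg hD0 n1]
      · have : |(j : ℝ)| / 2 ≤ |x - j| := by
          have := abs_sub_abs_le_abs_sub (j : ℝ) x
          rw [abs_sub_comm x]
          linarith
        nlinarith [mul_le_mul_of_nonneg_right (hfar _ this) n1, mul_nonneg hD0 n2]
    have hint' : Integrable fun x => |G (x - j)| := (hint.comp_sub_right (j : ℝ)).abs
    have h1 : |∫ x, G x * G (x - j)| ≤ D * (2 * I) := by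
      calc _ ≤ ∫ x, |G x * G (x - j)| := abs_integral_le_integral_abs
        _ ≤ ∫ x, D * (|G x| + |G (x - j)|) := by
            refine integral_mono_of_nonneg (ae_of_all _ fun _ => abs_nonneg _)
              ((hint.abs.add hint').const_mul D) (ae_of_all _ hpt)
        _ = _ := by
            rw [integral_const_mul, integral_add hint.abs hint',
              integral_sub_right_eq_self (fun x => |G x|) (j : ℝ), ← hI, two_mul]
    rw [norm_pow, Real.norm_eq_abs]
    calc _ ≤ (D * (2 * I)) ^ 2 := by gcongr
      _ = (C * 2 ^ (3 / 2 : ℝ) * (2 * I)) ^ 2 * (|(j : ℝ)| ^ (-3 / 2 : ℝ)) ^ 2 := by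
          rw [hD]; ring
      _ = _ := by
          rw [← Real.rpow_natCast (|(j : ℝ)| ^ (-3 / 2 : ℝ)), ← Real.rpow_mul hj0.le]
          norm_num
  refine Summable.of_norm_bounded_eventually
    (g := fun j : ℤ => (C * 2 ^ (3 / 2 : ℝ) * (2 * I)) ^ 2 * |(j : ℝ)| ^ (-3 : ℝ))
    ((Real.summable_abs_int_rpow (by norm_num)).mul_left _) ?_
  have hlarge : ∀ᶠ j : ℤ in cofinite, 2 * X₀ ≤ |(j : ℝ)| := by
    have : Tendsto (fun j : ℤ => |(j : ℝ)|) cofinite atTop := by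
      have := tendsto_norm_cocompact_atTop (E := ℝ) |>.comp Int.tendsto_coe_cofinite
      simpa [Function.comp_def] using this
    exact this.eventually_ge_atTop _
  exact hlarge.mono hbound

/-! ### The window -/

/-- The points k + p increase with p, so only p = 0 and p = K constrain k; the half-width in k is r
· r^(-γ) = r^(1-γ). -/
lemma window_eq_Icc (K : ℕ) (γ t₀ : ℝ) {r : ℝ} (hr : 0 < r) :
    window K γ t₀ r =
      (Finset.Icc ⌈r * t₀ - r ^ (1 - γ)⌉ ⌊r * t₀ + r ^ (1 - γ) - K⌋ : Finset ℤ) := by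
  have key : ∀ x : ℝ, |x / r - t₀| ≤ 1 / r ^ γ ↔
      r * t₀ - r ^ (1 - γ) ≤ x ∧ x ≤ r * t₀ + r ^ (1 - γ) := by
    intro x
    have h1 : x / r - t₀ = (x - r * t₀) / r := by field_simp
    rw [h1, abs_div, abs_of_pos hr, div_le_iff₀ hr, div_mul_eq_mul_div, one_mul,
      Real.rpow_sub hr, Real.rpow_one, abs_le]
    constructor <;> rintro ⟨h, h'⟩ <;> constructor <;> linarith
  ext k
  simp only [window, Set.mem_ofPred_eq, key, Finset.coe_Icc, Set.mem_Icc, Int.ceil_le, Int.le_floor]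
  constructor
  · intro h
    have h0 := (h 0).1
    have h1 := (h (Fin.last K)).2
    simp only [Fin.val_zero, Nat.cast_zero, add_zero, Fin.val_last] at h0 h1
    exact ⟨h0, by linarith⟩
  · rintro ⟨h0, h1⟩ p
    have hp0 : (0 : ℝ) ≤ (p : ℕ) := Nat.cast_nonneg _
    have hpK : ((p : ℕ) : ℝ) ≤ K := by exact_mod_cast Fin.is_le p
    constructor <;> linarith

lemma finite_window (K : ℕ) (γ t₀ : ℝ) {r : ℝ} (hr : 0 < r) : (window K γ t₀ r).Finite := by
  rw [window_eq_Icc K γ t₀ hr]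
  exact Finset.finite_toSet _

/-- The cardinality exceeds 2r^(1-γ) - (K + 1), and half of the leading term eventually absorbs the
boundary loss. -/
lemma eventually_rpow_le_ncard_window (K : ℕ) {γ : ℝ} (hγ : γ < 1) (t₀ : ℝ) :
    ∀ᶠ r : ℝ in atTop, r ^ (1 - γ) ≤ (window K γ t₀ r).ncard := by
  have hK : ∀ᶠ r : ℝ in atTop, (K : ℝ) + 1 ≤ r ^ (1 - γ) :=
    (tendsto_rpow_atTop (by linarith)).eventually_ge_atTop _
  filter_upwards [hK, eventually_gt_atTop 0] with r h hr
  rw [window_eq_Icc K γ t₀ hr, Set.ncard_coe_finset, Int.card_Icc]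
  have h1 := Int.lt_floor_add_one (r * t₀ + r ^ (1 - γ) - K)
  have h2 := Int.ceil_lt_add_one (r * t₀ - r ^ (1 - γ))
  have h3 : ((⌊r * t₀ + r ^ (1 - γ) - K⌋ + 1 - ⌈r * t₀ - r ^ (1 - γ)⌉ : ℤ) : ℝ) ≤
      ((⌊r * t₀ + r ^ (1 - γ) - K⌋ + 1 - ⌈r * t₀ - r ^ (1 - γ)⌉).toNat : ℝ) := by
    exact_mod_cast Int.self_le_toNat _
  push_cast at h3
  linarith

/-! ### Local comparison with fractional Brownian motion -/

/-- The integrand of `r ^ h` times the discrete variation of the multifractional motion. -/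
noncomputable def variationKernel {K : ℕ} (a : Fin (K + 1) → ℝ) (H : ℝ → ℝ) (h r : ℝ) (k : ℤ)
    (s : ℝ) : ℝ :=
  ∑ p : Fin (K + 1), (r ^ h * a p) *
    fbmKernel (H (((k : ℝ) + (p : ℕ)) / r)) (((k : ℝ) + (p : ℕ)) / r) s

/-- Self-similarity: scaling out r leaves r^h r^(-(h-1/2)) = r^(1/2). The term |s|^(h-1/2) does not
depend on p and is killed by ∑ aₚ = 0. -/
lemma variationKernel_const {K : ℕ} {a : Fin (K + 1) → ℝ} (h0 : ∑ p, a p = 0) (h : ℝ) {r : ℝ}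
    (hr : 0 < r) (k : ℤ) (s : ℝ) :
    variationKernel a (fun _ => h) h r k s =
      r ^ (1 / 2 : ℝ) * filteredPow a (h - 1 / 2) (r * s - k) := by
  have e1 : ∀ p : Fin (K + 1), |((k : ℝ) + (p : ℕ)) / r - s| ^ (h - 1 / 2) =
      r ^ (-(h - 1 / 2)) * |((p : ℕ) : ℝ) - (r * s - k)| ^ (h - 1 / 2) := fun p => by
    have : ((k : ℝ) + (p : ℕ)) / r - s = r⁻¹ * (((p : ℕ) : ℝ) - (r * s - k)) := by
      field_simp; ring
    rw [this, abs_mul, abs_of_pos (inv_pos.2 hr), Real.mul_rpow (inv_nonneg.2 hr.le) (abs_nonneg _),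
      Real.inv_rpow hr.le, Real.rpow_neg hr.le]
  have e2 : ∀ p : Fin (K + 1), (r ^ h * a p) * fbmKernel h (((k : ℝ) + (p : ℕ)) / r) s =
      r ^ (1 / 2 : ℝ) * (a p * |((p : ℕ) : ℝ) - (r * s - k)| ^ (h - 1 / 2)) -
        r ^ h * |s| ^ (h - 1 / 2) * a p := fun p => by
    have : r ^ (1 / 2 : ℝ) = r ^ h * r ^ (-(h - 1 / 2)) := by
      rw [← Real.rpow_add hr]; congr 1; ring
    rw [fbmKernel, e1, this]
    ring
  simp_rw [variationKernel, e2]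
  rw [Finset.sum_sub_distrib, ← Finset.mul_sum, ← Finset.mul_sum, h0, mul_zero, sub_zero,
    filteredPow]

lemma memLp_sqrt_mul_comp_affine {G : ℝ → ℝ} (hG : MemLp G 2 volume) (hGm : Measurable G) {r : ℝ}
    (hr : 0 < r) (y : ℝ) : MemLp (fun s => r ^ (1 / 2 : ℝ) * G (r * s - y)) 2 volume := by
  refine MemLp.const_mul ?_ _
  have hm : Measurable fun s => G (r * s - y) := hGm.comp (by fun_prop)
  rw [memLp_two_iff_integrable_sq hm.aestronglyMeasurable]
  exact (hG.integrable_sq.comp_sub_right y).comp_mul_left' hr.ne'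

/-- Stationarity: the correlation depends neither on the scale r nor on more than the lag z - y. -/
lemma integral_sqrt_mul_comp_affine (G : ℝ → ℝ) {r : ℝ} (hr : 0 < r) (y z : ℝ) :
    ∫ s, (r ^ (1 / 2 : ℝ) * G (r * s - y)) * (r ^ (1 / 2 : ℝ) * G (r * s - z)) =
      ∫ x, G x * G (x - (z - y)) := by
  have hrr : r ^ (1 / 2 : ℝ) * r ^ (1 / 2 : ℝ) = r := by
    rw [← Real.rpow_add hr]; norm_num
  have e : ∀ s, (r ^ (1 / 2 : ℝ) * G (r * s - y)) * (r ^ (1 / 2 : ℝ) * G (r * s - z)) =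
      r * (fun x => G (x - y) * G (x - z)) (r * s) := fun s => by
    calc _ = (r ^ (1 / 2 : ℝ) * r ^ (1 / 2 : ℝ)) * (G (r * s - y) * G (r * s - z)) := by ring
      _ = _ := by rw [hrr]
  simp_rw [e]
  rw [integral_const_mul,
    Measure.integral_comp_mul_left (fun x => G (x - y) * G (x - z)), abs_of_pos (inv_pos.2 hr), smul_eq_mul,
    ← mul_assoc, mul_inv_cancel₀ hr.ne', one_mul,
    ← integral_sub_right_eq_self (fun x => G x * G (x - (z - y))) y]
  congr 1
  ext x
  congr 2
  ring

lemma abs_inner_sub_inner_le {E : Type*} [NormedAddCommGroup E] [InnerProductSpace ℝ E]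
    {x x' y y' : E} {s d : ℝ} (hx : ‖x - y‖ ≤ d) (hx' : ‖x' - y'‖ ≤ d) (hy : ‖y‖ = s)
    (hy' : ‖y'‖ = s) : |inner ℝ x x' - inner ℝ y y'| ≤ (2 * s + d) * d := by
  have e : inner ℝ x x' - inner ℝ y y' = inner ℝ (x - y) x' + inner ℝ y (x' - y') := by
    rw [inner_sub_left, inner_sub_right]; ring
  have hd : 0 ≤ d := (norm_nonneg _).trans hx
  have hs : 0 ≤ s := hy ▸ norm_nonneg _
  have hx'n : ‖x'‖ ≤ s + d := by
    calc ‖x'‖ = ‖y' + (x' - y')‖ := by congr 1; abel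
      _ ≤ ‖y'‖ + ‖x' - y'‖ := norm_add_le _ _
      _ ≤ _ := by rw [hy']; linarith
  have h1 : |inner ℝ (x - y) x'| ≤ d * (s + d) :=
    (abs_real_inner_le_norm _ _).trans (mul_le_mul hx hx'n (norm_nonneg _) hd)
  have h2 : |inner ℝ y (x' - y')| ≤ s * d :=
    (abs_real_inner_le_norm _ _).trans (mul_le_mul hy.le hx' (norm_nonneg _) hs)
  rw [e]
  calc _ ≤ _ := abs_add_le _ _
    _ ≤ _ := add_le_add h1 h2
    _ = _ := by ring

lemma eventually_sampling_points {U : Set ℝ} {H : ℝ → ℝ} {t₀ : ℝ} (ht₀ : t₀ ∈ interior U)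
    (hH : DifferentiableAt ℝ H t₀) (K : ℕ) {γ : ℝ} (hγ : 0 < γ) :
    ∃ C : ℝ, 0 ≤ C ∧ ∀ᶠ r : ℝ in atTop, ∀ k ∈ window K γ t₀ r, ∀ p : Fin (K + 1),
      ((k : ℝ) + (p : ℕ)) / r ∈ U ∧ |((k : ℝ) + (p : ℕ)) / r| ≤ |t₀| + 1 ∧
      |H (((k : ℝ) + (p : ℕ)) / r) - H t₀| ≤ C * r ^ (-γ) := by
  obtain ⟨C, hC⟩ := hH.hasDerivAt.isBigO_sub.bound
  obtain ⟨δ, hδ, hball⟩ := Metric.eventually_nhds_iff.1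
    (hC.and (mem_interior_iff_mem_nhds.1 ht₀))
  refine ⟨|C|, abs_nonneg _, ?_⟩
  have hlim : ∀ᶠ r : ℝ in atTop, r ^ (-γ) < min δ 1 :=
    (tendsto_rpow_neg_atTop hγ).eventually_lt_const (lt_min hδ one_pos)
  filter_upwards [hlim, eventually_gt_atTop 0] with r hr hr0 k hk p
  have hp : |((k : ℝ) + (p : ℕ)) / r - t₀| ≤ r ^ (-γ) := by
    rw [Real.rpow_neg hr0.le, ← one_div]
    exact hk p
  generalize ((k : ℝ) + (p : ℕ)) / r = t at hp
  obtain ⟨h1, h2⟩ := hball (show dist t t₀ < δ from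
    (hp.trans_lt hr).trans_le (min_le_left _ _))
  refine ⟨h2, ?_, ?_⟩
  · have := abs_sub_abs_le_abs_sub t t₀
    have : r ^ (-γ) < 1 := hr.trans_le (min_le_right _ _)
    linarith
  · rw [Real.norm_eq_abs, Real.norm_eq_abs] at h1
    refine h1.trans (mul_le_mul (le_abs_self C) hp (abs_nonneg _) (abs_nonneg _))

/-- Near `t₀` the rescaled variations of the multifractional motion have, up to an error
`O(r ^ (H t₀ - γ))`, the covariances of a stationary sequence. -/
lemma exists_variationKernel_estimate {U : Set ℝ} {H : ℝ → ℝ} {t₀ : ℝ} (ht₀ : t₀ ∈ interior U)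
    (hH : DifferentiableAt ℝ H t₀) (hH0 : 0 < H t₀) (hH1 : H t₀ < 1) {K : ℕ}
    {a : Fin (K + 1) → ℝ} (h0 : ∑ p, a p = 0) (h1 : ∑ p : Fin (K + 1), ((p : ℕ) : ℝ) * a p = 0)
    {γ : ℝ} (hγ : H t₀ < γ)
    (hmem : ∀ t ∈ U, MemLp (fbmKernel (H t) t) 2 volume) :
    ∃ C : ℝ, 0 ≤ C ∧ ∀ᶠ r : ℝ in atTop, ∀ k ∈ window K γ t₀ r,
      |√(∫ s, variationKernel a H (H t₀) r k s ^ 2) -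
        √(∫ x, filteredPow a (H t₀ - 1 / 2) x ^ 2)| ≤ C * r ^ (H t₀ - γ) ∧
      ∀ k' ∈ window K γ t₀ r,
        |(∫ s, variationKernel a H (H t₀) r k s * variationKernel a H (H t₀) r k' s) -
          ∫ x, filteredPow a (H t₀ - 1 / 2) x *
            filteredPow a (H t₀ - 1 / 2) (x - ((k' - k : ℤ) : ℝ))| ≤ C * r ^ (H t₀ - γ) := by
  obtain ⟨h, hh⟩ : ∃ h, h = H t₀ := ⟨_, rfl⟩
  rw [← hh] at hH0 hH1 hγ ⊢
  obtain ⟨C₁, hC₁, hpts⟩ := eventually_sampling_points ht₀ hH K (hH0.trans hγ)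
  obtain ⟨ε, hε, C₂, hC₂, hker⟩ := exists_eLpNorm_fbmKernel_sub_le hH0 hH1
    (show 0 ≤ |t₀| + 1 by positivity)
  obtain ⟨G, hG⟩ : ∃ G, G = filteredPow a (h - 1 / 2) := ⟨_, rfl⟩
  have hGmem : MemLp G 2 volume := hG ▸ memLp_filteredPow h0 h1 (by linarith) (by linarith)
  have hGmeas : Measurable G := hG ▸ measurable_filteredPow
  rw [← hG]
  obtain ⟨σ, hσ⟩ : ∃ σ, σ = √(∫ x, G x ^ 2) := ⟨_, rfl⟩
  have hσ0 : 0 ≤ σ := hσ ▸ Real.sqrt_nonneg _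
  rw [← hσ]
  obtain ⟨D, hD⟩ : ∃ D, D = ∑ p, |a p| * (C₂ * C₁) := ⟨_, rfl⟩
  have hD0 : 0 ≤ D := by rw [hD]; positivity
  -- One constant for both claims: norms differ by at most D r^(h-γ), inner products by at most (2σ
  -- + D r^(h-γ)) D r^(h-γ), and r^(h-γ) ≤ 1.
  refine ⟨(2 * σ + D + 1) * D, by positivity, ?_⟩
  have hsmall : ∀ᶠ r : ℝ in atTop, C₁ * r ^ (-γ) ≤ ε := by
    have := (tendsto_rpow_neg_atTop (hH0.trans hγ)).const_mul C₁
    rw [mul_zero] at this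
    exact (this.eventually_lt_const hε).mono fun r hr => hr.le
  filter_upwards [hpts, hsmall, eventually_ge_atTop 1] with r hp hrε hr1
  have hr : 0 < r := by linarith
  have hδ1 : r ^ (h - γ) ≤ 1 := Real.rpow_le_one_of_one_le_of_nonpos hr1 (by linarith)
  have hδ0 : 0 ≤ r ^ (h - γ) := by positivity
  have hFmem : ∀ k ∈ window K γ t₀ r, MemLp (variationKernel a H h r k) 2 volume := fun k hk =>
    memLp_finsetSum _ fun p _ => (hmem _ (hp k hk p).1).const_mul _
  have hgeq : ∀ k, variationKernel a (fun _ => h) h r k =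
      fun s => r ^ (1 / 2 : ℝ) * G (r * s - k) := fun k => by
    ext s
    rw [variationKernel_const h0 h hr, hG]
  have hgmem : ∀ k, MemLp (variationKernel a (fun _ => h) h r k) 2 volume := fun k => by
    rw [hgeq]
    exact memLp_sqrt_mul_comp_affine hGmem hGmeas hr _
  have hginner : ∀ k k', inner ℝ ((hgmem k).toLp _) ((hgmem k').toLp _) =
      ∫ x, G x * G (x - ((k' - k : ℤ) : ℝ)) := fun k k' => by
    rw [inner_toLp_eq_integral]
    simp_rw [hgeq]
    rw [integral_sqrt_mul_comp_affine G hr, Int.cast_sub]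
  have hgnorm : ∀ k, ‖(hgmem k).toLp _‖ = σ := fun k => by
    have := hginner k k
    rw [real_inner_self_eq_norm_sq, sub_self, Int.cast_zero] at this
    simp_rw [sub_zero, ← pow_two] at this
    rw [hσ, ← this, Real.sqrt_sq (norm_nonneg _)]
  -- The normalization r^h meets the index error C₁ r^(-γ) and the Lipschitz constant C₂; this is
  -- the source of the exponent h - γ in the rate.
  have hdiff : ∀ k (hk : k ∈ window K γ t₀ r),
      ‖(hFmem k hk).toLp _ - (hgmem k).toLp _‖ ≤ D * r ^ (h - γ) := by
    intro k hk
    rw [← MemLp.toLp_sub, Lp.norm_toLp]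
    refine ENNReal.toReal_le_of_le_ofReal (by positivity) ?_
    have e : variationKernel a H h r k - variationKernel a (fun _ => h) h r k =
        ∑ p : Fin (K + 1), (r ^ h * a p) • fun s =>
          fbmKernel (H (((k : ℝ) + (p : ℕ)) / r)) (((k : ℝ) + (p : ℕ)) / r) s -
            fbmKernel h (((k : ℝ) + (p : ℕ)) / r) s := by
      ext s
      simp only [variationKernel, Pi.sub_apply, Finset.sum_apply, Pi.smul_apply, smul_eq_mul,
        ← Finset.sum_sub_distrib, mul_sub]
    have hle : ∀ p : Fin (K + 1), |H (((k : ℝ) + (p : ℕ)) / r) - h| ≤ C₁ * r ^ (-γ) := fun p => by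
      rw [hh]; exact (hp k hk p).2.2
    have hkerp := fun p : Fin (K + 1) => hker _ (((k : ℝ) + (p : ℕ)) / r)
      ((hle p).trans hrε) (hp k hk p).2.1
    rw [e]
    refine (eLpNorm_sum_le (fun p _ => ((hkerp p).1.const_smul _).aestronglyMeasurable)
      (by norm_num)).trans ?_
    calc _ ≤ ∑ p : Fin (K + 1), ENNReal.ofReal (|a p| * (C₂ * C₁) * r ^ (h - γ)) := by
          refine Finset.sum_le_sum fun p _ => ?_
          rw [eLpNorm_const_smul, Real.enorm_eq_ofReal_abs]
          refine (mul_le_mul_right (hkerp p).2 _).trans ?_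
          rw [← ENNReal.ofReal_mul (abs_nonneg _)]
          refine ENNReal.ofReal_le_ofReal ?_
          rw [abs_mul, abs_of_pos (Real.rpow_pos_of_pos hr _), sub_eq_add_neg h,
            Real.rpow_add hr]
          calc _ ≤ r ^ h * |a p| * (C₂ * (C₁ * r ^ (-γ))) := by
                gcongr
                exact hle p
            _ = _ := by ring
      _ = _ := by
          rw [← ENNReal.ofReal_sum_of_nonneg fun p _ => by positivity, ← Finset.sum_mul, hD]
  have hconst1 : D * r ^ (h - γ) ≤ (2 * σ + D + 1) * D * r ^ (h - γ) := by
    have : D ≤ (2 * σ + D + 1) * D := by nlinarith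
    gcongr
  intro k hk
  refine ⟨?_, fun k' hk' => ?_⟩
  · have h3 : √(∫ s, variationKernel a H h r k s ^ 2) = ‖(hFmem k hk).toLp _‖ := by
      rw [← norm_toLp_sq_eq_integral (hFmem k hk), Real.sqrt_sq (norm_nonneg _)]
    rw [h3, ← hgnorm k]
    exact ((abs_norm_sub_norm_le _ _).trans (hdiff k hk)).trans (by rw [hgnorm k]; exact hconst1)
  · have h4 := abs_inner_sub_inner_le (hdiff k hk) (hdiff k' hk') (hgnorm k) (hgnorm k')
    rw [hginner, inner_toLp_eq_integral] at h4
    refine h4.trans ?_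
    have : 2 * σ + D * r ^ (h - γ) ≤ 2 * σ + D + 1 := by nlinarith
    rw [mul_assoc]
    exact mul_le_mul_of_nonneg_right this (by positivity)

/-! ### Second moments of averages of negative powers of Gaussian variables -/

lemma HasGaussianLaw.integrable_abs_rpow {Ω : Type*} [MeasurableSpace Ω] {μ : Measure Ω}
    {X : Ω → ℝ} (hX : HasGaussianLaw X μ)
    (hX0 : ∫ ω, X ω ∂μ = 0) {β : ℝ} (hβ : -1 < β) :
    Integrable (fun ω => |X ω| ^ β) μ ∧
      ∫ ω, |X ω| ^ β ∂μ = √Var[X; μ] ^ β * normalAbsMoment β := by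
  have hm : AEMeasurable (fun ω => |X ω| ^ β) μ := by
    have := hX.aemeasurable
    fun_prop
  have hl : ∫⁻ ω, ENNReal.ofReal (|X ω| ^ β) ∂μ =
      ENNReal.ofReal (√Var[X; μ] ^ β * normalAbsMoment β) := by
    have h1 := lintegral_abs_rpow_gaussianReal hβ (Var[X; μ]).toNNReal
    have hlaw := hX.map_eq_gaussianReal
    rw [hX0] at hlaw
    rw [← hlaw, lintegral_map' (by fun_prop) hX.aemeasurable,
      Real.coe_toNNReal _ (variance_nonneg _ _)] at h1
    exact h1
  have hnn : 0 ≤ᵐ[μ] fun ω => |X ω| ^ β := ae_of_all _ fun ω => by positivity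
  have hint : Integrable (fun ω => |X ω| ^ β) μ :=
    (lintegral_ofReal_ne_top_iff_integrable hm.aestronglyMeasurable hnn).1
      (hl ▸ ENNReal.ofReal_ne_top)
  refine ⟨hint, ?_⟩
  rw [integral_eq_lintegral_of_nonneg_ae hnn hm.aestronglyMeasurable, hl,
    ENNReal.toReal_ofReal (mul_nonneg (by positivity) (normalAbsMoment_pos hβ).le)]

section

variable {Ω : Type*} [MeasurableSpace Ω] {μ : Measure Ω} [IsProbabilityMeasure μ]

lemma HasGaussianLaw.integral_abs_rpow_mul_le {X Y : Ω → ℝ}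
    (hXY : HasGaussianLaw (fun ω => (X ω, Y ω)) μ)
    (hX0 : ∫ ω, X ω ∂μ = 0) (hY0 : ∫ ω, Y ω ∂μ = 0) (hX : 0 < Var[X; μ]) (hY : 0 < Var[Y; μ])
    {β : ℝ} (hβ : -1 / 2 < β) (hβ0 : β < 0) :
    Integrable (fun ω => |X ω| ^ β * |Y ω| ^ β) μ ∧
    ∫ ω, |X ω| ^ β * |Y ω| ^ β ∂μ ≤
      (√Var[X; μ] * √Var[Y; μ]) ^ β * (normalAbsMoment β ^ 2 +
        cov[X, Y; μ] ^ 2 / (Var[X; μ] * Var[Y; μ]) * normalAbsMoment (2 * β)) := by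
  have hle := HasGaussianLaw.lintegral_abs_rpow_mul_le hXY hX0 hY0 hX hY hβ hβ0
  have hm : AEMeasurable (fun ω => |X ω| ^ β * |Y ω| ^ β) μ := by
    have := hXY.fst.aemeasurable
    have := hXY.snd.aemeasurable
    fun_prop
  have hnn : 0 ≤ᵐ[μ] fun ω => |X ω| ^ β * |Y ω| ^ β := ae_of_all _ fun ω => by positivity
  have hint := (lintegral_ofReal_ne_top_iff_integrable hm.aestronglyMeasurable hnn).1
      (hle.trans_lt ENNReal.ofReal_lt_top).ne
  refine ⟨hint, ?_⟩
  rw [integral_eq_lintegral_of_nonneg_ae hnn hm.aestronglyMeasurable]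
  refine ENNReal.toReal_le_of_le_ofReal ?_ hle
  have h1 := normalAbsMoment_pos (β := 2 * β) (by linarith)
  positivity

/-- Expand the square. Products of means recombine with c into the squared bias, and what remains is
bounded by the squared correlations. Upper bounds on the mixed moments suffice. -/
lemma integral_sq_average_sub_le {κ : Type*} {S : Finset κ} (hS : S.Nonempty) {ξ : κ → Ω → ℝ}
    (hlaw : ∀ i ∈ S, ∀ j ∈ S, HasGaussianLaw (fun ω => (ξ i ω, ξ j ω)) μ)
    (hmean : ∀ i ∈ S, ∫ ω, ξ i ω ∂μ = 0) (hvar : ∀ i ∈ S, 0 < Var[ξ i; μ])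
    {β : ℝ} (hβ : -1 / 2 < β) (hβ0 : β < 0) (c : ℝ) :
    Integrable (fun ω => (1 / (S.card : ℝ) * ∑ i ∈ S, |ξ i ω| ^ β - c) ^ 2) μ ∧
    ∫ ω, (1 / (S.card : ℝ) * ∑ i ∈ S, |ξ i ω| ^ β - c) ^ 2 ∂μ ≤
      (1 / (S.card : ℝ) * ∑ i ∈ S, (√Var[ξ i; μ] ^ β * normalAbsMoment β - c)) ^ 2 +
      (1 / (S.card : ℝ)) ^ 2 * ∑ i ∈ S, ∑ j ∈ S, (√Var[ξ i; μ] * √Var[ξ j; μ]) ^ β *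
        (cov[ξ i, ξ j; μ] ^ 2 / (Var[ξ i; μ] * Var[ξ j; μ]) * normalAbsMoment (2 * β)) := by
  set N : ℝ := (S.card : ℝ) with hN
  have hN0 : 0 < N := by rw [hN]; exact_mod_cast hS.card_pos
  have h1 := fun i hi => HasGaussianLaw.integrable_abs_rpow (hlaw i hi i hi).fst (hmean i hi)
    (β := β) (by linarith)
  have h2 := fun i hi j hj => HasGaussianLaw.integral_abs_rpow_mul_le (hlaw i hi j hj)
    (hmean i hi) (hmean j hj) (hvar i hi) (hvar j hj) hβ hβ0
  have e : ∀ ω, (1 / N * ∑ i ∈ S, |ξ i ω| ^ β - c) ^ 2 =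
      (1 / N) ^ 2 * ∑ i ∈ S, ∑ j ∈ S, |ξ i ω| ^ β * |ξ j ω| ^ β +
        (-(2 * c / N) * ∑ i ∈ S, |ξ i ω| ^ β + c ^ 2) := by
    intro ω
    rw [← Finset.sum_mul_sum]
    ring
  have i1 : Integrable (fun ω => ∑ i ∈ S, |ξ i ω| ^ β) μ :=
    integrable_finsetSum _ fun i hi => (h1 i hi).1
  have i2 : Integrable (fun ω => ∑ i ∈ S, ∑ j ∈ S, |ξ i ω| ^ β * |ξ j ω| ^ β) μ :=
    integrable_finsetSum _ fun i hi => integrable_finsetSum _ fun j hj => (h2 i hi j hj).1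
  have i3 : Integrable (fun ω => -(2 * c / N) * ∑ i ∈ S, |ξ i ω| ^ β + c ^ 2) μ :=
    (i1.const_mul _).add (integrable_const _)
  simp_rw [e]
  refine ⟨(i2.const_mul _).add i3, ?_⟩
  rw [integral_add (i2.const_mul _) i3, integral_const_mul, integral_add (i1.const_mul _)
    (integrable_const _), integral_const_mul, integral_const, probReal_univ, one_smul,
    integral_finsetSum _ fun i hi => (h1 i hi).1, integral_finsetSum _ fun i hi =>
      integrable_finsetSum _ fun j hj => (h2 i hi j hj).1]
  have hsum2 : ∑ i ∈ S, ∫ ω, ∑ j ∈ S, |ξ i ω| ^ β * |ξ j ω| ^ β ∂μ ≤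
      (∑ i ∈ S, √Var[ξ i; μ] ^ β * normalAbsMoment β) ^ 2 +
      ∑ i ∈ S, ∑ j ∈ S, (√Var[ξ i; μ] * √Var[ξ j; μ]) ^ β *
        (cov[ξ i, ξ j; μ] ^ 2 / (Var[ξ i; μ] * Var[ξ j; μ]) * normalAbsMoment (2 * β)) := by
    rw [pow_two, Finset.sum_mul_sum, ← Finset.sum_add_distrib]
    refine Finset.sum_le_sum fun i hi => ?_
    rw [integral_finsetSum _ fun j hj => (h2 i hi j hj).1, ← Finset.sum_add_distrib]
    refine Finset.sum_le_sum fun j hj => (h2 i hi j hj).2.trans (le_of_eq ?_)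
    rw [Real.mul_rpow (Real.sqrt_nonneg _) (Real.sqrt_nonneg _)]
    ring
  rw [Finset.sum_congr rfl fun i hi => (h1 i hi).2]
  have hsub : ∑ i ∈ S, (√Var[ξ i; μ] ^ β * normalAbsMoment β - c) = (∑ i ∈ S, √Var[ξ i; μ] ^ β * normalAbsMoment β) - N * c := by
    rw [Finset.sum_sub_distrib, Finset.sum_const, nsmul_eq_mul]
  rw [hsub]
  have h3 := mul_le_mul_of_nonneg_left hsum2 (by positivity : 0 ≤ (1 / N) ^ 2)
  refine (add_le_add_left h3 _).trans (le_of_eq ?_)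
  generalize (∑ i ∈ S, √Var[ξ i; μ] ^ β * normalAbsMoment β) = x
  generalize (∑ i ∈ S, ∑ j ∈ S, (√Var[ξ i; μ] * √Var[ξ j; μ]) ^ β *
    (cov[ξ i, ξ j; μ] ^ 2 / (Var[ξ i; μ] * Var[ξ j; μ]) * normalAbsMoment (2 * β))) = y
  field_simp
  ring

lemma abs_rpow_sub_rpow_le_of_half_le {β s x : ℝ} (hβ : β < 0) (hs : 0 < s) (hx : s / 2 ≤ x) :
    |x ^ β - s ^ β| ≤ |β| * (s / 2) ^ (β - 1) * |x - s| := by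
  have hs2 : 0 < s / 2 := by positivity
  refine (convex_Ici (s / 2)).norm_image_sub_le_of_norm_hasDerivWithin_le
    (f := fun y : ℝ => y ^ β) (f' := fun y => β * y ^ (β - 1)) (fun y hy => ?_) (fun y hy => ?_)
    (Set.mem_Ici.2 (by linarith)) hx
  · exact (Real.hasDerivAt_rpow_const (Or.inl (hs2.trans_le hy).ne')).hasDerivWithinAt
  · rw [norm_mul, Real.norm_eq_abs, Real.norm_eq_abs,
      abs_of_pos (Real.rpow_pos_of_pos (hs2.trans_le hy) _)]
    exact mul_le_mul_of_nonneg_left (Real.rpow_le_rpow_of_nonpos hs2 hy (by linarith))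
      (abs_nonneg _)

/-- The mean square error of the average of `|ξ i| ^ β`, for Gaussian variables whose covariances
are within `e` of those of a stationary sequence with square summable covariances. -/
lemma exists_integral_sq_average_sub_le {v s β : ℝ} (hv : 0 < v) (hs : 0 < s) (hβ : -1 / 2 < β)
    (hβ0 : β < 0) {R : ℤ → ℝ} (hR : Summable fun j => R j ^ 2) :
    ∃ A : ℝ, 0 ≤ A ∧ ∀ (S : Finset ℤ) (ξ : ℤ → Ω → ℝ) (τ : ℤ → ℝ) (c : ℤ → ℤ → ℝ) (e : ℝ),
      S.Nonempty → (∀ i ∈ S, ∀ j ∈ S, HasGaussianLaw (fun ω => (ξ i ω, ξ j ω)) μ) →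
      (∀ i ∈ S, ∫ ω, ξ i ω ∂μ = 0) → (∀ i ∈ S, Var[ξ i; μ] = v * τ i ^ 2) →
      (∀ i ∈ S, |τ i - s| ≤ e) → (∀ i ∈ S, ∀ j ∈ S, cov[ξ i, ξ j; μ] = v * c i j) →
      (∀ i ∈ S, ∀ j ∈ S, |c i j - R (j - i)| ≤ e) → e ≤ s / 2 →
      Integrable (fun ω => (1 / (S.card : ℝ) * ∑ i ∈ S, |ξ i ω| ^ β -
        (√v * s) ^ β * normalAbsMoment β) ^ 2) μ ∧
      ∫ ω, (1 / (S.card : ℝ) * ∑ i ∈ S, |ξ i ω| ^ β -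
        (√v * s) ^ β * normalAbsMoment β) ^ 2 ∂μ ≤ A * (e ^ 2 + 1 / S.card) := by
  obtain ⟨m, hm⟩ : ∃ m, m = normalAbsMoment β := ⟨_, rfl⟩
  obtain ⟨m₂, hm₂⟩ : ∃ m₂, m₂ = normalAbsMoment (2 * β) := ⟨_, rfl⟩
  have hm0 : 0 < m := hm ▸ normalAbsMoment_pos (by linarith)
  have hm₂0 : 0 < m₂ := hm₂ ▸ normalAbsMoment_pos (by linarith)
  obtain ⟨T, hT⟩ : ∃ T, T = ∑' j, R j ^ 2 := ⟨_, rfl⟩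
  have hT0 : 0 ≤ T := hT ▸ tsum_nonneg fun _ => sq_nonneg _
  -- L is a Lipschitz constant of the mean as a function of τ ≥ s/2, where all τ i lie because e ≤
  -- s/2. B below is the factor of the squared-correlation bound under the same restriction.
  obtain ⟨L, hL⟩ : ∃ L, L = √v ^ β * m * (|β| * (s / 2) ^ (β - 1)) := ⟨_, rfl⟩
  have hL0 : 0 ≤ L := by rw [hL]; positivity
  obtain ⟨B, hB⟩ : ∃ B, B = ((√v * (s / 2)) * (√v * (s / 2))) ^ β * (16 / s ^ 4 * m₂) := ⟨_, rfl⟩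
  have hB0 : 0 ≤ B := by rw [hB]; positivity
  refine ⟨L ^ 2 + 2 * B + 2 * B * T, by positivity, ?_⟩
  intro S ξ τ c e hS hlaw hmean hvar hτ hcov hc he
  have hτ2 : ∀ i ∈ S, s / 2 ≤ τ i := fun i hi => by
    have := (abs_le.1 (hτ i hi)).1
    linarith
  have hτ0 : ∀ i ∈ S, 0 < τ i := fun i hi => by linarith [hτ2 i hi]
  have hsd : ∀ i ∈ S, √Var[ξ i; μ] = √v * τ i := fun i hi => by
    rw [hvar i hi, Real.sqrt_mul hv.le, Real.sqrt_sq (hτ0 i hi).le]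
  have hvpos : ∀ i ∈ S, 0 < Var[ξ i; μ] := fun i hi => by
    rw [hvar i hi]
    have := hτ0 i hi
    positivity
  have he0 : 0 ≤ e := by
    obtain ⟨i, hi⟩ := hS
    exact (abs_nonneg _).trans (hτ i hi)
  obtain ⟨hint, hle⟩ := integral_sq_average_sub_le hS hlaw hmean hvpos hβ hβ0
    ((√v * s) ^ β * normalAbsMoment β)
  rw [← hm] at hint hle ⊢
  rw [← hm₂] at hle
  refine ⟨hint, hle.trans ?_⟩
  obtain ⟨N, hN⟩ : ∃ N, N = (S.card : ℝ) := ⟨_, rfl⟩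
  have hN0 : 0 < N := by rw [hN]; exact_mod_cast hS.card_pos
  rw [← hN]
  have hbias : |1 / N * ∑ i ∈ S, (√Var[ξ i; μ] ^ β * m - (√v * s) ^ β * m)| ≤ L * e := by
    have hterm : ∀ i ∈ S, |√Var[ξ i; μ] ^ β * m - (√v * s) ^ β * m| ≤ L * e := fun i hi => by
      rw [hsd i hi, Real.mul_rpow (Real.sqrt_nonneg _) (hτ0 i hi).le,
        Real.mul_rpow (Real.sqrt_nonneg _) hs.le,
        show √v ^ β * τ i ^ β * m - √v ^ β * s ^ β * m = √v ^ β * m * (τ i ^ β - s ^ β) by ring,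
        abs_mul, abs_of_nonneg (by positivity : 0 ≤ √v ^ β * m), hL, mul_assoc (√v ^ β * m)]
      gcongr
      exact (abs_rpow_sub_rpow_le_of_half_le hβ0 hs (hτ2 i hi)).trans (by
        have := hτ i hi
        gcongr)
    rw [abs_mul, abs_of_pos (by positivity : 0 < 1 / N)]
    calc _ ≤ 1 / N * ∑ i ∈ S, L * e := by
          gcongr
          exact (Finset.abs_sum_le_sum_abs _ _).trans (Finset.sum_le_sum hterm)
      _ = L * e := by
          rw [Finset.sum_const, nsmul_eq_mul, ← hN]
          field_simp
  have hcorr : ∀ i ∈ S, ∀ j ∈ S, (√Var[ξ i; μ] * √Var[ξ j; μ]) ^ β *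
        (cov[ξ i, ξ j; μ] ^ 2 / (Var[ξ i; μ] * Var[ξ j; μ]) * m₂) ≤
        B * (2 * R (j - i) ^ 2 + 2 * e ^ 2) := by
    intro i hi j hj
    have hti := hτ2 i hi
    have htj := hτ2 j hj
    have hi0 := hτ0 i hi
    have hj0 := hτ0 j hj
    have h1 : (√Var[ξ i; μ] * √Var[ξ j; μ]) ^ β ≤ ((√v * (s / 2)) * (√v * (s / 2))) ^ β := by
      rw [hsd i hi, hsd j hj]
      refine Real.rpow_le_rpow_of_nonpos (by positivity) ?_ hβ0.le
      gcongr
    have h2 : cov[ξ i, ξ j; μ] ^ 2 / (Var[ξ i; μ] * Var[ξ j; μ]) ≤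
        16 / s ^ 4 * (2 * R (j - i) ^ 2 + 2 * e ^ 2) := by
      rw [hcov i hi j hj, hvar i hi, hvar j hj]
      have h3 : (v * c i j) ^ 2 / (v * τ i ^ 2 * (v * τ j ^ 2)) =
          c i j ^ 2 / (τ i ^ 2 * τ j ^ 2) := by
        field_simp
      have h4 : c i j ^ 2 ≤ 2 * R (j - i) ^ 2 + 2 * e ^ 2 := by
        have h5 : (c i j - R (j - i)) ^ 2 ≤ e ^ 2 := sq_le_sq' (abs_le.1 (hc i hi j hj)).1
          (abs_le.1 (hc i hi j hj)).2
        nlinarith [sq_nonneg (c i j - 2 * R (j - i))]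
      have h6 : s ^ 4 / 16 ≤ τ i ^ 2 * τ j ^ 2 := by
        calc s ^ 4 / 16 = (s / 2) ^ 2 * (s / 2) ^ 2 := by ring
          _ ≤ _ := by gcongr
      rw [h3, div_le_iff₀ (by positivity)]
      calc c i j ^ 2 ≤ 2 * R (j - i) ^ 2 + 2 * e ^ 2 := h4
        _ = 16 / s ^ 4 * (2 * R (j - i) ^ 2 + 2 * e ^ 2) * (s ^ 4 / 16) := by field_simp
        _ ≤ _ := by gcongr
    have hVi := hvpos i hi
    have hVj := hvpos j hj
    calc _ ≤ ((√v * (s / 2)) * (√v * (s / 2))) ^ β *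
          (16 / s ^ 4 * (2 * R (j - i) ^ 2 + 2 * e ^ 2) * m₂) := by gcongr
      _ = _ := by rw [hB]; ring
  -- Each row is a translate of part of the series of R², so summability over ℤ bounds it uniformly
  -- in i.
  have hrow : ∀ i ∈ S, ∑ j ∈ S, R (j - i) ^ 2 ≤ T := by
    intro i _
    rw [hT, ← (Equiv.subRight i).tsum_eq]
    exact ((Equiv.subRight i).summable_iff.2 hR).sum_le_tsum S (fun _ _ => sq_nonneg _)
  have hdouble : ∑ i ∈ S, ∑ j ∈ S, (√Var[ξ i; μ] * √Var[ξ j; μ]) ^ β *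
        (cov[ξ i, ξ j; μ] ^ 2 / (Var[ξ i; μ] * Var[ξ j; μ]) * m₂) ≤
        N * (B * (2 * T + N * (2 * e ^ 2))) := by
    calc _ ≤ ∑ i ∈ S, B * (2 * T + N * (2 * e ^ 2)) := by
          refine Finset.sum_le_sum fun i hi => (Finset.sum_le_sum (hcorr i hi)).trans ?_
          rw [← Finset.mul_sum, Finset.sum_add_distrib, ← Finset.mul_sum, Finset.sum_const,
            nsmul_eq_mul, ← hN]
          gcongr
          exact hrow i hi
      _ = _ := by rw [Finset.sum_const, nsmul_eq_mul, hN]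
  -- Over N² pairs the R² part totals O(N) and the error part O(N² e²); division by N² leaves 1/N
  -- and e².
  calc _ ≤ (L * e) ^ 2 + (1 / N) ^ 2 * (N * (B * (2 * T + N * (2 * e ^ 2)))) := by
        refine add_le_add (sq_le_sq' (abs_le.1 hbias).1 (abs_le.1 hbias).2) ?_
        gcongr
    _ = L ^ 2 * e ^ 2 + 2 * B * e ^ 2 + 2 * B * T * (1 / N) := by
        field_simp
        ring
    _ ≤ _ := by
        have : 0 ≤ 1 / N := by positivity
        nlinarith [mul_nonneg (sq_nonneg L) this, mul_nonneg hB0 this,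
          mul_nonneg (mul_nonneg hB0 hT0) (sq_nonneg e)]

end

/-! ### Stochastic orders -/

section

variable {Ω : Type*} [MeasurableSpace Ω] {μ : Measure Ω} [IsProbabilityMeasure μ]

lemma measure_lt_abs_le_of_integral_sq_le {Z : Ω → ℝ} (hZ : Integrable (fun ω => Z ω ^ 2) μ)
    {B t : ℝ} (hB : ∫ ω, Z ω ^ 2 ∂μ ≤ B) (ht : 0 < t) :
    μ {ω | t < |Z ω|} ≤ ENNReal.ofReal (B / t ^ 2) := by
  have h1 := mul_meas_ge_le_integral_of_nonneg (ae_of_all μ fun ω => sq_nonneg (Z ω)) hZ (t ^ 2)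
  have h2 : {ω | t < |Z ω|} ⊆ {ω | t ^ 2 ≤ Z ω ^ 2} := fun ω (hω : t < |Z ω|) => by
    show t ^ 2 ≤ Z ω ^ 2
    rw [← sq_abs (Z ω)]
    gcongr
  refine (measure_mono h2).trans ?_
  rw [← ofReal_measureReal]
  refine ENNReal.ofReal_le_ofReal ?_
  rw [le_div_iff₀ (by positivity)]
  linarith

lemma exists_measure_lt_abs_le {Y : Ω → ℝ} (hY : AEMeasurable Y μ) {ε : ℝ} (hε : 0 < ε) :
    ∃ C : ℝ, 0 < C ∧ μ {ω | C < |Y ω|} ≤ ENNReal.ofReal ε := by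
  have hanti : Antitone fun n : ℕ => {ω | (n : ℝ) < |Y ω|} := fun m n hmn ω (hω : (n : ℝ) < |Y ω|) =>
    show (m : ℝ) < |Y ω| from lt_of_le_of_lt (by exact_mod_cast hmn) hω
  have hnull : ∀ n : ℕ, NullMeasurableSet {ω | (n : ℝ) < |Y ω|} μ := fun n =>
    nullMeasurableSet_lt aemeasurable_const (by fun_prop)
  have hlim := tendsto_measure_iInter_atTop hnull hanti ⟨0, measure_ne_top _ _⟩
  have hempty : ⋂ n : ℕ, {ω | (n : ℝ) < |Y ω|} = ∅ := by
    refine Set.eq_empty_of_forall_notMem fun ω hω => ?_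
    obtain ⟨n, hn⟩ := exists_nat_ge |Y ω|
    have : (n : ℝ) < |Y ω| := Set.mem_iInter.1 hω n
    linarith
  rw [hempty, measure_empty] at hlim
  obtain ⟨n, hn, hn1⟩ := ((hlim.eventually_lt_const (ENNReal.ofReal_pos.2 hε)).and
    (eventually_ge_atTop 1)).exists
  exact ⟨n, by exact_mod_cast hn1, hn.le⟩

/-- The definition takes a supremum over all n: the finitely many early indices are tight one by
one, and their constants are added. Working with ε/2 gives the strict inequality. -/
lemma isBoundedInProb_of_eventually {Y : ℕ → Ω → ℝ} (hY : ∀ n, AEMeasurable (Y n) μ)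
    (h : ∀ ε : ℝ, 0 < ε → ∃ C : ℝ, 0 < C ∧ ∀ᶠ n in atTop, μ {ω | C < |Y n ω|} ≤ ENNReal.ofReal ε) :
    IsBoundedInProb μ Y := by
  intro ε hε
  obtain ⟨C, hC, hev⟩ := h (ε / 2) (half_pos hε)
  obtain ⟨n₀, hn₀⟩ := eventually_atTop.1 hev
  choose D hD hDle using fun n => exists_measure_lt_abs_le (hY n) (half_pos hε)
  have hsum : 0 ≤ ∑ n ∈ Finset.range n₀, D n := Finset.sum_nonneg fun n _ => (hD n).le
  refine ⟨C + ∑ n ∈ Finset.range n₀, D n, by linarith, ?_⟩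
  refine lt_of_le_of_lt (iSup_le fun n => ?_) ((ENNReal.ofReal_lt_ofReal_iff hε).2 (half_lt_self hε))
  rcases le_or_gt n₀ n with hn | hn
  · refine (measure_mono fun ω hω => ?_).trans (hn₀ n hn)
    have hω : C + ∑ n ∈ Finset.range n₀, D n < |Y n ω| := hω
    show C < |Y n ω|
    linarith
  · refine (measure_mono fun ω hω => ?_).trans (hDle n)
    have hω : C + ∑ n ∈ Finset.range n₀, D n < |Y n ω| := hω
    show D n < |Y n ω|
    have := Finset.single_le_sum (fun n _ => (hD n).le) (Finset.mem_range.2 hn)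
    linarith

/-- Convergence in probability with a rate, from eventual tightness at that rate. -/
lemma tendstoInMeasure_and_isBigOInProb {F : ℕ → Ω → ℝ} {c : ℝ} {d : ℕ → ℝ}
    (hd : ∀ᶠ n in atTop, 0 < d n) (hd0 : Tendsto d atTop (𝓝 0))
    (hF : ∀ᶠ n in atTop, AEMeasurable (F n) μ)
    (h : ∀ ε : ℝ, 0 < ε → ∃ C : ℝ, 0 < C ∧ ∀ᶠ n in atTop,
      μ {ω | C * d n < |F n ω - c|} ≤ ENNReal.ofReal ε) :
    TendstoInMeasure μ F atTop (fun _ => c) ∧ IsBigOInProb μ (fun n ω => F n ω - c) d := by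
  constructor
  · rw [tendstoInMeasure_iff_norm]
    intro δ hδ
    rw [ENNReal.tendsto_nhds_zero]
    intro ε hε
    obtain ⟨ε', hε', hε'le⟩ : ∃ ε' : ℝ, 0 < ε' ∧ ENNReal.ofReal ε' ≤ ε := by
      obtain ⟨q, hq0, hq⟩ := ENNReal.lt_iff_exists_real_btwn.1 hε
      exact ⟨q, ENNReal.ofReal_pos.1 hq.1, hq.2.le⟩
    obtain ⟨C, hC, hev⟩ := h ε' hε'
    have hsmall : ∀ᶠ n in atTop, C * d n < δ := by
      have := hd0.const_mul C
      rw [mul_zero] at this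
      exact this.eventually_lt_const hδ
    filter_upwards [hev, hsmall] with n h1 h2
    refine le_trans (measure_mono fun ω hω => ?_) (h1.trans hε'le)
    have hω : δ ≤ ‖F n ω - c‖ := hω
    exact h2.trans_le hω
  · obtain ⟨n₀, hn₀⟩ := eventually_atTop.1 (hd.and hF)
    -- The value 0 is used for early n, where `F n` need not be measurable and `d n` need not be
    -- positive.
    refine ⟨fun n ω => if n₀ ≤ n then (F n ω - c) / d n else 0,
      isBoundedInProb_of_eventually (fun n => ?_) fun ε hε => ?_, ?_⟩
    · by_cases hn : n₀ ≤ n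
      · simp only [hn, if_true]
        exact ((hn₀ n hn).2.sub_const c).div_const _
      · simp only [hn, if_false]
        exact aemeasurable_const
    · obtain ⟨C, hC, hev⟩ := h ε hε
      refine ⟨C, hC, ?_⟩
      filter_upwards [hev, eventually_ge_atTop n₀] with n h1 hn
      refine le_trans (measure_mono fun ω hω => ?_) h1
      have hω : C < |if n₀ ≤ n then (F n ω - c) / d n else 0| := hω
      have hdn := (hn₀ n hn).1
      rw [if_pos hn, abs_div, abs_of_pos hdn, lt_div_iff₀ hdn] at hω
      exact hω
    · filter_upwards [eventually_ge_atTop n₀] with n hn ω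
      rw [if_pos hn, mul_div_cancel₀ _ (hn₀ n hn).1.ne']

end

/-! ### The rate -/

/-- The rate `rate h γ` as a maximum, at real scales. -/
noncomputable def maxRate (h γ r : ℝ) : ℝ := max (r ^ (h - γ)) (r ^ ((γ - 1) / 2))

/-- The exponents h - γ and (γ - 1)/2 cross exactly at γ = (1 + 2h)/3. -/
lemma rate_eq_maxRate (h γ : ℝ) {n : ℕ} (hn : 1 ≤ n) : rate h γ n = maxRate h γ n := by
  have hn1 : (1 : ℝ) ≤ n := by exact_mod_cast hn
  rw [rate, maxRate]
  split_ifs with hc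
  · rw [max_eq_left (Real.rpow_le_rpow_of_exponent_le hn1 (by linarith))]
  · push Not at hc
    rw [max_eq_right (Real.rpow_le_rpow_of_exponent_le hn1 (by linarith))]

lemma maxRate_pos (h γ : ℝ) {r : ℝ} (hr : 0 < r) : 0 < maxRate h γ r :=
  lt_max_of_lt_left (Real.rpow_pos_of_pos hr _)

lemma tendsto_maxRate {h γ : ℝ} (hγ : h < γ) (hγ1 : γ < 1) :
    Tendsto (maxRate h γ) atTop (𝓝 0) := by
  have h1 : Tendsto (fun r : ℝ => r ^ (h - γ)) atTop (𝓝 0) := by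
    have := tendsto_rpow_neg_atTop (sub_pos.2 hγ)
    rwa [neg_sub] at this
  have h2 : Tendsto (fun r : ℝ => r ^ ((γ - 1) / 2)) atTop (𝓝 0) := by
    have := tendsto_rpow_neg_atTop (show 0 < (1 - γ) / 2 by linarith)
    rwa [show -((1 - γ) / 2) = (γ - 1) / 2 by ring] at this
  have h3 := h1.max h2
  rw [max_self] at h3
  exact h3

/-- Both exponents are at least -1, so halving the scale costs at most a factor 2; needed for the
numerator of the estimator. -/
lemma maxRate_half_le {h γ : ℝ} (h0 : 0 < h) (hγ : h < γ) (hγ1 : γ < 1) {r : ℝ} (hr : 0 < r) :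
    maxRate h γ (r / 2) ≤ 2 * maxRate h γ r := by
  have key : ∀ e : ℝ, -1 ≤ e → (r / 2) ^ e ≤ 2 * r ^ e := fun e he => by
    rw [Real.div_rpow hr.le two_pos.le, div_eq_mul_inv, ← Real.rpow_neg two_pos.le, mul_comm]
    gcongr
    calc (2 : ℝ) ^ (-e) ≤ 2 ^ (1 : ℝ) :=
          Real.rpow_le_rpow_of_exponent_le one_le_two (by linarith)
      _ = 2 := Real.rpow_one 2
  refine max_le ((key _ (by linarith)).trans ?_) ((key _ (by linarith)).trans ?_)
  · exact mul_le_mul_of_nonneg_left (le_max_left _ _) two_pos.le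
  · exact mul_le_mul_of_nonneg_left (le_max_right _ _) two_pos.le

/-! ### The local power variation -/

lemma abs_log_sub_log_le {x m : ℝ} (hm : 0 < m) (hx : |x - m| ≤ m / 2) :
    |Real.log x - Real.log m| ≤ 2 / m * |x - m| := by
  have hx2 : m / 2 ≤ x := by linarith [(abs_le.1 hx).1]
  have hx0 : 0 < x := by linarith
  rw [← Real.log_div hx0.ne' hm.ne', abs_le]
  constructor
  · have h1 := Real.one_sub_inv_le_log_of_pos (div_pos hx0 hm)
    rw [inv_div] at h1
    have h2 : 1 - m / x = (x - m) / x := by field_simp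
    have h3 : |x - m| / x ≤ 2 / m * |x - m| := by
      rw [div_le_iff₀ hx0]
      calc |x - m| = 2 / m * |x - m| * (m / 2) := by field_simp
        _ ≤ _ := by gcongr
    have h4 : -(|x - m| / x) ≤ (x - m) / x := by
      rw [← neg_div]
      gcongr
      exact neg_abs_le _
    linarith
  · have h1 := Real.log_le_sub_one_of_pos (div_pos hx0 hm)
    have h2 : x / m - 1 = (x - m) / m := by field_simp
    have h3 : (x - m) / m ≤ |x - m| / m := by gcongr; exact le_abs_self _
    have h4 : |x - m| / m ≤ 2 / m * |x - m| := by
      rw [div_mul_eq_mul_div]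
      gcongr
      linarith [abs_nonneg (x - m)]
    linarith

section

variable {Ω : Type*} {K : ℕ} {a : Fin (K + 1) → ℝ} {X : ℝ → Ω → ℝ} {H : ℝ → ℝ} {γ β t₀ : ℝ}

lemma V_eq_sum {r : ℝ} (hr : 0 < r) (ω : Ω) :
    V a X γ β t₀ r ω = 1 / ((finite_window K γ t₀ hr).toFinset.card : ℝ) *
      ∑ k ∈ (finite_window K γ t₀ hr).toFinset, |variation a X r k ω| ^ β := by
  rw [V, Set.ncard_eq_toFinset_card _ (finite_window K γ t₀ hr),
    finsum_mem_eq_finite_toFinset_sum _ (finite_window K γ t₀ hr)]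

lemma rpow_mul_variation (h : ℝ) (r : ℝ) (k : ℤ) (ω : Ω) :
    r ^ h * variation a X r k ω =
      ∑ p : Fin (K + 1), (r ^ h * a p) * X (((k : ℝ) + (p : ℕ)) / r) ω := by
  rw [variation, Finset.mul_sum]
  exact Finset.sum_congr rfl fun p _ => by ring

lemma W_eq_sum {r : ℝ} (hr : 0 < r) (ω : Ω) :
    W a H X γ β t₀ r ω = 1 / ((finite_window K γ t₀ hr).toFinset.card : ℝ) *
      ∑ k ∈ (finite_window K γ t₀ hr).toFinset, |r ^ H t₀ * variation a X r k ω| ^ β := by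
  rw [W, V_eq_sum hr, mul_left_comm, Finset.mul_sum]
  congr 1
  refine Finset.sum_congr rfl fun k _ => ?_
  rw [abs_mul, abs_of_pos (Real.rpow_pos_of_pos hr _), Real.mul_rpow (by positivity) (abs_nonneg _),
    ← Real.rpow_mul hr.le, mul_comm β]

/-- The ratio of the V's is the ratio of the W's times 2^(βh), so the error of the estimator is (log
W_{r/2} - log W_r)/(β log 2); the logarithm is Lipschitz near m > 0. -/
lemma abs_HHat_sub_le {m r : ℝ} (hβ : β ≠ 0) (hm : 0 < m) (hr : 0 < r) {ω : Ω}
    (h1 : |W a H X γ β t₀ r ω - m| ≤ m / 2) (h2 : |W a H X γ β t₀ (r / 2) ω - m| ≤ m / 2) :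
    |HHat a X γ β t₀ r ω - H t₀| ≤ 2 / (|β| * Real.log 2 * m) *
      (|W a H X γ β t₀ (r / 2) ω - m| + |W a H X γ β t₀ r ω - m|) := by
  set x := W a H X γ β t₀ (r / 2) ω with hx
  set y := W a H X γ β t₀ r ω with hy
  have hx0 : 0 < x := by linarith [(abs_le.1 h2).1]
  have hy0 : 0 < y := by linarith [(abs_le.1 h1).1]
  have hlog2 : 0 < Real.log 2 := Real.log_pos one_lt_two
  have e : V a X γ β t₀ (r / 2) ω / V a X γ β t₀ r ω = x / y * 2 ^ (β * H t₀) := by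
    have h3 : x = (r / 2) ^ (β * H t₀) * V a X γ β t₀ (r / 2) ω := hx
    have h4 : y = r ^ (β * H t₀) * V a X γ β t₀ r ω := hy
    rw [h3, h4, Real.div_rpow hr.le two_pos.le]
    have : r ^ (β * H t₀) ≠ 0 := (Real.rpow_pos_of_pos hr _).ne'
    have : (2 : ℝ) ^ (β * H t₀) ≠ 0 := by positivity
    have : V a X γ β t₀ r ω ≠ 0 := fun h => by rw [h4, h, mul_zero] at hy0; exact hy0.false
    field_simp
  have e2 : HHat a X γ β t₀ r ω - H t₀ =
      1 / (β * Real.log 2) * ((Real.log x - Real.log m) - (Real.log y - Real.log m)) := by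
    rw [HHat, e, Real.logb, Real.log_mul (by positivity) (by positivity),
      Real.log_div hx0.ne' hy0.ne', Real.log_rpow two_pos]
    field_simp
    ring
  rw [e2, abs_mul, abs_div, abs_one, abs_mul, abs_of_pos hlog2]
  calc _ ≤ 1 / (|β| * Real.log 2) * (2 / m * |x - m| + 2 / m * |y - m|) := by
        gcongr
        exact (abs_sub _ _).trans
          (add_le_add (abs_log_sub_log_le hm h2) (abs_log_sub_log_le hm h1))
    _ = _ := by
        have : |β| ≠ 0 := abs_ne_zero.2 hβ
        field_simp

end

section

variable {Ω : Type*} [MeasurableSpace Ω] {μ : Measure Ω}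
  {v : ℝ} {M : Set ℝ → Ω → ℝ} {U : Set ℝ} {H : ℝ → ℝ} {X : ℝ → Ω → ℝ} {t₀ : ℝ} {K : ℕ}
  {a : Fin (K + 1) → ℝ} {γ β : ℝ}

lemma scaleConst_eq (a : Fin (K + 1) → ℝ) (h : ℝ) :
    scaleConst a h = √(∫ x, filteredPow a (h - 1 / 2) x ^ 2) := by
  simp only [scaleConst, filteredPow, sq_abs, Real.sqrt_eq_rpow]

lemma IsMultifractionalBM.aemeasurable_variation (hX : IsMultifractionalBM μ M U H X) {r : ℝ} {k : ℤ}
    (hk : ∀ p : Fin (K + 1), ((k : ℝ) + (p : ℕ)) / r ∈ U) : AEMeasurable (variation a X r k) μ :=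
  Finset.aemeasurable_fun_sum _ fun p _ =>
    (hX _ (hk p)).2.1.aestronglyMeasurable.aemeasurable.const_mul _

lemma IsMultifractionalBM.aemeasurable_V (hX : IsMultifractionalBM μ M U H X) {r : ℝ} (hr : 0 < r)
    (hk : ∀ k ∈ window K γ t₀ r, ∀ p : Fin (K + 1), ((k : ℝ) + (p : ℕ)) / r ∈ U) :
    AEMeasurable (V a X γ β t₀ r) μ := by
  simp only [funext (V_eq_sum (a := a) (X := X) (β := β) hr)]
  refine (Finset.aemeasurable_fun_sum _ fun k hkS => ?_).const_mul _
  have := hX.aemeasurable_variation (a := a) (hk k ((Set.Finite.mem_toFinset _).1 hkS))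
  exact (measurable_id.abs.pow_const β).comp_aemeasurable this

lemma IsMultifractionalBM.aemeasurable_HHat (hX : IsMultifractionalBM μ M U H X) {r : ℝ} (hr : 0 < r)
    (hk : ∀ k ∈ window K γ t₀ r, ∀ p : Fin (K + 1), ((k : ℝ) + (p : ℕ)) / r ∈ U)
    (hk2 : ∀ k ∈ window K γ t₀ (r / 2), ∀ p : Fin (K + 1), ((k : ℝ) + (p : ℕ)) / (r / 2) ∈ U) :
    AEMeasurable (HHat a X γ β t₀ r) μ := by
  have h := (hX.aemeasurable_V (a := a) (β := β) (half_pos hr) hk2).div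
    (hX.aemeasurable_V (a := a) (β := β) hr hk)
  exact ((Real.measurable_log.div_const (Real.log 2)).comp_aemeasurable h).const_mul _

variable [IsProbabilityMeasure μ]

lemma IsMultifractionalBM.hasGaussianLaw_variation_pair (hM : IsGaussianRandomMeasure μ v M)
    (hv : 0 ≤ v) (hX : IsMultifractionalBM μ M U H X) (h r : ℝ) {k k' : ℤ}
    (hk : ∀ p : Fin (K + 1), ((k : ℝ) + (p : ℕ)) / r ∈ U)
    (hk' : ∀ p : Fin (K + 1), ((k' : ℝ) + (p : ℕ)) / r ∈ U) :
    HasGaussianLaw (fun ω => (r ^ h * variation a X r k ω, r ^ h * variation a X r k' ω)) μ ∧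
    ∫ ω, r ^ h * variation a X r k ω ∂μ = 0 ∧
    Var[fun ω => r ^ h * variation a X r k ω; μ] =
      v * √(∫ s, variationKernel a H h r k s ^ 2) ^ 2 ∧
    cov[fun ω => r ^ h * variation a X r k ω, fun ω => r ^ h * variation a X r k' ω; μ] =
      v * ∫ s, variationKernel a H h r k s * variationKernel a H h r k' s := by
  rw [Real.sq_sqrt (integral_nonneg fun _ => sq_nonneg _)]
  simp only [rpow_mul_variation]
  exact hM.hasGaussianLaw_pair hv (fun p => hX _ (hk p)) (fun p => hX _ (hk' p))
    (fun p => r ^ h * a p) (fun p => r ^ h * a p)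

/-- Non-degeneracy of the variations and the second moment bound for the power variation. -/
lemma IsMultifractionalBM.exists_integral_sq_W_sub_le (hM : IsGaussianRandomMeasure μ v M)
    (hv : 0 < v) (hX : IsMultifractionalBM μ M U H X) (ht₀ : t₀ ∈ interior U)
    (hH : DifferentiableAt ℝ H t₀) (hH0 : 0 < H t₀) (hH1 : H t₀ < 1) (hH2 : H t₀ ≠ 1 / 2)
    (h0 : ∑ p, a p = 0) (h1 : ∑ p : Fin (K + 1), ((p : ℕ) : ℝ) * a p = 0) (ha : ∃ p, a p ≠ 0)
    (hγ : H t₀ < γ) (hγ1 : γ < 1) (hβ : -1 / 2 < β) (hβ0 : β < 0) :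
    0 < limitConst a (H t₀) v β ∧
    (∀ᶠ r : ℝ in atTop, ∀ k ∈ window K γ t₀ r, ∀ᵐ ω ∂μ, variation a X r k ω ≠ 0) ∧
    ∃ A : ℝ, 0 ≤ A ∧ ∀ᶠ r : ℝ in atTop,
      Integrable (fun ω => (W a H X γ β t₀ r ω - limitConst a (H t₀) v β) ^ 2) μ ∧
      ∫ ω, (W a H X γ β t₀ r ω - limitConst a (H t₀) v β) ^ 2 ∂μ ≤ A * maxRate (H t₀) γ r ^ 2 := by
  have hL2 : MemLp (filteredPow a (H t₀ - 1 / 2)) 2 volume :=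
    memLp_filteredPow h0 h1 (by linarith) (by linarith)
  have hpos := integral_filteredPow_sq_pos hL2 (sub_ne_zero.2 hH2) (by linarith) ha
  obtain ⟨s, hs⟩ : ∃ s, s = √(∫ x, filteredPow a (H t₀ - 1 / 2) x ^ 2) := ⟨_, rfl⟩
  have hs0 : 0 < s := hs ▸ Real.sqrt_pos.2 hpos
  have hm : limitConst a (H t₀) v β = (√v * s) ^ β * normalAbsMoment β := by
    rw [limitConst_eq a hv (by linarith) hβ0, scaleConst_eq, hs]
  have hm0 : 0 < normalAbsMoment β := normalAbsMoment_pos (by linarith)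
  obtain ⟨C₀, hC₀, hdec⟩ := exists_abs_filteredPow_le_of_large (α := H t₀ - 1 / 2) h0 h1 (by linarith)
  have hR := summable_sq_integral_mul_comp_sub
    (integrable_filteredPow (α := H t₀ - 1 / 2) h0 h1 (by linarith) (by linarith)) hC₀
    (by positivity : (0 : ℝ) < 2 * K + 1) hdec
  obtain ⟨A, hA, hbound⟩ := exists_integral_sq_average_sub_le (μ := μ) hv hs0 hβ hβ0 hR
  obtain ⟨C, hC, hest⟩ := exists_variationKernel_estimate ht₀ hH hH0 hH1 h0 h1 hγ
    fun t ht => (hX t ht).1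
  obtain ⟨_, _, hpts⟩ := eventually_sampling_points ht₀ hH K (hH0.trans hγ)
  rw [← hs] at hest
  have hsmall : ∀ᶠ r : ℝ in atTop, C * r ^ (H t₀ - γ) ≤ s / 2 := by
    have h2 : Tendsto (fun r : ℝ => r ^ (H t₀ - γ)) atTop (𝓝 0) := by
      have := tendsto_rpow_neg_atTop (sub_pos.2 hγ)
      rwa [neg_sub] at this
    have h3 := h2.const_mul C
    rw [mul_zero] at h3
    exact h3.eventually_le_const (half_pos hs0)
  refine ⟨by rw [hm]; positivity, ?_, A * (C ^ 2 + 1), by positivity, ?_⟩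
  · filter_upwards [hest, hpts, hsmall, eventually_gt_atTop 0] with r hr hp he hr0 k hk
    obtain ⟨hG, hmean, hvar, -⟩ := hX.hasGaussianLaw_variation_pair (a := a) hM hv.le (H t₀) r
      (fun p => (hp k hk p).1) fun p => (hp k hk p).1
    -- The standard deviation factor is within s/2 of s > 0, so the Gaussian law is not degenerate
    -- and has no atom at 0.
    have hτ : 0 < √(∫ s, variationKernel a H (H t₀) r k s ^ 2) := by
      linarith [(abs_le.1 (hr k hk).1).1]
    have hmap := hG.fst.map_eq_gaussianReal
    rw [hmean, hvar] at hmap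
    have hne : (v * √(∫ s, variationKernel a H (H t₀) r k s ^ 2) ^ 2).toNNReal ≠ 0 :=
      (Real.toNNReal_pos.2 (by positivity)).ne'
    have hae := ae_ne_zero_gaussianReal hne
    rw [← hmap] at hae
    filter_upwards [ae_of_ae_map hG.fst.aemeasurable hae] with ω hω h
    exact hω (by rw [h, mul_zero])
  · filter_upwards [hest, hpts, hsmall, eventually_gt_atTop 0,
      eventually_rpow_le_ncard_window K hγ1 t₀] with r hr hp he hr0 hcard
    obtain ⟨S, hS⟩ : ∃ S, S = (finite_window K γ t₀ hr0).toFinset := ⟨_, rfl⟩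
    have hmem : ∀ k ∈ S, k ∈ window K γ t₀ r := fun k hk => by
      rw [hS] at hk
      exact (Set.Finite.mem_toFinset _).1 hk
    rw [Set.ncard_eq_toFinset_card _ (finite_window K γ t₀ hr0), ← hS] at hcard
    have hrpos := Real.rpow_pos_of_pos hr0 (1 - γ)
    have hSne : S.Nonempty := Finset.card_pos.1 (by exact_mod_cast hrpos.trans_le hcard)
    have hlaw : ∀ i ∈ S, ∀ j ∈ S, _ := fun i hi j hj =>
      hX.hasGaussianLaw_variation_pair (a := a) hM hv.le (H t₀) r
        (fun p => (hp i (hmem i hi) p).1) fun p => (hp j (hmem j hj) p).1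
    obtain ⟨hI, hle⟩ := hbound S (fun k ω => r ^ H t₀ * variation a X r k ω)
      (fun k => √(∫ s, variationKernel a H (H t₀) r k s ^ 2))
      (fun k k' => ∫ s, variationKernel a H (H t₀) r k s * variationKernel a H (H t₀) r k' s)
      (C * r ^ (H t₀ - γ)) hSne (fun i hi j hj => (hlaw i hi j hj).1)
      (fun i hi => (hlaw i hi i hi).2.1) (fun i hi => (hlaw i hi i hi).2.2.1)
      (fun i hi => (hr i (hmem i hi)).1) (fun i hi j hj => (hlaw i hi j hj).2.2.2)
      (fun i hi j hj => (hr i (hmem i hi)).2 j (hmem j hj)) he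
    rw [hm]
    simp only [W_eq_sum hr0, ← hS]
    refine ⟨hI, hle.trans ?_⟩
    rw [mul_assoc]
    refine mul_le_mul_of_nonneg_left ?_ hA
    have e1 : r ^ (H t₀ - γ) ≤ maxRate (H t₀) γ r := le_max_left _ _
    have e2 : r ^ ((γ - 1) / 2) ≤ maxRate (H t₀) γ r := le_max_right _ _
    -- The second half of the rate: (1/N)^(1/2) ≤ r^((γ-1)/2) since N ≥ r^(1-γ).
    have e3 : 1 / (S.card : ℝ) ≤ (r ^ ((γ - 1) / 2)) ^ 2 := by
      rw [← Real.rpow_natCast, ← Real.rpow_mul hr0.le,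
        show (γ - 1) / 2 * ((2 : ℕ) : ℝ) = -(1 - γ) by push_cast; ring, Real.rpow_neg hr0.le,
        ← one_div]
      exact one_div_le_one_div_of_le hrpos hcard
    have e4 : (r ^ (H t₀ - γ)) ^ 2 ≤ maxRate (H t₀) γ r ^ 2 :=
      pow_le_pow_left₀ (Real.rpow_nonneg hr0.le _) e1 2
    have e5 : (r ^ ((γ - 1) / 2)) ^ 2 ≤ maxRate (H t₀) γ r ^ 2 :=
      pow_le_pow_left₀ (Real.rpow_nonneg hr0.le _) e2 2
    rw [mul_pow]
    nlinarith [mul_le_mul_of_nonneg_left e4 (sq_nonneg C)]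

lemma measure_rate_lt_abs_W_sub_le {A m h r : ℝ} (hr : 0 < r)
    (hI : Integrable (fun ω => (W a H X γ β t₀ r ω - m) ^ 2) μ)
    (hle : ∫ ω, (W a H X γ β t₀ r ω - m) ^ 2 ∂μ ≤ A * maxRate h γ r ^ 2) {C : ℝ} (hC : 0 < C) :
    μ {ω | C * maxRate h γ r < |W a H X γ β t₀ r ω - m|} ≤ ENNReal.ofReal (A / C ^ 2) := by
  have hd := maxRate_pos h γ hr
  refine (measure_lt_abs_le_of_integral_sq_le hI hle (mul_pos hC hd)).trans_eq ?_
  rw [mul_pow, mul_div_mul_right _ _ (by positivity)]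

lemma exists_div_sq_le {A ε : ℝ} (hA : 0 ≤ A) (hε : 0 < ε) : ∃ C : ℝ, 0 < C ∧ A / C ^ 2 ≤ ε := by
  refine ⟨A / ε + 1, by positivity, ?_⟩
  rw [div_le_iff₀ (by positivity)]
  have h1 : ε * (A / ε) = A := mul_div_cancel₀ _ hε.ne'
  have h2 : 0 ≤ A / ε := by positivity
  nlinarith [mul_nonneg hε.le (sq_nonneg (A / ε))]

end

end MultifracBM

/-! ### Consistency and rates for the power variation and the estimator -/

theorem theorem1 {Ω : Type*} [MeasurableSpace Ω] (μ : Measure Ω) [IsProbabilityMeasure μ]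
    -- the Gaussian random measure; `v = 1` is the standard one
    (v : ℝ) (hv : 0 < v) (M : Set ℝ → Ω → ℝ) (hM : IsGaussianRandomMeasure μ v M)
    -- the multifractional Brownian motion
    (U : Set ℝ) (hU : U.OrdConnected) (hUc : IsClosed U)
    (H : ℝ → ℝ) (hH : ∀ t ∈ U, H t ∈ Set.Ioo (0 : ℝ) 1) (hHs : ContDiffOn ℝ ((⊤ : ℕ∞) : WithTop ℕ∞) H U)
    (X : ℝ → Ω → ℝ) (hX : IsMultifractionalBM μ M U H X)
    (t₀ : ℝ) (ht₀ : t₀ ∈ interior U) (hHt₀ : H t₀ ≠ 1 / 2)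
    -- the sequence `a` with exactly `L` vanishing first moments
    (L K : ℕ) (hL : 1 ≤ L) (hK : 1 ≤ K) (a : Fin (K + 1) → ℝ)
    (ha : ∀ q ≤ L, ∑ k : Fin (K + 1), ((k : ℕ) : ℝ) ^ q * a k = 0)
    (ha' : ∑ k : Fin (K + 1), ((k : ℕ) : ℝ) ^ (L + 1) * a k ≠ 0)
    (γ : ℝ) (hγ : sSup (H '' U) < γ) (hγ1 : γ < 1)
    (β : ℝ) (hβ : β ∈ Set.Ioo (-1 / 2 : ℝ) 0) :
    -- at all large scales the sampling points lie in `U`, the window is finite and non-empty and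
    -- the variations are almost surely non-zero, so that their negative powers make sense
    (∀ᶠ r : ℝ in atTop, (window K γ t₀ r).Finite ∧ (window K γ t₀ r).Nonempty ∧
      ∀ k ∈ window K γ t₀ r,
        (∀ p : Fin (K + 1), ((k : ℝ) + (p : ℕ)) / r ∈ U) ∧ ∀ᵐ ω ∂μ, variation a X r k ω ≠ 0) ∧
    (TendstoInMeasure μ (fun (n : ℕ) ω => W a H X γ β t₀ n ω) atTop
        (fun _ => limitConst a (H t₀) v β) ∧
      IsBigOInProb μ (fun (n : ℕ) ω => W a H X γ β t₀ n ω - limitConst a (H t₀) v β)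
        (rate (H t₀) γ)) ∧
    (TendstoInMeasure μ (fun (n : ℕ) ω => HHat a X γ β t₀ n ω) atTop (fun _ => H t₀) ∧
      IsBigOInProb μ (fun (n : ℕ) ω => HHat a X γ β t₀ n ω - H t₀) (rate (H t₀) γ)) := by
  have hUt : U ∈ 𝓝 t₀ := mem_interior_iff_mem_nhds.1 ht₀
  have htU : t₀ ∈ U := interior_subset ht₀
  obtain ⟨hH0, hH1⟩ := hH t₀ htU
  have hγH : H t₀ < γ := by
    refine (le_csSup ⟨1, ?_⟩ (Set.mem_image_of_mem H htU)).trans_lt hγ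
    rintro _ ⟨t, ht, rfl⟩
    exact (hH t ht).2.le
  have hdiff : DifferentiableAt ℝ H t₀ :=
    (hHs.differentiableOn (by simp)).differentiableAt hUt
  have h0 : ∑ p, a p = 0 := by simpa using ha 0 (Nat.zero_le L)
  have h1 : ∑ p : Fin (K + 1), ((p : ℕ) : ℝ) * a p = 0 := by simpa using ha 1 hL
  have hne : ∃ p, a p ≠ 0 := by
    by_contra! h
    exact ha' (Finset.sum_eq_zero fun p _ => by rw [h p, mul_zero])
  obtain ⟨hm, hnz, A, hA, hWr⟩ := hX.exists_integral_sq_W_sub_le hM hv ht₀ hdiff hH0 hH1 hHt₀ h0 h1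
    hne hγH hγ1 hβ.1 hβ.2
  obtain ⟨_, _, hpts⟩ := eventually_sampling_points ht₀ hdiff K (hH0.trans hγH)
  obtain ⟨m, hmdef⟩ : ∃ m, m = limitConst a (H t₀) v β := ⟨_, rfl⟩
  rw [← hmdef] at hm hWr ⊢
  have hcast : Tendsto (fun n : ℕ => (n : ℝ)) atTop atTop := tendsto_natCast_atTop_atTop
  have hhalf : Tendsto (fun n : ℕ => (n : ℝ) / 2) atTop atTop := hcast.atTop_div_const two_pos
  have hrate : rate (H t₀) γ =ᶠ[atTop] fun n : ℕ => maxRate (H t₀) γ n :=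
    (eventually_ge_atTop 1).mono fun n hn => rate_eq_maxRate _ _ hn
  have hd : ∀ᶠ n in atTop, 0 < rate (H t₀) γ n := by
    filter_upwards [hrate, eventually_ge_atTop 1] with n hn hn1
    rw [hn]
    exact maxRate_pos _ _ (by exact_mod_cast hn1)
  have hd0 : Tendsto (rate (H t₀) γ) atTop (𝓝 0) :=
    ((tendsto_maxRate hγH hγ1).comp hcast).congr' hrate.symm
  have hWm : ∀ᶠ n : ℕ in atTop, AEMeasurable (fun ω => W a H X γ β t₀ n ω) μ := by
    filter_upwards [hcast.eventually hpts, eventually_ge_atTop 1] with n hp hn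
    exact (hX.aemeasurable_V (by exact_mod_cast hn) fun k hk p => (hp k hk p).1).const_mul _
  have hHm : ∀ᶠ n : ℕ in atTop, AEMeasurable (fun ω => HHat a X γ β t₀ n ω) μ := by
    filter_upwards [hcast.eventually hpts, hhalf.eventually hpts, eventually_ge_atTop 1]
      with n hp hp2 hn
    exact hX.aemeasurable_HHat (by exact_mod_cast hn) (fun k hk p => (hp k hk p).1)
      fun k hk p => (hp2 k hk p).1
  refine ⟨?_, tendstoInMeasure_and_isBigOInProb hd hd0 hWm fun ε hε => ?_,
    tendstoInMeasure_and_isBigOInProb hd hd0 hHm fun ε hε => ?_⟩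
  · filter_upwards [hpts, hnz, eventually_gt_atTop 0, eventually_rpow_le_ncard_window K hγ1 t₀]
      with r hp hz hr hcard
    refine ⟨finite_window K γ t₀ hr, Set.nonempty_of_ncard_ne_zero fun h => ?_,
      fun k hk => ⟨fun p => (hp k hk p).1, hz k hk⟩⟩
    rw [h, Nat.cast_zero] at hcard
    exact (Real.rpow_pos_of_pos hr _).not_ge hcard
  · obtain ⟨C, hC, hCle⟩ := exists_div_sq_le hA hε
    refine ⟨C, hC, ?_⟩
    filter_upwards [hrate, hcast.eventually hWr, eventually_ge_atTop 1] with n hn hW hn1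
    rw [hn]
    exact (measure_rate_lt_abs_W_sub_le (by exact_mod_cast hn1) hW.1 hW.2 hC).trans
      (ENNReal.ofReal_le_ofReal hCle)
  · obtain ⟨C, hC, hCle⟩ := exists_div_sq_le hA (half_pos hε)
    obtain ⟨B, hB⟩ : ∃ B, B = 2 / (|β| * Real.log 2 * m) := ⟨_, rfl⟩
    have hβ0 : 0 < |β| := abs_pos.2 hβ.2.ne
    have hB0 : 0 < B := by
      have := Real.log_pos one_lt_two
      rw [hB]
      positivity
    -- The factor 3 is 1 for the error at scale n plus 2 for scale n/2, where the rate may be twice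
    -- as large.
    refine ⟨B * (3 * C), by positivity, ?_⟩
    -- Eventually both W's lie within m/2 of m off the exceptional events, as the logarithmic
    -- linearization requires.
    have hsmall : ∀ᶠ n in atTop, 2 * C * rate (H t₀) γ n < m / 2 := by
      have := hd0.const_mul (2 * C)
      rw [mul_zero] at this
      exact this.eventually_lt_const (half_pos hm)
    filter_upwards [hrate, hcast.eventually hWr, hhalf.eventually hWr, hsmall,
      eventually_ge_atTop 1] with n hn hW hW2 hsm hn1
    have hn0 : (0 : ℝ) < n := by exact_mod_cast hn1
    rw [hn] at hsm ⊢
    have hd2 := maxRate_half_le hH0 hγH hγ1 hn0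
    have hd1 := maxRate_pos (H t₀) γ hn0
    calc μ {ω | B * (3 * C) * maxRate (H t₀) γ n < |HHat a X γ β t₀ n ω - H t₀|}
        ≤ μ ({ω | C * maxRate (H t₀) γ n < |W a H X γ β t₀ n ω - m|} ∪
            {ω | C * maxRate (H t₀) γ (n / 2) < |W a H X γ β t₀ (n / 2) ω - m|}) := by
          refine measure_mono fun ω hω => ?_
          by_contra hcon
          have hw1 : |W a H X γ β t₀ n ω - m| ≤ C * maxRate (H t₀) γ n :=
            not_lt.1 fun h => hcon (Or.inl h)
          have hw2 : |W a H X γ β t₀ (n / 2) ω - m| ≤ C * maxRate (H t₀) γ (n / 2) :=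
            not_lt.1 fun h => hcon (Or.inr h)
          have hw3 : C * maxRate (H t₀) γ (n / 2) ≤ C * (2 * maxRate (H t₀) γ n) :=
            mul_le_mul_of_nonneg_left hd2 hC.le
          have hCd := mul_pos hC hd1
          have key := abs_HHat_sub_le (a := a) (X := X) (H := H) (γ := γ) (t₀ := t₀) (ω := ω)
            hβ.2.ne hm hn0 (by linarith) (by linarith)
          rw [← hB] at key
          have hω : B * (3 * C) * maxRate (H t₀) γ n < |HHat a X γ β t₀ n ω - H t₀| := hω
          have h2 : B * (|W a H X γ β t₀ (n / 2) ω - m| + |W a H X γ β t₀ n ω - m|) ≤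
              B * (3 * (C * maxRate (H t₀) γ n)) :=
            mul_le_mul_of_nonneg_left (by linarith) hB0.le
          linarith
      _ ≤ ENNReal.ofReal (A / C ^ 2) + ENNReal.ofReal (A / C ^ 2) :=
          (measure_union_le _ _).trans (add_le_add
            (measure_rate_lt_abs_W_sub_le hn0 hW.1 hW.2 hC)
            (measure_rate_lt_abs_W_sub_le (half_pos hn0) hW2.1 hW2.2 hC))
      _ ≤ ENNReal.ofReal ε := by
          rw [← ENNReal.ofReal_add (by positivity) (by positivity)]
          exact ENNReal.ofReal_le_ofReal (by linarith)
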